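/- Let $0<r\le q<p<1$. There are constants $c_1,c_2\in(0,\infty)$ depending only on $p,q,r$ such that the following holds for all $0\le a<b\le\infty$ and all weights $u,v,w$ on $(a,b)$ (measurable functions that are positive and finite a.e. on $(a,b)$) with $0<\mathcal W(x)<\infty$ for all $x\in(a,b)$, where $\mathcal W(x)=\int_x^b w$ for $x\in[a,b]$. Put $V_r(x,y)=\big(\int_x^y v^{\frac1{1-r}}\big)^{\frac{1-r}{r}}$ for $a\le x<y\le b$, and $$ \begin{aligned} \mathcal C_5 &= \bigg(\int_a^b \mathcal W(x)^{-\frac p{p-q}}\,w(x)\bigg(\int_x^b\Big(\int_t^b u\Big)^{\frac q{1-q}}u(t)\,V_r(x,t)^{\frac q{1-q}}\,dt\bigg)^{\frac{p(1-q)}{p-q}}dx\bigg)^{\frac{p-q}{pq}}\\ &\qquad+\mathcal W(a)^{-\frac1p}\bigg(\int_a^b\Big(\int_t^b u\Big)^{\frac q{1-q}}u(t)\,V_r(a,t)^{\frac q{1-q}}\,dt\bigg)^{\frac{1-q}q},\\ \mathcal C_6 &= \bigg(\int_a^b\Big(\int_x^b u\Big)^{\frac q{p-q}}u(x)\bigg(\int_a^x\mathcal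 W(t)^{-\frac p{p-r}}\,w(t)\,V_r(t,x)^{\frac{pr}{p-r}}\,dt\bigg)^{\frac{q(p-r)}{r(p-q)}}dx\bigg)^{\frac{p-q}{pq}}, \end{aligned} $$ with values in $[0,\infty]$ and the conventions $1/\infty=0$, $0\cdot\infty=0$. Then there is a constant $C<\infty$ such that $$ \bigg(\int_a^b\Big(\int_a^t f(s)^r v(s)\,ds\Big)^{\frac qr}u(t)\,dt\bigg)^{\frac1q}\le C\bigg(\int_a^b\Big(\int_a^t f(s)\,ds\Big)^{p}w(t)\,dt\bigg)^{\frac1p} $$ holds for all non-negative measurable functions $f$ on $(a,b)$ if and only if $\max\{\mathcal C_5,\mathcal C_6\}<\infty$. Moreover, the best (least) constant $C\in[0,\infty]$ in this inequality satisfies $$c_1(\mathcal C_5+\mathcal C_6)\le C\le c_2(\mathcal C_5+\mathcal C_6).$$ -/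

import Mathlib

open MeasureTheory
open scoped ENNReal NNReal

namespace CesaroEmbedding

noncomputable section

/-- The real points strictly between two extended reals `x` and `y`. -/
def interval (x y : EReal) : Set ℝ := {s : ℝ | x < (s : EReal) ∧ (s : EReal) < y}

/-- The integral of `g` over `(x, y)` against Lebesgue measure, with values in `[0, ∞]`. -/
def integral (x y : EReal) (g : ℝ → ℝ≥0∞) : ℝ≥0∞ := ∫⁻ s in interval x y, g s

/-- Non-negative Lebesgue measurable functions on `(a, b)`. -/
def MeasurableOn (a b : EReal) (f : ℝ → ℝ≥0∞) : Prop :=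
  AEMeasurable f (volume.restrict (interval a b))

/-- Weights on `(a, b)`: measurable functions that are positive and finite almost everywhere. -/
structure IsWeight (a b : EReal) (u : ℝ → ℝ≥0∞) : Prop where
  measurableOn : MeasurableOn a b u
  pos_finite : ∀ᵐ t ∂(volume.restrict (interval a b)), 0 < u t ∧ u t < ∞

/-- `V_r(x, y) = (∫_x^y v^{1/(1-r)})^{(1-r)/r}`, for `0 < r < 1`. -/
def V (r : ℝ) (v : ℝ → ℝ≥0∞) (x y : EReal) : ℝ≥0∞ :=
  (integral x y fun s => v s ^ (1 / (1 - r))) ^ ((1 - r) / r)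

/-- `W(x) = ∫_x^b w`. -/
def W (b : EReal) (w : ℝ → ℝ≥0∞) (x : EReal) : ℝ≥0∞ := integral x b w

/-- The left-hand side of the inequality,
`(∫_a^b (∫_a^t f(s)^r v(s) ds)^{q/r} u(t) dt)^{1/q}`. -/
def lhs (q r : ℝ) (a b : EReal) (u v f : ℝ → ℝ≥0∞) : ℝ≥0∞ :=
  (integral a b fun t => (integral a t fun s => f s ^ r * v s) ^ (q / r) * u t) ^ (1 / q)

/-- The right-hand side of the inequality without the constant,
`(∫_a^b (∫_a^t f(s) ds)^p w(t) dt)^{1/p}`. -/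
def rhs (p : ℝ) (a b : EReal) (w f : ℝ → ℝ≥0∞) : ℝ≥0∞ :=
  (integral a b fun t => (integral a t f) ^ p * w t) ^ (1 / p)

/-- The inequality holds with constant `C` for all non-negative measurable functions. -/
def InequalityHolds (p q r : ℝ) (a b : EReal) (u v w : ℝ → ℝ≥0∞) (C : ℝ≥0∞) : Prop :=
  ∀ f : ℝ → ℝ≥0∞, MeasurableOn a b f → lhs q r a b u v f ≤ C * rhs p a b w f

/-- The best constant in the inequality; it is `∞` if no finite constant is admissible. -/
def bestConstant (p q r : ℝ) (a b : EReal) (u v w : ℝ → ℝ≥0∞) : ℝ≥0∞ :=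
  sInf {C : ℝ≥0∞ | InequalityHolds p q r a b u v w C}

/-- The condition `𝒞₅`. -/
def C5 (p q r : ℝ) (a b : EReal) (u v w : ℝ → ℝ≥0∞) : ℝ≥0∞ :=
  (integral a b fun x =>
      W b w x ^ (-(p / (p - q))) * w x *
        (integral x b fun t =>
          (integral t b u) ^ (q / (1 - q)) * u t * V r v x t ^ (q / (1 - q)))
          ^ (p * (1 - q) / (p - q)))
      ^ ((p - q) / (p * q))
    + W b w a ^ (-(1 / p)) *
        (integral a b fun t =>
          (integral t b u) ^ (q / (1 - q)) * u t * V r v a t ^ (q / (1 - q)))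
          ^ ((1 - q) / q)

/-- The condition `𝒞₆`. -/
def C6 (p q r : ℝ) (a b : EReal) (u v w : ℝ → ℝ≥0∞) : ℝ≥0∞ :=
  (integral a b fun x =>
      (integral x b u) ^ (q / (p - q)) * u x *
        (integral a x fun t =>
          W b w t ^ (-(p / (p - r))) * w t * V r v t x ^ (p * r / (p - r)))
          ^ (q * (p - r) / (r * (p - q))))
      ^ ((p - q) / (p * q))

end

end CesaroEmbedding

/-! Writing f = v^{1/(1-r)} h turns the inequality into one about three measures μ = u dt, ν =
v^{1/(1-r)} dt and ω = w dt, namely ∫ (∫_{s<t} h^r dν)^{q/r} dμ(t) ≤ C^q (∫ (∫_{s<t} h dν)^p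
dω(t))^{q/p} (`MeasureIneq`, `inequalityHolds_iff`). The two terms of `C5` and the condition `C6`
become the powers with exponent (p-q)/(pq) of `tailEnergy`, `endEnergy` and `kernEnergy`.

Assume first that the measures are finite, and cut the line at points x_k where the tail of ω equals
m_k = 2^{-k} ω(ℝ). Because m_k decays geometrically, the integral on the right is comparable with Σ
m_k (∫_{block k} h dν)^p (`sum_rpow_le_lintegral`, `exists_lintegral_le_iSup_sum`). On the left, for
t in block k, the inner integral splits into the part inside block k and the part over the earlier
blocks. The first part is handled by the Hardy inequality from L^{1/r}(ν) to L^{q/r}(μ) on (x_k, ∞),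
whose constant is β(x_k)^{1-q}, and Hölder in k; this produces `blockSum`. For the second part,
Hölder on every block leaves a Hardy inequality from L^{p/r} to L^{q/r} for an atomic measure with
one atom per block; this produces `hardyFun` of `atomMeasure`. Both Hardy inequalities are
`exists_hardy_upper`.

Conversely both quantities are necessary. For `blockSum` the test function superposes the Hardy
extremals on the half-lines (x_k, ∞); they overlap, but the overlap grows more slowly than m_k
decays (`exists_lintegral_superposition_le`). For the atomic part a step function suffices. In
either case the quantity S satisfies S ≤ D S^{q/p} and, being finite, can be absorbed.

The discrete pair is comparable with the sum of the three energies. Parts of blocks that do not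
match are paid for by `exists_hardy_nesting`, which bounds the functional with parameter p by the
one with p = 1. General weights follow by truncating μ and ν to finite measures and ω from the left,
and passing to the limit by monotone convergence. -/

namespace CesaroEmbedding

/-! ### Inequalities for finite sums and powers in [0, ∞]. -/

open Finset

/-- Hölder's inequality for finite sums with weights `θ` and `1 - θ`. -/
theorem sum_rpow_mul_rpow_le {ι : Type*} (s : Finset ι) (f g : ι → ℝ≥0∞) {θ : ℝ}
    (h0 : 0 < θ) (h1 : θ < 1) :
    ∑ i ∈ s, f i ^ θ * g i ^ (1 - θ) ≤ (∑ i ∈ s, f i) ^ θ * (∑ i ∈ s, g i) ^ (1 - θ) := by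
  have h2 : 0 < 1 - θ := by linarith
  have hc : (1 / θ).HolderConjugate (1 / (1 - θ)) := by
    rw [Real.holderConjugate_iff]
    refine ⟨(one_lt_div h0).2 h1, by simp⟩
  have := ENNReal.inner_le_Lp_mul_Lq s (fun i => f i ^ θ) (fun i => g i ^ (1 - θ)) hc
  simpa [← ENNReal.rpow_mul, h0.ne', h2.ne'] using this

/-- Hölder's inequality in the form `∫ g ≤ (∫ g ^ P) ^ (1 / P) * ν univ ^ (1 - 1 / P)`, raised to a
power. -/
theorem lintegral_rpow_le_of_one_lt {α : Type*} [MeasurableSpace α] (ν : Measure α) {P : ℝ}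
    (hP : 1 < P) {g : α → ℝ≥0∞} (hg : AEMeasurable g ν) :
    ∫⁻ s, g s ∂ν ≤ (∫⁻ s, g s ^ P ∂ν) ^ (1 / P) * ν Set.univ ^ ((P - 1) / P) := by
  have hP0 : P ≠ 0 := by linarith
  have hP1 : P - 1 ≠ 0 := by linarith
  have := ENNReal.lintegral_mul_le_Lp_mul_Lq ν (Real.HolderConjugate.conjExponent hP) hg
    (aemeasurable_const (b := (1 : ℝ≥0∞)))
  simpa [Real.conjExponent] using this

/-- Only one of the two coefficients has to be large. With η given by (1 + η)^α = ρ, either x ≤ ηy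
and x + y ≤ (1 + η)y, or y ≤ x/η. A coefficient near 1 on y is what allows the estimate to be
iterated. -/
theorem exists_add_rpow_le {α ρ : ℝ} (hα : 0 < α) (hρ : 1 < ρ) :
    ∃ A : ℝ≥0, ∀ x y : ℝ≥0∞, (x + y) ^ α ≤ A * x ^ α + ENNReal.ofReal ρ * y ^ α := by
  set η : ℝ := ρ ^ (1 / α) - 1 with hη
  have hη0 : 0 < η := by
    have := Real.one_lt_rpow hρ (one_div_pos.2 hα)
    linarith
  refine ⟨((1 + 1 / η) ^ α).toNNReal, fun x y => ?_⟩
  have hρ' : ENNReal.ofReal ρ = ENNReal.ofReal (1 + η) ^ α := by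
    rw [ENNReal.ofReal_rpow_of_pos (by linarith), hη]
    congr 1
    rw [add_sub_cancel, ← Real.rpow_mul (by linarith)]
    simp [hα.ne']
  have hA : (((1 + 1 / η) ^ α).toNNReal : ℝ≥0∞) = ENNReal.ofReal (1 + 1 / η) ^ α := by
    rw [ENNReal.ofReal_rpow_of_pos (by positivity)]
    rfl
  rw [hρ', hA, ← ENNReal.mul_rpow_of_nonneg _ _ hα.le, ← ENNReal.mul_rpow_of_nonneg _ _ hα.le]
  rcases le_total x (ENNReal.ofReal η * y) with h | h
  · refine le_trans (ENNReal.rpow_le_rpow ?_ hα.le) le_add_self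
    calc x + y ≤ ENNReal.ofReal η * y + y := by gcongr
      _ = ENNReal.ofReal (1 + η) * y := by
        rw [ENNReal.ofReal_add zero_le_one hη0.le, add_mul]; simp [add_comm]
  · refine le_trans (ENNReal.rpow_le_rpow ?_ hα.le) le_self_add
    have h' : y ≤ ENNReal.ofReal (1 / η) * x := by
      calc y = ENNReal.ofReal (1 / η) * (ENNReal.ofReal η * y) := by
            rw [← mul_assoc, ← ENNReal.ofReal_mul (by positivity)]
            simp [hη0.ne']
        _ ≤ _ := by gcongr
    calc x + y ≤ x + ENNReal.ofReal (1 / η) * x := by gcongr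
      _ = _ := by
        rw [ENNReal.ofReal_add zero_le_one (by positivity), add_mul]; simp

/-- Iterating the two-term estimate with the older partial sum in the place of y costs a factor ρ
per step, so a term of age n - j carries only ρ^(n-j) instead of a constant depending on n. -/
theorem exists_rpow_sum_le {α ρ : ℝ} (hα : 0 < α) (hρ : 1 < ρ) :
    ∃ A : ℝ≥0, ∀ (g : ℕ → ℝ≥0∞) (n : ℕ), (∑ j ∈ range (n + 1), g j) ^ α ≤
      A * ∑ j ∈ range (n + 1), ENNReal.ofReal ρ ^ (n - j) * g j ^ α := by
  obtain ⟨A, hA⟩ := exists_add_rpow_le hα hρ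
  refine ⟨A + 1, fun g n => ?_⟩
  induction n with
  | zero =>
    simp only [zero_add, sum_range_one, tsub_self, pow_zero, one_mul]
    refine le_mul_of_one_le_left (zero_le) ?_
    simp
  | succ n ih =>
    rw [sum_range_succ, add_comm, sum_range_succ _ (n + 1)]
    refine (hA _ _).trans ?_
    rw [mul_add, add_comm]
    refine add_le_add ?_ ?_
    · calc ENNReal.ofReal ρ * (∑ j ∈ range (n + 1), g j) ^ α
          ≤ ENNReal.ofReal ρ * (((A + 1 : ℝ≥0) : ℝ≥0∞) *
            ∑ j ∈ range (n + 1), ENNReal.ofReal ρ ^ (n - j) * g j ^ α) := by gcongr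
        _ = _ := by
          rw [mul_left_comm, mul_sum]
          congr 1
          refine sum_congr rfl fun j hj => ?_
          rw [← mul_assoc, ← pow_succ']
          congr 2
          have := mem_range.1 hj
          omega
    · simp only [tsub_self, pow_zero, one_mul]
      gcongr
      simp

/-- A discrete Hardy inequality for geometrically decreasing weights. -/
theorem exists_geom_hardy {α σ : ℝ} (hα : 0 < α) (hσ : 0 < σ) (hσ1 : σ < 1) :
    ∃ c : ℝ≥0, ∀ (w g : ℕ → ℝ≥0∞) (n : ℕ),
      (∀ k, k + 1 < n → w (k + 1) ≤ ENNReal.ofReal σ * w k) →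
      ∑ k ∈ range n, w k * (∑ j ∈ range (k + 1), g j) ^ α ≤
        c * ∑ k ∈ range n, w k * g k ^ α := by
  -- The value ρ > 1 is such that ρσ = (1 + σ)/2 < 1: the growth of the partial sums by ρ per step
  -- is beaten by the decay of the weights by σ.
  set ρ : ℝ := (1 + σ) / (2 * σ) with hρ
  have hρ1 : 1 < ρ := by rw [hρ, lt_div_iff₀ (by positivity)]; linarith
  have hρσ : ρ * σ = (1 + σ) / 2 := by rw [hρ]; field_simp
  obtain ⟨A, hA⟩ := exists_add_rpow_le hα hρ1
  -- This is the solution of (1 + lσ)ρ = l, which makes the extra term in the induction below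
  -- reproduce itself.
  set l : ℝ := ρ / (1 - ρ * σ) with hl
  have hl0 : 0 < l := div_pos (by linarith) (by rw [hρσ]; linarith)
  have hl1 : (1 + l * σ) * ρ = l := by
    have : 1 - ρ * σ ≠ 0 := by rw [hρσ]; linarith
    rw [hl]; field_simp; ring
  refine ⟨(1 + l * σ).toNNReal * (A + 1), fun w g n => ?_⟩
  set Z : ℕ → ℝ≥0∞ := fun k => (∑ j ∈ range (k + 1), g j) ^ α with hZ
  have hZs : ∀ k, Z (k + 1) ≤ (A + 1) * g (k + 1) ^ α + ENNReal.ofReal ρ * Z k := by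
    intro k
    simp only [hZ]
    rw [sum_range_succ, add_comm]
    refine (hA _ _).trans ?_
    gcongr
    simp
  have hZ0 : Z 0 ≤ (A + 1) * g 0 ^ α := by
    simp only [hZ, zero_add, sum_range_one]
    exact le_mul_of_one_le_left zero_le le_add_self
  set κ : ℝ≥0∞ := ENNReal.ofReal (1 + l * σ) with hκ
  have hκ' : κ = 1 + ENNReal.ofReal l * ENNReal.ofReal σ := by
    rw [hκ, ENNReal.ofReal_add zero_le_one (by positivity), ENNReal.ofReal_mul hl0.le]; simp
  have hκρ : κ * ENNReal.ofReal ρ = ENNReal.ofReal l := by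
    rw [hκ, ← ENNReal.ofReal_mul (by positivity), hl1]
  -- The claim is strengthened by a multiple of the last term, kept in reserve to pay for the share
  -- of `Z n` in `Z (n + 1)`. This avoids subtraction in [0, ∞].
  have main : ∀ n, (∀ k, k + 1 < n + 1 → w (k + 1) ≤ ENNReal.ofReal σ * w k) →
      ∑ k ∈ range (n + 1), w k * Z k + ENNReal.ofReal l * ENNReal.ofReal σ * w n * Z n ≤
        κ * (A + 1) * ∑ k ∈ range (n + 1), w k * g k ^ α := by
    intro n
    induction n with
    | zero =>
      intro _
      simp only [zero_add, sum_range_one]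
      calc w 0 * Z 0 + ENNReal.ofReal l * ENNReal.ofReal σ * w 0 * Z 0
          = κ * (w 0 * Z 0) := by rw [hκ']; ring
        _ ≤ κ * (w 0 * ((A + 1) * g 0 ^ α)) := by gcongr
        _ = _ := by ring
    | succ n ih =>
      intro hw
      have ih := ih fun k hk => hw k (by omega)
      rw [sum_range_succ, sum_range_succ _ (n + 1)]
      calc ∑ k ∈ range (n + 1), w k * Z k + w (n + 1) * Z (n + 1) +
            ENNReal.ofReal l * ENNReal.ofReal σ * w (n + 1) * Z (n + 1)
          = ∑ k ∈ range (n + 1), w k * Z k + κ * (w (n + 1) * Z (n + 1)) := by rw [hκ']; ring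
        _ ≤ ∑ k ∈ range (n + 1), w k * Z k +
            κ * (w (n + 1) * ((A + 1) * g (n + 1) ^ α + ENNReal.ofReal ρ * Z n)) := by
            gcongr; exact hZs n
        _ = (∑ k ∈ range (n + 1), w k * Z k + κ * ENNReal.ofReal ρ * w (n + 1) * Z n) +
            κ * (A + 1) * (w (n + 1) * g (n + 1) ^ α) := by ring
        _ ≤ (∑ k ∈ range (n + 1), w k * Z k +
              ENNReal.ofReal l * (ENNReal.ofReal σ * w n) * Z n) +
            κ * (A + 1) * (w (n + 1) * g (n + 1) ^ α) := by
            rw [hκρ]; gcongr; exact hw n (by omega)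
        _ ≤ _ := by
            rw [mul_add (κ * (A + 1))]
            refine add_le_add (le_trans (le_of_eq ?_) ih) le_rfl
            ring
  intro hw
  cases n with
  | zero => simp
  | succ n =>
    refine le_trans le_self_add ((main n hw).trans (le_of_eq ?_))
    rw [hκ]
    push_cast
    rfl

theorem sum_rpow_le_rpow_sum {ι : Type*} (s : Finset ι) (f : ι → ℝ≥0∞) {α : ℝ} (hα : 1 ≤ α) :
    ∑ i ∈ s, f i ^ α ≤ (∑ i ∈ s, f i) ^ α := by
  classical
  induction s using Finset.induction_on with
  | empty => simp
  | insert i s hi ih =>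
    rw [sum_insert hi, sum_insert hi]
    exact (add_le_add le_rfl ih).trans (ENNReal.add_rpow_le_rpow_add _ _ hα)

theorem add_rpow_le_two_rpow_mul (x y : ℝ≥0∞) {α : ℝ} (hα : 0 ≤ α) :
    (x + y) ^ α ≤ 2 ^ α * (x ^ α + y ^ α) := by
  rcases le_total x y with h | h
  · calc (x + y) ^ α ≤ (2 * y) ^ α := by gcongr; rw [two_mul]; gcongr
      _ = 2 ^ α * y ^ α := ENNReal.mul_rpow_of_nonneg _ _ hα
      _ ≤ _ := by gcongr; exact le_add_self
  · calc (x + y) ^ α ≤ (2 * x) ^ α := by gcongr; rw [two_mul]; gcongr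
      _ = 2 ^ α * x ^ α := ENNReal.mul_rpow_of_nonneg _ _ hα
      _ ≤ _ := by gcongr; exact le_self_add

/-- If `S ≤ D * S ^ θ` with `θ < 1` and `S` is finite then `S ≤ D ^ (1 / (1 - θ))`. -/
theorem le_rpow_of_le_mul_rpow {S D : ℝ≥0∞} {θ : ℝ} (h1 : θ < 1) (hS : S ≠ ∞)
    (h : S ≤ D * S ^ θ) : S ≤ D ^ (1 / (1 - θ)) := by
  rcases eq_or_ne S 0 with rfl | hS0
  · exact zero_le
  have h2 : 0 < 1 - θ := by linarith
  have h3 : S ^ (1 - θ) ≤ D := by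
    rw [ENNReal.rpow_sub _ _ hS0 hS, ENNReal.rpow_one]
    exact ENNReal.div_le_of_le_mul h
  calc S = (S ^ (1 - θ)) ^ (1 / (1 - θ)) := by
        rw [← ENNReal.rpow_mul, mul_one_div_cancel h2.ne', ENNReal.rpow_one]
    _ ≤ _ := by gcongr

end CesaroEmbedding

/-! ### Tails of measures on the line and dyadic decomposition. -/

namespace CesaroEmbedding

open Set

theorem antitone_measure_Ioi (μ : Measure ℝ) : Antitone fun t => μ (Ioi t) :=
  fun _ _ h => measure_mono (Ioi_subset_Ioi h)

theorem monotone_measure_Iio (μ : Measure ℝ) : Monotone fun t => μ (Iio t) :=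
  fun _ _ h => measure_mono (Iio_subset_Iio h)

theorem monotone_measure_Iic (μ : Measure ℝ) : Monotone fun t => μ (Iic t) :=
  fun _ _ h => measure_mono (Iic_subset_Iic.2 h)

theorem monotone_setLIntegral_Iio (ν : Measure ℝ) (g : ℝ → ℝ≥0∞) :
    Monotone fun t => ∫⁻ s in Iio t, g s ∂ν :=
  fun _ _ h => lintegral_mono_set (Iio_subset_Iio h)

/-- The tail of a finite measure without atoms takes all intermediate values. -/
theorem exists_measure_Ioi_eq (μ : Measure ℝ) [IsFiniteMeasure μ] [NullSingletonClass μ] (a : ℝ)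
    {y : ℝ≥0∞} (hy0 : 0 < y) (hy : y ≤ μ (Ioi a)) : ∃ x, a ≤ x ∧ μ (Ioi x) = y := by
  -- Absence of atoms enters here: the distribution function of μ is continuous, so the intermediate
  -- value theorem applies.
  have hcont : Continuous fun x => ∫ _ in a..x, (1 : ℝ) ∂μ :=
    intervalIntegral.continuous_primitive (fun _ _ => intervalIntegrable_const) a
  have hval : ∀ x, a ≤ x → ∫ _ in a..x, (1 : ℝ) ∂μ = (μ (Ioi a)).toReal - (μ (Ioi x)).toReal := by
    intro x hx
    rw [intervalIntegral.integral_of_le hx]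
    have : μ (Ioi a) = μ (Ioc a x) + μ (Ioi x) := by
      rw [← Ioc_union_Ioi_eq_Ioi hx, measure_union _ measurableSet_Ioi]
      exact Set.disjoint_left.2 fun t ht ht' => not_lt.2 ht.2 ht'
    rw [this, ENNReal.toReal_add (measure_ne_top _ _) (measure_ne_top _ _)]
    simp [Measure.real]
  have htend : Filter.Tendsto (fun n : ℕ => μ (Ioi (n : ℝ))) Filter.atTop (nhds 0) := by
    have := tendsto_measure_iInter_atTop (μ := μ) (s := fun n : ℕ => Ioi (n : ℝ))
      (fun n => measurableSet_Ioi.nullMeasurableSet)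
      (fun i j h => Ioi_subset_Ioi (Nat.cast_le.2 h)) ⟨0, measure_ne_top _ _⟩
    have he : (⋂ n : ℕ, Ioi (n : ℝ)) = ∅ := by
      ext t
      simp only [mem_iInter, mem_Ioi, mem_empty_iff_false, iff_false, not_forall, not_lt]
      exact exists_nat_ge t
    rw [he, measure_empty] at this
    exact this
  have hytop : y ≠ ∞ := ne_top_of_le_ne_top (measure_ne_top _ _) hy
  obtain ⟨n, hn⟩ := ((htend.eventually_lt_const hy0).and
    (tendsto_natCast_atTop_atTop.eventually_ge_atTop a)).exists
  have hyr : (μ (Ioi a)).toReal - y.toReal ∈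
      Icc (∫ _ in a..a, (1 : ℝ) ∂μ) (∫ _ in a..(n : ℝ), (1 : ℝ) ∂μ) := by
    rw [hval a le_rfl, hval n hn.2]
    constructor
    · have := ENNReal.toReal_mono (measure_ne_top _ _) hy
      linarith
    · have := ENNReal.toReal_mono hytop hn.1.le
      linarith
  obtain ⟨x, hx, hxy⟩ := intermediate_value_Icc hn.2 hcont.continuousOn hyr
  refine ⟨x, hx.1, ?_⟩
  simp only [hval x hx.1] at hxy
  exact (ENNReal.toReal_eq_toReal_iff' (measure_ne_top _ _) hytop).1 (by linarith)

/-- Points at which the tail of `ω` is halved successively. -/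
structure Dyadic (ω : Measure ℝ) (x : ℕ → ℝ) (m : ℕ → ℝ≥0∞) : Prop where
  strictMono : StrictMono x
  tail : ∀ k, ω (Ioi (x k)) = m k
  half : ∀ k, m k = 2 * m (k + 1)
  ne_zero : ∀ k, m k ≠ 0
  ne_top : ∀ k, m k ≠ ∞
  null : ω (Iic (x 0)) = 0

theorem exists_dyadic (ω : Measure ℝ) [IsFiniteMeasure ω] [NullSingletonClass ω] (a : ℝ)
    (ha : ω (Iic a) = 0) (h0 : ω ≠ 0) : ∃ x m, Dyadic ω x m ∧ x 0 = a ∧ m 0 = ω univ := by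
  have huniv : ω (Ioi a) = ω univ := by
    rw [← Iic_union_Ioi (a := a), measure_union _ measurableSet_Ioi, ha, zero_add]
    exact Set.disjoint_left.2 fun t ht ht' => not_lt.2 (mem_Iic.1 ht) (mem_Ioi.1 ht')
  have hθ : ω univ ≠ 0 := by simpa using h0
  have hθt : ω univ ≠ ∞ := measure_ne_top _ _
  set m : ℕ → ℝ≥0∞ := fun k => ω univ * (2⁻¹) ^ k with hm
  have hm0 : ∀ k, m k ≠ 0 := fun k => mul_ne_zero hθ (by simp)
  have hmt : ∀ k, m k ≠ ∞ := fun k => ENNReal.mul_ne_top hθt (by simp)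
  have hhalf : ∀ k, m k = 2 * m (k + 1) := by
    intro k
    simp only [hm, pow_succ]
    rw [mul_comm, mul_comm (ω univ), mul_assoc, ← mul_assoc, ← mul_assoc, mul_comm 2, mul_assoc,
      mul_assoc, ← mul_assoc 2, ENNReal.mul_inv_cancel (by simp) (by simp), one_mul]
  have hanti : StrictAnti m := strictAnti_nat_of_succ_lt fun k => by
    conv_rhs => rw [hhalf k, two_mul]
    exact ENNReal.lt_add_right (hmt _) (hm0 _)
  have hex : ∀ k, ∃ x, a ≤ x ∧ ω (Ioi x) = m k ∧ (k = 0 → x = a) := by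
    intro k
    rcases Nat.eq_zero_or_pos k with rfl | hk
    · exact ⟨a, le_rfl, by simp [hm, huniv], fun _ => rfl⟩
    · obtain ⟨x, hx, hxm⟩ := exists_measure_Ioi_eq ω a (pos_iff_ne_zero.2 (hm0 k))
        (by rw [huniv]; simpa [hm] using hanti.antitone (Nat.zero_le k))
      exact ⟨x, hx, hxm, fun h => absurd h hk.ne'⟩
  choose x hxa hxm hx0 using hex
  refine ⟨x, m, ⟨fun i j hij => ?_, hxm, hhalf, hm0, hmt, ?_⟩, hx0 0 rfl, by simp [hm]⟩
  · by_contra! h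
    have := antitone_measure_Ioi ω h
    simp only [hxm] at this
    exact not_lt.2 this (hanti hij)
  · rw [hx0 0 rfl, ha]

namespace Dyadic

variable {ω : Measure ℝ} {x : ℕ → ℝ} {m : ℕ → ℝ≥0∞}

theorem rpow_eq (h : Dyadic ω x m) (k : ℕ) (s : ℝ) : m k ^ s = 2 ^ s * m (k + 1) ^ s := by
  rw [h.half k, ENNReal.mul_rpow_of_ne_zero two_ne_zero (h.ne_zero _)]

theorem rpow_succ_neg (h : Dyadic ω x m) (k : ℕ) (s : ℝ) :
    m (k + 1) ^ (-s) = 2 ^ s * m k ^ (-s) := by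
  rw [h.rpow_eq k (-s), ← mul_assoc, ← ENNReal.rpow_add _ _ two_ne_zero (by simp)]
  simp

theorem measure_block (h : Dyadic ω x m) (k : ℕ) : ω (Ioc (x k) (x (k + 1))) = m (k + 1) := by
  have h1 : ω (Ioi (x k)) = ω (Ioc (x k) (x (k + 1))) + ω (Ioi (x (k + 1))) := by
    rw [← Ioc_union_Ioi_eq_Ioi (h.strictMono (Nat.lt_succ_self k)).le,
      measure_union _ measurableSet_Ioi]
    exact Set.disjoint_left.2 fun t ht ht' => not_lt.2 ht.2 ht'
  rw [h.tail, h.tail, h.half, two_mul] at h1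
  exact ((ENNReal.add_left_inj (h.ne_top _)).1 h1).symm

theorem tail_le (h : Dyadic ω x m) {k : ℕ} {t : ℝ} (ht : x k ≤ t) : ω (Ioi t) ≤ m k := by
  rw [← h.tail]; exact antitone_measure_Ioi ω ht

theorem le_tail (h : Dyadic ω x m) {k : ℕ} {t : ℝ} (ht : t ≤ x k) : m k ≤ ω (Ioi t) := by
  rw [← h.tail]; exact antitone_measure_Ioi ω ht

theorem eq_mul_pow (h : Dyadic ω x m) (k : ℕ) : m k = m 0 * (2⁻¹) ^ k := by
  induction k with
  | zero => simp
  | succ k ih =>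
    rw [pow_succ, ← mul_assoc, ← ih, h.half k, mul_comm, ← mul_assoc,
      ENNReal.inv_mul_cancel (by simp) (by simp), one_mul]

theorem exists_lt (h : Dyadic ω x m) {ε : ℝ≥0∞} (hε : 0 < ε) : ∃ n, m n < ε := by
  have h1 : Filter.Tendsto (fun k : ℕ => m 0 * (2⁻¹ : ℝ≥0∞) ^ k) Filter.atTop (nhds (m 0 * 0)) :=
    ENNReal.Tendsto.const_mul (ENNReal.tendsto_pow_atTop_nhds_zero_of_lt_one (by simp))
      (Or.inr (h.ne_top 0))
  rw [mul_zero] at h1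
  obtain ⟨n, hn⟩ := (h1.eventually_lt_const hε).exists
  exact ⟨n, by rwa [h.eq_mul_pow]⟩

/-- The points x n need not converge to the right end point, but they exhaust ω: what lies beyond
all of them has measure at most every m n, hence zero. -/
theorem lintegral_le_iSup (h : Dyadic ω x m) (f : ℝ → ℝ≥0∞) :
    ∫⁻ t, f t ∂ω ≤ ⨆ n, ∫⁻ t in Ioc (x 0) (x n), f t ∂ω := by
  have hd : Directed (· ⊆ ·) fun n => Ioc (x 0) (x n) :=
    Monotone.directed_le fun i j hij => Ioc_subset_Ioc_right (h.strictMono.monotone hij)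
  rw [← setLIntegral_iUnion_of_directed f hd, ← setLIntegral_univ]
  refine le_of_eq (setLIntegral_congr ?_)
  symm
  rw [ae_eq_univ]
  have hsub : (⋃ n, Ioc (x 0) (x n))ᶜ ⊆ Iic (x 0) ∪ ⋂ n, Ioi (x n) := by
    intro t ht
    simp only [mem_compl_iff, mem_iUnion, Set.mem_Ioc, not_exists, not_and, not_le] at ht
    rcases le_or_gt t (x 0) with h0 | h0
    · exact Or.inl h0
    · exact Or.inr (mem_iInter.2 fun n => ht n h0)
  refine measure_mono_null hsub (measure_union_null h.null ?_)
  by_contra hne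
  obtain ⟨n, hn⟩ := h.exists_lt (pos_iff_ne_zero.2 hne)
  refine not_le.2 hn ?_
  rw [← h.tail]
  exact measure_mono (iInter_subset _ n)

end Dyadic

theorem setLIntegral_Ioc_eq_sum (ω : Measure ℝ) {x : ℕ → ℝ} (hx : Monotone x) (f : ℝ → ℝ≥0∞)
    (n : ℕ) : ∫⁻ t in Ioc (x 0) (x n), f t ∂ω =
      ∑ k ∈ Finset.range n, ∫⁻ t in Ioc (x k) (x (k + 1)), f t ∂ω := by
  induction n with
  | zero => simp
  | succ n ih =>
    rw [Finset.sum_range_succ, ← ih, ← Ioc_union_Ioc_eq_Ioc (hx (Nat.zero_le n)) (hx (Nat.le_succ n)),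
      lintegral_union measurableSet_Ioc]
    exact Set.disjoint_left.2 fun t ht ht' => not_lt.2 ht.2 ht'.1

theorem setLIntegral_Ico_eq_sum (ω : Measure ℝ) {x : ℕ → ℝ} (hx : Monotone x) (f : ℝ → ℝ≥0∞)
    (n : ℕ) : ∫⁻ t in Ico (x 0) (x n), f t ∂ω =
      ∑ k ∈ Finset.range n, ∫⁻ t in Ico (x k) (x (k + 1)), f t ∂ω := by
  induction n with
  | zero => simp
  | succ n ih =>
    rw [Finset.sum_range_succ, ← ih, ← Ico_union_Ico_eq_Ico (hx (Nat.zero_le n)) (hx (Nat.le_succ n)),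
      lintegral_union measurableSet_Ico]
    exact Set.disjoint_left.2 fun t ht ht' => not_le.2 ht.2 ht'.1

/-- A substitute for integrating U^κ dU. Up to the point where the tail has halved, the integrand is
at least (μ(Ioi s)/2)^κ, and this stretch carries half of the mass. -/
theorem measure_Ioi_rpow_le (μ : Measure ℝ) [IsFiniteMeasure μ] [NullSingletonClass μ] {κ : ℝ} (hκ : 0 ≤ κ)
    (s : ℝ) : μ (Ioi s) ^ (κ + 1) ≤ 2 ^ (κ + 1) * ∫⁻ t in Ioi s, μ (Ioi t) ^ κ ∂μ := by
  rcases eq_or_ne (μ (Ioi s)) 0 with h0 | h0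
  · rw [h0, ENNReal.zero_rpow_of_pos (by linarith)]; exact zero_le
  have hhalf : μ (Ioi s) = 2 * (μ (Ioi s) / 2) := by
    rw [ENNReal.mul_div_cancel (by simp) (by simp)]
  obtain ⟨x, hx, hxs⟩ := exists_measure_Ioi_eq μ s (y := μ (Ioi s) / 2)
    (ENNReal.half_pos h0) ENNReal.half_le_self
  have hb : μ (Ioc s x) = μ (Ioi s) / 2 := by
    have h1 : μ (Ioi s) = μ (Ioc s x) + μ (Ioi x) := by
      rw [← Ioc_union_Ioi_eq_Ioi hx, measure_union _ measurableSet_Ioi]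
      exact Set.disjoint_left.2 fun t ht ht' => not_lt.2 ht.2 ht'
    rw [hxs] at h1
    have h2 := h1
    conv_lhs at h2 => rw [← ENNReal.add_halves (μ (Ioi s))]
    exact ((ENNReal.add_left_inj
      (ENNReal.div_ne_top (measure_ne_top _ _) two_ne_zero)).1 h2).symm
  calc μ (Ioi s) ^ (κ + 1) = 2 ^ (κ + 1) * ((μ (Ioi s) / 2) ^ κ * (μ (Ioi s) / 2)) := by
        conv_lhs => rw [hhalf, ENNReal.mul_rpow_of_nonneg _ _ (by linarith)]
        congr 1
        rw [ENNReal.rpow_add_of_nonneg _ _ hκ zero_le_one, ENNReal.rpow_one]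
    _ = 2 ^ (κ + 1) * ∫⁻ _ in Ioc s x, (μ (Ioi s) / 2) ^ κ ∂μ := by
        rw [setLIntegral_const, hb]
    _ ≤ 2 ^ (κ + 1) * ∫⁻ t in Ioc s x, μ (Ioi t) ^ κ ∂μ := by
        gcongr 2 ^ (κ + 1) * ?_
        refine setLIntegral_mono' measurableSet_Ioc fun t ht => ?_
        rw [← hxs]
        exact ENNReal.rpow_le_rpow (antitone_measure_Ioi μ ht.2) hκ
    _ ≤ _ := by
        gcongr 2 ^ (κ + 1) * ?_
        exact lintegral_mono_set Ioc_subset_Ioi_self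

/-- The set is closed downwards, hence contained in an increasing union of half-lines `Iic (u n)`
with u n in the set, each of measure below y. No continuity of ν is needed. -/
theorem measure_setOf_measure_Iic_lt_le (ν : Measure ℝ) (y : ℝ≥0∞) :
    ν {s | ν (Iic s) < y} ≤ y := by
  set L := {s | ν (Iic s) < y} with hL
  have hlow : ∀ s ∈ L, Iic s ⊆ L := fun s hs s' hs' =>
    lt_of_le_of_lt (monotone_measure_Iic ν hs') hs
  rcases L.eq_empty_or_nonempty with he | hne
  · simp [he]
  obtain ⟨u, hu, hutend, hmem⟩ : ∃ u : ℕ → ℝ, Monotone u ∧ (∀ n, u n ∈ L) ∧ L ⊆ ⋃ n, Iic (u n) := by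
    by_cases hbdd : BddAbove L
    · by_cases hmax : sSup L ∈ L
      · exact ⟨fun _ => sSup L, monotone_const, fun _ => hmax, fun s hs =>
          mem_iUnion.2 ⟨0, le_csSup hbdd hs⟩⟩
      · obtain ⟨u, hu, hu', hmem⟩ := exists_seq_tendsto_sSup hne hbdd
        refine ⟨u, hu, hmem, fun s hs => ?_⟩
        have hlt : s < sSup L := lt_of_le_of_ne (le_csSup hbdd hs) fun h => hmax (h ▸ hs)
        obtain ⟨n, hn⟩ := (hu'.eventually_const_lt hlt).exists
        exact mem_iUnion.2 ⟨n, hn.le⟩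
    · have hall : ∀ s, s ∈ L := fun s => by
        obtain ⟨s', hs', hlt⟩ := not_bddAbove_iff.1 hbdd s
        exact hlow s' hs' hlt.le
      exact ⟨fun n => n, Nat.mono_cast, fun n => hall n, fun s _ =>
        mem_iUnion.2 (exists_nat_ge s)⟩
  calc ν L ≤ ν (⋃ n, Iic (u n)) := measure_mono hmem
    _ = ⨆ n, ν (Iic (u n)) := Monotone.measure_iUnion fun i j h => Iic_subset_Iic.2 (hu h)
    _ ≤ y := iSup_le fun n => (hutend n).le

/-- Here ν may have atoms, as it must for `atomMeasure`, so the mass cannot be halved exactly.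
Instead the points with ν(Iic s) < y are removed; they carry at most half of the mass. The closed
half-line in the integrand matters: for a single atom, `Iio` would make the integral vanish when κ >
0. -/
theorem measure_Iio_rpow_le (ν : Measure ℝ) [IsFiniteMeasure ν] {κ : ℝ} (hκ : 0 ≤ κ) (t : ℝ) :
    ν (Iio t) ^ (κ + 1) ≤ 2 ^ (κ + 1) * ∫⁻ s in Iio t, ν (Iic s) ^ κ ∂ν := by
  set y := ν (Iio t) / 2 with hy
  have hhalf : ν (Iio t) = 2 * y := by
    rw [ENNReal.mul_div_cancel (by simp) (by simp)]
  have hmeas : MeasurableSet {s | ν (Iic s) < y} :=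
    measurableSet_lt (monotone_measure_Iic ν).measurable measurable_const
  have hyt : y ≠ ∞ := ENNReal.div_ne_top (measure_ne_top _ _) two_ne_zero
  have hb : y ≤ ν (Iio t \ {s | ν (Iic s) < y}) := by
    have h1 : ν (Iio t) ≤ ν {s | ν (Iic s) < y} + ν (Iio t \ {s | ν (Iic s) < y}) := by
      rw [← measure_union disjoint_sdiff_right (measurableSet_Iio.diff hmeas)]
      exact measure_mono fun s hs => by
        by_cases h : ν (Iic s) < y
        · exact Or.inl h
        · exact Or.inr ⟨hs, h⟩
    have h2 := h1.trans (add_le_add (measure_setOf_measure_Iic_lt_le ν y) le_rfl)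
    rw [hhalf, two_mul] at h2
    exact (ENNReal.add_le_add_iff_left hyt).1 h2
  calc ν (Iio t) ^ (κ + 1) = 2 ^ (κ + 1) * (y ^ κ * y) := by
        rw [hhalf, ENNReal.mul_rpow_of_nonneg _ _ (by linarith)]
        rw [ENNReal.rpow_add_of_nonneg _ _ hκ zero_le_one (x := y), ENNReal.rpow_one]
    _ ≤ 2 ^ (κ + 1) * ∫⁻ _ in Iio t \ {s | ν (Iic s) < y}, y ^ κ ∂ν := by
        rw [setLIntegral_const]; gcongr
    _ ≤ 2 ^ (κ + 1) * ∫⁻ s in Iio t \ {s | ν (Iic s) < y}, ν (Iic s) ^ κ ∂ν := by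
        gcongr 2 ^ (κ + 1) * ?_
        refine setLIntegral_mono' (measurableSet_Iio.diff hmeas) fun s hs => ?_
        exact ENNReal.rpow_le_rpow (not_lt.1 hs.2) hκ
    _ ≤ _ := by
        gcongr 2 ^ (κ + 1) * ?_
        exact lintegral_mono_set sdiff_subset

end CesaroEmbedding

/-! ### The Hardy inequality between two measures and its extremal functions. -/

namespace CesaroEmbedding

open Set

/-- The functional characterizing the Hardy inequality from `L^{p/r}(ν)` to `L^{q/r}(μ)`. -/
noncomputable def hardyFun (p q r : ℝ) (μ ν : Measure ℝ) : ℝ≥0∞ :=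
  ∫⁻ t, μ (Ioi t) ^ (q / (p - q)) * ν (Iio t) ^ (q * (p - r) / (r * (p - q))) ∂μ

theorem measurable_measure_Ioi_rpow (μ : Measure ℝ) (s : ℝ) :
    Measurable fun t => μ (Ioi t) ^ s :=
  (antitone_measure_Ioi μ).measurable.pow_const s

theorem measurable_measure_Iio_rpow (μ : Measure ℝ) (s : ℝ) :
    Measurable fun t => μ (Iio t) ^ s :=
  (monotone_measure_Iio μ).measurable.pow_const s

/-- The line is cut where the tail of μ halves. The geometric Hardy inequality replaces the integral
over all earlier blocks by the integral over the current one; Hölder inside the block and then over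
the blocks separates g from the measures. -/
theorem exists_hardy_upper {p q r : ℝ} (hr : 0 < r) (hrq : r ≤ q) (hqp : q < p) :
    ∃ c : ℝ≥0, ∀ (a : ℝ) (μ ν : Measure ℝ) [IsFiniteMeasure μ] [NullSingletonClass μ],
      μ (Iic a) = 0 → ν (Iio a) = 0 → ∀ g : ℝ → ℝ≥0∞, Measurable g →
      ∫⁻ t, (∫⁻ s in Iio t, g s ∂ν) ^ (q / r) ∂μ ≤
        c * hardyFun p q r μ ν ^ ((p - q) / p) * (∫⁻ s, g s ^ (p / r) ∂ν) ^ (q / p) := by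
  have hq : 0 < q := hr.trans_le hrq
  have hp : 0 < p := hq.trans hqp
  have hQ : 0 < q / r := div_pos hq hr
  have hP : 1 < p / r := (one_lt_div hr).2 (hrq.trans_lt hqp)
  have hθ0 : 0 < q / p := div_pos hq hp
  have hθ1 : q / p < 1 := (div_lt_one hp).2 hqp
  have hθ : 1 - q / p = (p - q) / p := by field_simp
  have hpq : 0 < p - q := by linarith
  have hpr : 0 < p - r := by linarith
  obtain ⟨c, hc⟩ := exists_geom_hardy (α := q / r) (σ := 1 / 2) hQ (by norm_num) (by norm_num)
  refine ⟨c * (2 ^ (p / (p - q))) ^ ((p - q) / p), fun a μ ν _ _ hμ hν g hg => ?_⟩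
  rcases eq_or_ne μ 0 with rfl | hμ0
  · simp
  obtain ⟨x, m, hx, hx0, -⟩ := exists_dyadic μ a hμ hμ0
  have hmono := hx.strictMono.monotone
  refine (hx.lintegral_le_iSup _).trans (iSup_le fun n => ?_)
  -- Blocks for ν are closed on the left and those for μ on the right: ν may have atoms, and `Iio (x
  -- (k + 1))` has to be a union of its blocks.
  set I : ℕ → ℝ≥0∞ := fun k => ∫⁻ s in Ico (x k) (x (k + 1)), g s ^ (p / r) ∂ν with hI
  set G : ℕ → ℝ≥0∞ := fun k => ∫⁻ s in Ico (x k) (x (k + 1)), g s ∂ν with hG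
  set J : ℕ → ℝ≥0∞ := fun k =>
    m (k + 1) ^ (p / (p - q)) * ν (Iio (x (k + 1))) ^ (q * (p - r) / (r * (p - q))) with hJ
  set Φ : ℝ → ℝ≥0∞ := fun t =>
    μ (Ioi t) ^ (q / (p - q)) * ν (Iio t) ^ (q * (p - r) / (r * (p - q))) with hΦ
  have hGI : ∀ k, m (k + 1) * G k ^ (q / r) ≤ I k ^ (q / p) * J k ^ (1 - q / p) := by
    intro k
    have h1 : G k ≤ I k ^ (1 / (p / r)) * ν (Iio (x (k + 1))) ^ ((p / r - 1) / (p / r)) := by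
      refine (lintegral_rpow_le_of_one_lt _ hP hg.aemeasurable).trans ?_
      rw [Measure.restrict_apply_univ]
      have : 0 ≤ (p / r - 1) / (p / r) := div_nonneg (by linarith) (by linarith)
      gcongr
      exact fun s hs => hs.2
    have h2 : m (k + 1) = (m (k + 1) ^ (p / (p - q))) ^ (1 - q / p) := by
      rw [← ENNReal.rpow_mul, hθ, div_mul_div_cancel₀ hpq.ne', div_self hp.ne', ENNReal.rpow_one]
    calc m (k + 1) * G k ^ (q / r)
        ≤ m (k + 1) * (I k ^ (1 / (p / r)) *
            ν (Iio (x (k + 1))) ^ ((p / r - 1) / (p / r))) ^ (q / r) := by gcongr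
      _ = I k ^ (q / p) * J k ^ (1 - q / p) := by
        rw [hJ, ENNReal.mul_rpow_of_nonneg _ _ hQ.le,
          ENNReal.mul_rpow_of_nonneg _ _ (by linarith : 0 ≤ 1 - q / p), ← h2,
          ← ENNReal.rpow_mul, ← ENNReal.rpow_mul, ← ENNReal.rpow_mul]
        have e1 : 1 / (p / r) * (q / r) = q / p := by field_simp
        have e2 : (p / r - 1) / (p / r) * (q / r) =
            q * (p - r) / (r * (p - q)) * (1 - q / p) := by
          rw [hθ]; field_simp
        rw [e1, e2]; ring
  -- The comparison uses the next block, where t > x (k + 1) and so ν(Iio t) has already reached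
  -- ν(Iio (x (k + 1))).
  have hJΦ : ∀ k, J k ≤ 2 ^ (p / (p - q)) * ∫⁻ t in Ioc (x (k + 1)) (x (k + 2)), Φ t ∂μ := by
    intro k
    have e3 : p / (p - q) = q / (p - q) + 1 := by field_simp; ring
    calc J k = 2 ^ (p / (p - q)) * ((m (k + 2) ^ (q / (p - q)) *
          ν (Iio (x (k + 1))) ^ (q * (p - r) / (r * (p - q)))) * m (k + 2)) := by
          simp only [hJ]
          rw [hx.rpow_eq, e3, ENNReal.rpow_add_of_nonneg (q / (p - q)) 1
            (div_nonneg hq.le hpq.le) zero_le_one (x := m (k + 1 + 1)), ENNReal.rpow_one]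
          ring
      _ = 2 ^ (p / (p - q)) * ∫⁻ _ in Ioc (x (k + 1)) (x (k + 2)), (m (k + 2) ^ (q / (p - q)) *
          ν (Iio (x (k + 1))) ^ (q * (p - r) / (r * (p - q)))) ∂μ := by
          rw [setLIntegral_const, hx.measure_block (k + 1)]
      _ ≤ _ := by
          gcongr 2 ^ (p / (p - q)) * ?_
          refine setLIntegral_mono' measurableSet_Ioc fun t ht => ?_
          refine mul_le_mul' (ENNReal.rpow_le_rpow (hx.le_tail ht.2) (by positivity))
            (ENNReal.rpow_le_rpow (monotone_measure_Iio ν ht.1.le) (by positivity))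
  have hsumJ : ∑ k ∈ Finset.range n, J k ≤ 2 ^ (p / (p - q)) * hardyFun p q r μ ν := by
    refine (Finset.sum_le_sum fun k _ => hJΦ k).trans ?_
    rw [← Finset.mul_sum]
    gcongr 2 ^ (p / (p - q)) * ?_
    calc ∑ k ∈ Finset.range n, ∫⁻ t in Ioc (x (k + 1)) (x (k + 2)), Φ t ∂μ
        ≤ ∑ k ∈ Finset.range (n + 1), ∫⁻ t in Ioc (x k) (x (k + 1)), Φ t ∂μ := by
          rw [Finset.sum_range_succ']; exact le_self_add
      _ = ∫⁻ t in Ioc (x 0) (x (n + 1)), Φ t ∂μ := (setLIntegral_Ioc_eq_sum μ hmono _ _).symm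
      _ ≤ _ := setLIntegral_le_lintegral _ _
  have hsumI : ∑ k ∈ Finset.range n, I k ≤ ∫⁻ s, g s ^ (p / r) ∂ν := by
    rw [← setLIntegral_Ico_eq_sum ν hmono]
    exact setLIntegral_le_lintegral _ _
  have hGsum : ∀ k, ∫⁻ s in Iio (x (k + 1)), g s ∂ν = ∑ j ∈ Finset.range (k + 1), G j := by
    intro k
    rw [← setLIntegral_Ico_eq_sum ν hmono, ← Iio_union_Ico_eq_Iio (hmono (Nat.zero_le (k + 1))),
      lintegral_union measurableSet_Ico, setLIntegral_measure_zero, zero_add]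
    · rw [hx0, hν]
    · exact Set.disjoint_left.2 fun t ht ht' => not_le.2 ht ht'.1
  calc ∫⁻ t in Ioc (x 0) (x n), (∫⁻ s in Iio t, g s ∂ν) ^ (q / r) ∂μ
      = ∑ k ∈ Finset.range n,
          ∫⁻ t in Ioc (x k) (x (k + 1)), (∫⁻ s in Iio t, g s ∂ν) ^ (q / r) ∂μ :=
        setLIntegral_Ioc_eq_sum μ hmono _ _
    _ ≤ ∑ k ∈ Finset.range n, m (k + 1) * (∑ j ∈ Finset.range (k + 1), G j) ^ (q / r) := by
        refine Finset.sum_le_sum fun k _ => ?_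
        rw [mul_comm, ← hx.measure_block, ← setLIntegral_const]
        refine setLIntegral_mono' measurableSet_Ioc fun t ht => ?_
        rw [← hGsum]
        exact ENNReal.rpow_le_rpow (monotone_setLIntegral_Iio ν g ht.2) hQ.le
    _ ≤ c * ∑ k ∈ Finset.range n, m (k + 1) * G k ^ (q / r) := by
        refine hc (fun k => m (k + 1)) G n fun k _ => ?_
        rw [hx.half (k + 1), ← mul_assoc, one_div, ENNReal.ofReal_inv_of_pos (by norm_num)]
        simp [ENNReal.inv_mul_cancel]
    _ ≤ c * ∑ k ∈ Finset.range n, I k ^ (q / p) * J k ^ (1 - q / p) := by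
        exact mul_le_mul' le_rfl (Finset.sum_le_sum fun k _ => hGI k)
    _ ≤ c * ((∑ k ∈ Finset.range n, I k) ^ (q / p) *
          (∑ k ∈ Finset.range n, J k) ^ (1 - q / p)) := by
        gcongr; exact sum_rpow_mul_rpow_le _ _ _ hθ0 hθ1
    _ ≤ c * ((∫⁻ s, g s ^ (p / r) ∂ν) ^ (q / p) *
          (2 ^ (p / (p - q)) * hardyFun p q r μ ν) ^ (1 - q / p)) := by
        have := hθ1.le
        gcongr
    _ = _ := by
        rw [hθ, ENNReal.mul_rpow_of_nonneg _ _ (by positivity)]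
        push_cast [ENNReal.coe_rpow_of_nonneg _ (by positivity : 0 ≤ p / (p - q)),
          ENNReal.coe_rpow_of_nonneg _ (by positivity : 0 ≤ (p - q) / p)]
        ring

/-- The extremal function of the Hardy inequality. -/
noncomputable def hardyTest (p q r : ℝ) (μ ν : Measure ℝ) (s : ℝ) : ℝ≥0∞ :=
  μ (Ioi s) ^ (r / (p - q)) * ν (Iic s) ^ ((q - r) / (p - q))

theorem measurable_hardyTest (p q r : ℝ) (μ ν : Measure ℝ) : Measurable (hardyTest p q r μ ν) :=
  ((antitone_measure_Ioi μ).measurable.pow_const _).mul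
    ((monotone_measure_Iic ν).measurable.pow_const _)

/-- The power p/(p-q) of μ(Ioi s) is expanded into an integral of μ(Ioi t)^{q/(p-q)} over t > s.
After Tonelli the inner integral of a power of ν(Iic s) over s < t is at most the next power of
ν(Iio t), which gives the functional. -/
theorem lintegral_hardyTest_rpow_le {p q r : ℝ} (hr : 0 < r) (hrq : r ≤ q) (hqp : q < p)
    (μ ν : Measure ℝ) [IsFiniteMeasure μ] [NullSingletonClass μ] [IsFiniteMeasure ν] :
    ∫⁻ s, hardyTest p q r μ ν s ^ (p / r) ∂ν ≤ 2 ^ (p / (p - q)) * hardyFun p q r μ ν := by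
  have hq : 0 < q := hr.trans_le hrq
  have hp : 0 < p := hq.trans hqp
  have hpq : 0 < p - q := by linarith
  have hqr : 0 ≤ q - r := by linarith
  have e3 : p / (p - q) = q / (p - q) + 1 := by field_simp; ring
  set A : ℝ → ℝ≥0∞ := fun t => μ (Ioi t) ^ (q / (p - q)) with hA
  set M : ℝ → ℝ≥0∞ := fun s => ν (Iic s) ^ (p * (q - r) / (r * (p - q))) with hM
  have hAm : Measurable A := measurable_measure_Ioi_rpow μ _
  have hMm : Measurable M := (monotone_measure_Iic ν).measurable.pow_const _
  calc ∫⁻ s, hardyTest p q r μ ν s ^ (p / r) ∂ν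
      ≤ ∫⁻ s, 2 ^ (p / (p - q)) * ((∫⁻ t in Ioi s, A t ∂μ) * M s) ∂ν := by
        refine lintegral_mono fun s => ?_
        rw [hardyTest, ENNReal.mul_rpow_of_nonneg _ _ (by positivity), ← ENNReal.rpow_mul,
          ← ENNReal.rpow_mul, ← mul_assoc]
        have e1 : r / (p - q) * (p / r) = q / (p - q) + 1 := by rw [← e3]; field_simp
        have e2 : (q - r) / (p - q) * (p / r) = p * (q - r) / (r * (p - q)) := by field_simp
        rw [e1, e2, e3]
        gcongr
        exact measure_Ioi_rpow_le μ (by positivity) s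
    _ = 2 ^ (p / (p - q)) * ∫⁻ s, ∫⁻ t, (Ioi s).indicator A t * M s ∂μ ∂ν := by
        rw [lintegral_const_mul' _ _ (by simp)]
        congr 1
        refine lintegral_congr fun s => ?_
        rw [lintegral_mul_const _ (hAm.indicator measurableSet_Ioi),
          lintegral_indicator measurableSet_Ioi]
    _ = 2 ^ (p / (p - q)) * ∫⁻ t, ∫⁻ s, (Ioi s).indicator A t * M s ∂ν ∂μ := by
        congr 1
        refine lintegral_lintegral_swap ?_
        have : (Function.uncurry fun s t => (Ioi s).indicator A t * M s) =
            fun z : ℝ × ℝ => {z : ℝ × ℝ | z.1 < z.2}.indicator (fun z => A z.2) z * M z.1 := by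
          ext ⟨s, t⟩
          simp [Function.uncurry, Set.indicator]
        rw [this]
        exact (((hAm.comp measurable_snd).indicator
          (measurableSet_lt measurable_fst measurable_snd)).mul
          (hMm.comp measurable_fst)).aemeasurable
    _ ≤ 2 ^ (p / (p - q)) * hardyFun p q r μ ν := by
        gcongr 2 ^ (p / (p - q)) * ?_
        refine lintegral_mono fun t => ?_
        have e4 : q * (p - r) / (r * (p - q)) = p * (q - r) / (r * (p - q)) + 1 := by
          field_simp; ring
        calc ∫⁻ s, (Ioi s).indicator A t * M s ∂ν
            = ∫⁻ s, (Iio t).indicator (fun s => A t * M s) s ∂ν := by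
              refine lintegral_congr fun s => ?_
              simp [Set.indicator]
          _ = ∫⁻ s in Iio t, A t * M s ∂ν := lintegral_indicator measurableSet_Iio _
          _ ≤ ∫⁻ _ in Iio t, A t * ν (Iio t) ^ (p * (q - r) / (r * (p - q))) ∂ν := by
              refine setLIntegral_mono' measurableSet_Iio fun s hs => ?_
              refine mul_le_mul' le_rfl (ENNReal.rpow_le_rpow (measure_mono ?_) (by positivity))
              exact Iic_subset_Iio.2 hs
          _ = _ := by
              rw [setLIntegral_const, e4, ENNReal.rpow_add_of_nonneg _ _ (by positivity)
                zero_le_one, ENNReal.rpow_one, mul_assoc]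

/-- This holds pointwise in t: for s < t the factor μ(Ioi s) is at least μ(Ioi t), and what is left
is the integral bounded below by `measure_Iio_rpow_le`. -/
theorem exists_hardyFun_le_lintegral_hardyTest {p q r : ℝ} (hr : 0 < r) (hrq : r ≤ q)
    (hqp : q < p) : ∃ c : ℝ≥0, ∀ (μ ν : Measure ℝ) [IsFiniteMeasure ν],
    hardyFun p q r μ ν ≤
      c * ∫⁻ t, (∫⁻ s in Iio t, hardyTest p q r μ ν s ∂ν) ^ (q / r) ∂μ := by
  have hq : 0 < q := hr.trans_le hrq
  have hp : 0 < p := hq.trans hqp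
  have hpq : 0 < p - q := by linarith
  have hqr : 0 ≤ q - r := by linarith
  have hpr : 0 < p - r := by linarith
  set κ := (q - r) / (p - q) with hκ
  have hκ0 : 0 ≤ κ := by positivity
  refine ⟨(2 ^ (κ + 1)) ^ (q / r), fun μ ν _ => ?_⟩
  push_cast [ENNReal.coe_rpow_of_nonneg _ (by positivity : 0 ≤ κ + 1),
    ENNReal.coe_rpow_of_nonneg _ (by positivity : 0 ≤ q / r)]
  rw [← lintegral_const_mul' _ _ (by simp)]
  refine lintegral_mono fun t => ?_
  rw [← ENNReal.mul_rpow_of_nonneg _ _ (by positivity)]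
  have e1 : q / (p - q) = r / (p - q) * (q / r) := by field_simp
  have e2 : q * (p - r) / (r * (p - q)) = (κ + 1) * (q / r) := by rw [hκ]; field_simp; ring
  rw [e1, e2, ENNReal.rpow_mul, ENNReal.rpow_mul, ← ENNReal.mul_rpow_of_nonneg _ _ (by positivity)]
  refine ENNReal.rpow_le_rpow ?_ (by positivity)
  calc μ (Ioi t) ^ (r / (p - q)) * ν (Iio t) ^ (κ + 1)
      ≤ μ (Ioi t) ^ (r / (p - q)) * (2 ^ (κ + 1) * ∫⁻ s in Iio t, ν (Iic s) ^ κ ∂ν) := by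
        gcongr; exact measure_Iio_rpow_le ν hκ0 t
    _ = 2 ^ (κ + 1) * ∫⁻ s in Iio t, μ (Ioi t) ^ (r / (p - q)) * ν (Iic s) ^ κ ∂ν := by
        rw [lintegral_const_mul _ ((monotone_measure_Iic ν).measurable.pow_const _)]; ring
    _ ≤ _ := by
        gcongr 2 ^ (κ + 1) * ?_
        refine setLIntegral_mono' measurableSet_Iio fun s hs => ?_
        rw [hardyTest]
        gcongr
        exact hs.le

/-- The functionals `hardyFun p` for `p < 1` are controlled by the one for `p = 1`. -/
theorem exists_hardy_nesting {p q r : ℝ} (hr : 0 < r) (hr1 : r < 1) (hq : 0 < q) (hqp : q < p)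
    (hp1 : p < 1) : ∃ c : ℝ≥0, ∀ (μ ν : Measure ℝ) [IsFiniteMeasure μ] [NullSingletonClass μ],
    ∫⁻ t, μ (Ioi t) ^ (q / (p - q)) * ν (Iio t) ^ (p * q * (1 - r) / (r * (p - q))) ∂μ ≤
      c * hardyFun 1 q r μ ν ^ (p * (1 - q) / (p - q)) := by
  have hp : 0 < p := hq.trans hqp
  have hpq : 0 < p - q := by linarith
  have h1q : 0 < 1 - q := by linarith
  have h1p : 0 < 1 - p := by linarith
  have h1r : 0 < 1 - r := by linarith
  set e := q * (1 - p) / (p - q) with he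
  have he0 : 0 ≤ e := by positivity
  refine ⟨(2 ^ (q / (1 - q) + 1)) ^ e, fun μ ν _ _ => ?_⟩
  push_cast [ENNReal.coe_rpow_of_nonneg _ (by positivity : 0 ≤ q / (1 - q) + 1),
    ENNReal.coe_rpow_of_nonneg _ he0]
  set U : ℝ → ℝ≥0∞ := fun t => μ (Ioi t) with hU
  set N : ℝ → ℝ≥0∞ := fun t => ν (Iio t) ^ (q * (1 - r) / (r * (1 - q))) with hN
  have hNm : Monotone N := fun s t h =>
    ENNReal.rpow_le_rpow (monotone_measure_Iio ν h) (by positivity)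
  -- Since N increases, its value at t can be moved inside the integral over (t, ∞), so the product
  -- at a single point is controlled by the whole functional. The excess of the exponents for p over
  -- those for 1 is exactly the power e of this product, and it leaves the integral as a constant.
  have hpt : ∀ t, U t ^ (q / (1 - q) + 1) * N t ≤
      2 ^ (q / (1 - q) + 1) * hardyFun 1 q r μ ν := by
    intro t
    calc U t ^ (q / (1 - q) + 1) * N t
        ≤ 2 ^ (q / (1 - q) + 1) * (∫⁻ s in Ioi t, U s ^ (q / (1 - q)) ∂μ) * N t := by
          gcongr; exact measure_Ioi_rpow_le μ (by positivity) t
      _ = 2 ^ (q / (1 - q) + 1) * ∫⁻ s in Ioi t, U s ^ (q / (1 - q)) * N t ∂μ := by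
          rw [lintegral_mul_const _ (measurable_measure_Ioi_rpow μ _), mul_assoc]
      _ ≤ 2 ^ (q / (1 - q) + 1) * ∫⁻ s in Ioi t, U s ^ (q / (1 - q)) * N s ∂μ := by
          gcongr 2 ^ (q / (1 - q) + 1) * ?_
          refine setLIntegral_mono' measurableSet_Ioi fun s hs => ?_
          gcongr
          exact hNm (le_of_lt hs)
      _ ≤ _ := by
          gcongr 2 ^ (q / (1 - q) + 1) * ?_
          exact setLIntegral_le_lintegral _ _
  have e1 : q / (p - q) = q / (1 - q) + (q / (1 - q) + 1) * e := by
    rw [he]; field_simp; ring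
  have e2 : p * q * (1 - r) / (r * (p - q)) =
      q * (1 - r) / (r * (1 - q)) + q * (1 - r) / (r * (1 - q)) * e := by
    rw [he]; field_simp; ring
  have e3 : p * (1 - q) / (p - q) = 1 + e := by
    rw [he]; field_simp; ring
  calc ∫⁻ t, μ (Ioi t) ^ (q / (p - q)) * ν (Iio t) ^ (p * q * (1 - r) / (r * (p - q))) ∂μ
      = ∫⁻ t, (U t ^ (q / (1 - q)) * N t) * (U t ^ (q / (1 - q) + 1) * N t) ^ e ∂μ := by
        refine lintegral_congr fun t => ?_
        rw [e1, e2, ENNReal.rpow_add_of_nonneg _ _ (by positivity) (by positivity),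
          ENNReal.rpow_add_of_nonneg _ _ (by positivity) (by positivity),
          ENNReal.mul_rpow_of_nonneg _ _ he0, ← ENNReal.rpow_mul, ← ENNReal.rpow_mul]
        ring
    _ ≤ ∫⁻ t, (U t ^ (q / (1 - q)) * N t) *
          (2 ^ (q / (1 - q) + 1) * hardyFun 1 q r μ ν) ^ e ∂μ := by
        refine lintegral_mono fun t => ?_
        exact mul_le_mul' le_rfl (ENNReal.rpow_le_rpow (hpt t) he0)
    _ = hardyFun 1 q r μ ν * (2 ^ (q / (1 - q) + 1) * hardyFun 1 q r μ ν) ^ e := by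
        have hm : Measurable fun t => U t ^ (q / (1 - q)) * N t :=
          (measurable_measure_Ioi_rpow μ _).mul (measurable_measure_Iio_rpow ν _)
        rw [lintegral_mul_const _ hm]
        rfl
    _ = _ := by
        rw [ENNReal.mul_rpow_of_nonneg _ _ he0, e3,
          ENNReal.rpow_add_of_nonneg _ _ zero_le_one he0, ENNReal.rpow_one]
        ring

end CesaroEmbedding

/-! ### The three energies, their discrete counterparts, and the comparison between them. -/

namespace CesaroEmbedding

open Set

/-- A discrete Hardy inequality for geometrically increasing weights. -/
theorem exists_geom_hardy_reflect {α σ : ℝ} (hα : 0 < α) (hσ : 0 < σ) (hσ1 : σ < 1) :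
    ∃ c : ℝ≥0, ∀ (w g : ℕ → ℝ≥0∞) (n : ℕ),
      (∀ k, k + 1 < n → w k ≤ ENNReal.ofReal σ * w (k + 1)) →
      ∑ k ∈ Finset.range n, w k * (∑ j ∈ Finset.Ico k n, g j) ^ α ≤
        c * ∑ k ∈ Finset.range n, w k * g k ^ α := by
  obtain ⟨c, hc⟩ := exists_geom_hardy hα hσ hσ1
  refine ⟨c, fun w g n hw => ?_⟩
  have h := hc (fun k => w (n - 1 - k)) (fun k => g (n - 1 - k)) n fun k hk => by
    have := hw (n - 1 - (k + 1)) (by omega)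
    rwa [show n - 1 - (k + 1) + 1 = n - 1 - k by omega] at this
  rw [Finset.sum_range_reflect (fun k => w k * g k ^ α)] at h
  refine le_trans (le_of_eq ?_) h
  rw [← Finset.sum_range_reflect]
  refine Finset.sum_congr rfl fun k hk => ?_
  have hk := Finset.mem_range.1 hk
  congr 2
  refine Finset.sum_bij' (fun j _ => n - 1 - j) (fun j _ => n - 1 - j) ?_ ?_ ?_ ?_ ?_ <;>
    simp only [Finset.mem_Ico, Finset.mem_range] <;> intros
  · omega
  · omega
  · omega
  · omega
  · congr 1; omega

/-- The functional of the Hardy inequality on `(x, ∞)` from `L^{1/r}(ν)` to `L^{q/r}(μ)`. -/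
noncomputable def beta (q r : ℝ) (μ ν : Measure ℝ) (x : ℝ) : ℝ≥0∞ :=
  hardyFun 1 q r μ (ν.restrict (Ioi x))

theorem restrict_Ioi_apply_Iio (ν : Measure ℝ) (x t : ℝ) :
    ν.restrict (Ioi x) (Iio t) = ν (Ioo x t) := by
  rw [Measure.restrict_apply measurableSet_Iio, inter_comm, Ioi_inter_Iio]

theorem beta_eq (q r : ℝ) (μ ν : Measure ℝ) (x : ℝ) : beta q r μ ν x =
    ∫⁻ t, μ (Ioi t) ^ (q / (1 - q)) * ν (Ioo x t) ^ (q * (1 - r) / (r * (1 - q))) ∂μ := by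
  simp only [beta, hardyFun, restrict_Ioi_apply_Iio]

theorem antitone_beta {q r : ℝ} (hq : 0 ≤ q) (hq1 : q ≤ 1) (hr : 0 ≤ r) (hr1 : r ≤ 1)
    (μ ν : Measure ℝ) : Antitone (beta q r μ ν) := by
  intro x y hxy
  simp only [beta_eq]
  refine lintegral_mono fun t => mul_le_mul' le_rfl ?_
  refine ENNReal.rpow_le_rpow (measure_mono (Ioo_subset_Ioo_left hxy)) ?_
  have h1 : 0 ≤ 1 - r := by linarith
  have h2 : 0 ≤ 1 - q := by linarith
  positivity

theorem beta_eq_zero {q r : ℝ} (hq : 0 < q) (hq1 : q < 1) (hr : 0 < r) (hr1 : r < 1)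
    {μ ν : Measure ℝ} {b x : ℝ} (hμ : μ (Ioi b) = 0) (hx : b ≤ x) : beta q r μ ν x = 0 := by
  have h1 : 0 < 1 - r := by linarith
  have h2 : 0 < 1 - q := by linarith
  rw [beta_eq]
  refine (lintegral_congr fun t => ?_).trans lintegral_zero
  rcases le_or_gt t x with h | h
  · rw [Ioo_eq_empty (not_lt.2 h), measure_empty, ENNReal.zero_rpow_of_pos (by positivity),
      mul_zero]
  · rw [measure_mono_null (Ioi_subset_Ioi (hx.trans h.le)) hμ,
      ENNReal.zero_rpow_of_pos (by positivity), zero_mul]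

/-- The inner integral of `C6`; the exponent of ν is that of V_r multiplied by pr/(p-r). -/
noncomputable def kern (p r : ℝ) (ν ω : Measure ℝ) (t : ℝ) : ℝ≥0∞ :=
  ∫⁻ s in Iio t, ω (Ioi s) ^ (-(p / (p - r))) * ν (Ioo s t) ^ (p * (1 - r) / (p - r)) ∂ω

theorem monotone_kern {p r : ℝ} (hp : 0 ≤ p) (hrp : r ≤ p) (hr1 : r ≤ 1) (ν ω : Measure ℝ) :
    Monotone (kern p r ν ω) := by
  intro t t' h
  refine (lintegral_mono_set (Iio_subset_Iio h)).trans (lintegral_mono fun s => ?_)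
  refine mul_le_mul' le_rfl (ENNReal.rpow_le_rpow (measure_mono (Ioo_subset_Ioo_right h)) ?_)
  have h1 : 0 ≤ 1 - r := by linarith
  have h2 : 0 ≤ p - r := by linarith
  positivity

noncomputable def tailEnergy (p q r : ℝ) (μ ν ω : Measure ℝ) : ℝ≥0∞ :=
  ∫⁻ x, ω (Ioi x) ^ (-(p / (p - q))) * beta q r μ ν x ^ (p * (1 - q) / (p - q)) ∂ω

noncomputable def endEnergy (p q r a : ℝ) (μ ν ω : Measure ℝ) : ℝ≥0∞ :=
  ω (Ioi a) ^ (-(q / (p - q))) * beta q r μ ν a ^ (p * (1 - q) / (p - q))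

noncomputable def kernEnergy (p q r : ℝ) (μ ν ω : Measure ℝ) : ℝ≥0∞ :=
  ∫⁻ t, μ (Ioi t) ^ (q / (p - q)) * kern p r ν ω t ^ (q * (p - r) / (r * (p - q))) ∂μ

/-- The discrete form of `tailEnergy` and `endEnergy` together; the term with k = 0 is the latter.
-/
noncomputable def blockSum (p q r : ℝ) (μ ν : Measure ℝ) (x : ℕ → ℝ) (m : ℕ → ℝ≥0∞) (n : ℕ) :
    ℝ≥0∞ :=
  ∑ k ∈ Finset.range n, m k ^ (-(q / (p - q))) * beta q r μ ν (x k) ^ (p * (1 - q) / (p - q))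

/-- The contribution of one block to `kern`: over block j, the integral of ω(Ioi s)^{-p/(p-r)} dω(s)
is of size m_j^{-r/(p-r)}. -/
noncomputable def atomWeight (p r : ℝ) (ν : Measure ℝ) (x : ℕ → ℝ) (m : ℕ → ℝ≥0∞) (j : ℕ) : ℝ≥0∞ :=
  m j ^ (-(r / (p - r))) * ν (Ioc (x j) (x (j + 1))) ^ (p * (1 - r) / (p - r))

/-- Each atom sits at the right end of its block, so that for t in block k the half-line `Iio t`
contains precisely the atoms of the blocks before k. -/
noncomputable def atomMeasure (p r : ℝ) (ν : Measure ℝ) (x : ℕ → ℝ) (m : ℕ → ℝ≥0∞) (n : ℕ) :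
    Measure ℝ :=
  ∑ j ∈ Finset.range n, atomWeight p r ν x m j • Measure.dirac (x (j + 1))

theorem lintegral_atomMeasure (p r : ℝ) (ν : Measure ℝ) (x : ℕ → ℝ) (m : ℕ → ℝ≥0∞) (n : ℕ)
    {g : ℝ → ℝ≥0∞} (hg : Measurable g) : ∫⁻ s, g s ∂(atomMeasure p r ν x m n) =
      ∑ j ∈ Finset.range n, atomWeight p r ν x m j * g (x (j + 1)) := by
  simp only [atomMeasure, lintegral_finsetSum_measure, lintegral_smul_measure,
    lintegral_dirac' _ hg, smul_eq_mul]

theorem setLIntegral_Iio_atomMeasure (p r : ℝ) (ν : Measure ℝ) {x : ℕ → ℝ} (hx : StrictMono x)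
    (m : ℕ → ℝ≥0∞) {n k : ℕ} (hk : k ≤ n) {t : ℝ} (ht : t ∈ Ioc (x k) (x (k + 1)))
    {g : ℝ → ℝ≥0∞} (hg : Measurable g) : ∫⁻ s in Iio t, g s ∂(atomMeasure p r ν x m n) =
      ∑ j ∈ Finset.range k, atomWeight p r ν x m j * g (x (j + 1)) := by
  rw [← lintegral_indicator measurableSet_Iio,
    lintegral_atomMeasure _ _ _ _ _ _ (hg.indicator measurableSet_Iio)]
  symm
  refine Finset.sum_subset_zero_on_sdiff (Finset.range_mono hk) (fun j hj => ?_) fun j hj => ?_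
  · simp only [Finset.mem_sdiff, Finset.mem_range, not_lt] at hj
    rw [indicator_of_notMem, mul_zero]
    exact not_lt.2 (ht.2.trans (hx.monotone (by omega)))
  · have hj := Finset.mem_range.1 hj
    rw [indicator_of_mem]
    exact lt_of_le_of_lt (hx.monotone hj) ht.1

theorem atomMeasure_Iio (p r : ℝ) (ν : Measure ℝ) {x : ℕ → ℝ} (hx : StrictMono x)
    (m : ℕ → ℝ≥0∞) {n k : ℕ} (hk : k ≤ n) {t : ℝ} (ht : t ∈ Ioc (x k) (x (k + 1))) :
    atomMeasure p r ν x m n (Iio t) = ∑ j ∈ Finset.range k, atomWeight p r ν x m j := by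
  have := setLIntegral_Iio_atomMeasure p r ν hx m hk ht (measurable_const (a := (1 : ℝ≥0∞)))
  simpa using this

theorem lintegral_le_setLIntegral_Ioc {ω : Measure ℝ} {a b : ℝ} {f : ℝ → ℝ≥0∞}
    (ha : ω (Iic a) = 0) (hb : ∫⁻ t in Ioi b, f t ∂ω = 0) :
    ∫⁻ t, f t ∂ω ≤ ∫⁻ t in Ioc a b, f t ∂ω := by
  have : (univ : Set ℝ) ⊆ Iic a ∪ (Ioc a b ∪ Ioi b) := by
    intro t _
    rcases le_or_gt t a with h | h
    · exact Or.inl h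
    · rcases le_or_gt t b with h' | h'
      · exact Or.inr (Or.inl ⟨h, h'⟩)
      · exact Or.inr (Or.inr h')
  rw [← setLIntegral_univ]
  refine (lintegral_mono_set this).trans ((lintegral_union_le _ _ _).trans ?_)
  rw [setLIntegral_measure_zero _ _ ha, zero_add]
  refine (lintegral_union_le _ _ _).trans ?_
  rw [hb, add_zero]

theorem ae_mem_Ioc {μ : Measure ℝ} {a b : ℝ} (ha : μ (Iic a) = 0) (hb : μ (Ioi b) = 0) :
    ∀ᵐ t ∂μ, t ∈ Ioc a b := by
  have : (Ioc a b)ᶜ ⊆ Iic a ∪ Ioi b := fun t ht => by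
    by_contra h
    simp only [mem_union, mem_Iic, mem_Ioi, not_or, not_le, not_lt] at h
    exact ht h
  exact measure_mono_null this (measure_union_null ha hb)

theorem exists_mem_block {x : ℕ → ℝ} {n : ℕ} {t : ℝ} (ht : t ∈ Ioc (x 0) (x n)) :
    ∃ k < n, t ∈ Ioc (x k) (x (k + 1)) := by
  have hex : ∃ j, t ≤ x j := ⟨n, ht.2⟩
  classical
  have hpos : Nat.find hex ≠ 0 := fun h => by
    have := Nat.find_spec hex
    rw [h] at this
    exact not_lt.2 this ht.1
  have hle := Nat.find_min' hex ht.2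
  refine ⟨Nat.find hex - 1, by omega, ?_, ?_⟩
  · exact not_le.1 (Nat.find_min hex (by omega))
  · rw [Nat.sub_add_cancel (by omega)]; exact Nat.find_spec hex

section Comparison

variable {p q r : ℝ} {μ ν ω : Measure ℝ} {x : ℕ → ℝ} {m : ℕ → ℝ≥0∞} {n : ℕ}

theorem Dyadic.rpow_mul_self (hx : Dyadic ω x m) (k : ℕ) {s t : ℝ} (h : t = s - 1) :
    m k ^ (-s) * m k = m k ^ (-t) := by
  rw [h, show -(s - 1) = -s + 1 by ring, ENNReal.rpow_add _ _ (hx.ne_zero k) (hx.ne_top k),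
    ENNReal.rpow_one]

/-- A lower bound for an integral over a block. -/
theorem Dyadic.le_setLIntegral_block (hx : Dyadic ω x m) (k : ℕ) {s t : ℝ} (hs : 0 ≤ s)
    (hst : t = s - 1) {f : ℝ → ℝ≥0∞} {y : ℝ≥0∞}
    (hf : ∀ z ∈ Ioc (x k) (x (k + 1)), y ≤ f z) : m (k + 1) ^ (-t) * y ≤
      2 ^ s * ∫⁻ z in Ioc (x k) (x (k + 1)), ω (Ioi z) ^ (-s) * f z ∂ω := by
  calc m (k + 1) ^ (-t) * y
      = 2 ^ s * ∫⁻ _ in Ioc (x k) (x (k + 1)), m k ^ (-s) * y ∂ω := by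
        rw [setLIntegral_const, hx.measure_block, ← hx.rpow_mul_self (k + 1) hst,
          hx.rpow_succ_neg k]
        ring
    _ ≤ _ := by
        gcongr 2 ^ s * ?_
        refine setLIntegral_mono' measurableSet_Ioc fun z hz => mul_le_mul' ?_ (hf z hz)
        rw [ENNReal.rpow_neg, ENNReal.rpow_neg]
        exact ENNReal.inv_le_inv.2 (ENNReal.rpow_le_rpow (hx.tail_le hz.1.le) hs)

/-- An upper bound for an integral over a block. -/
theorem Dyadic.setLIntegral_block_le (hx : Dyadic ω x m) (k : ℕ) {s t : ℝ} (hs : 0 ≤ s)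
    (hst : t = s - 1) {f : ℝ → ℝ≥0∞} {y : ℝ≥0∞}
    (hf : ∀ z ∈ Ioc (x k) (x (k + 1)), f z ≤ y) :
    ∫⁻ z in Ioc (x k) (x (k + 1)), ω (Ioi z) ^ (-s) * f z ∂ω ≤ 2 ^ t * (m k ^ (-t) * y) := by
  calc ∫⁻ z in Ioc (x k) (x (k + 1)), ω (Ioi z) ^ (-s) * f z ∂ω
      ≤ ∫⁻ _ in Ioc (x k) (x (k + 1)), m (k + 1) ^ (-s) * y ∂ω := by
        refine setLIntegral_mono' measurableSet_Ioc fun z hz => mul_le_mul' ?_ (hf z hz)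
        rw [ENNReal.rpow_neg, ENNReal.rpow_neg]
        exact ENNReal.inv_le_inv.2 (ENNReal.rpow_le_rpow (hx.le_tail hz.2) hs)
    _ = _ := by
        rw [setLIntegral_const, hx.measure_block, mul_right_comm, hx.rpow_mul_self (k + 1) hst,
          hx.rpow_succ_neg k]
        ring

/-- As β decreases, the term k + 1 is dominated by the integral over block k. The term k = 0 has no
block to its left, which is why the end term is needed. -/
theorem blockSum_le (hr : 0 < r) (hr1 : r < 1) (hq : 0 < q) (hqp : q < p) (hp1 : p < 1)
    (hx : Dyadic ω x m) : blockSum p q r μ ν x m n ≤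
      2 ^ (p / (p - q)) * tailEnergy p q r μ ν ω + endEnergy p q r (x 0) μ ν ω := by
  have hpq : 0 < p - q := by linarith
  have hp : 0 < p := by linarith
  have h1q : 0 < 1 - q := by linarith
  have hst : q / (p - q) = p / (p - q) - 1 := by field_simp; ring
  cases n with
  | zero => simp [blockSum]
  | succ n =>
    rw [blockSum, Finset.sum_range_succ']
    refine add_le_add ?_ (by rw [endEnergy, hx.tail])
    calc _ ≤ ∑ k ∈ Finset.range n, 2 ^ (p / (p - q)) * ∫⁻ z in Ioc (x k) (x (k + 1)),
          ω (Ioi z) ^ (-(p / (p - q))) * beta q r μ ν z ^ (p * (1 - q) / (p - q)) ∂ω := by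
          refine Finset.sum_le_sum fun k _ =>
            hx.le_setLIntegral_block k (by positivity) hst fun z hz => ?_
          exact ENNReal.rpow_le_rpow
            (antitone_beta hq.le (by linarith) hr.le hr1.le μ ν hz.2) (by positivity)
      _ = 2 ^ (p / (p - q)) * ∫⁻ z in Ioc (x 0) (x n),
          ω (Ioi z) ^ (-(p / (p - q))) * beta q r μ ν z ^ (p * (1 - q) / (p - q)) ∂ω := by
          rw [← Finset.mul_sum, setLIntegral_Ioc_eq_sum ω hx.strictMono.monotone]
      _ ≤ _ := by
          gcongr 2 ^ (p / (p - q)) * ?_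
          exact setLIntegral_le_lintegral _ _

/-- To the right of x n the function β vanishes together with the tail of μ, so n blocks suffice. -/
theorem tailEnergy_le (hr : 0 < r) (hr1 : r < 1) (hq : 0 < q) (hqp : q < p) (hp1 : p < 1)
    (hx : Dyadic ω x m) (hμ : μ (Ioi (x n)) = 0) :
    tailEnergy p q r μ ν ω ≤ 2 ^ (q / (p - q)) * blockSum p q r μ ν x m n := by
  have hpq : 0 < p - q := by linarith
  have hp : 0 < p := by linarith
  have h1q : 0 < 1 - q := by linarith
  have hst : q / (p - q) = p / (p - q) - 1 := by field_simp; ring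
  refine (lintegral_le_setLIntegral_Ioc (b := x n) hx.null ?_).trans ?_
  · refine (setLIntegral_congr_fun measurableSet_Ioi fun t ht => ?_).trans lintegral_zero
    rw [beta_eq_zero hq (by linarith) hr hr1 hμ (le_of_lt ht),
      ENNReal.zero_rpow_of_pos (by positivity), mul_zero]
  rw [setLIntegral_Ioc_eq_sum ω hx.strictMono.monotone, blockSum, Finset.mul_sum]
  refine Finset.sum_le_sum fun k _ =>
    hx.setLIntegral_block_le k (by positivity) hst fun z hz => ?_
  exact ENNReal.rpow_le_rpow
    (antitone_beta hq.le (by linarith) hr.le hr1.le μ ν hz.1.le) (by positivity)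

theorem endEnergy_le (hx : Dyadic ω x m) (hn : 0 < n) :
    endEnergy p q r (x 0) μ ν ω ≤ blockSum p q r μ ν x m n := by
  rw [endEnergy, hx.tail, blockSum]
  exact Finset.single_le_sum (f := fun k => m k ^ (-(q / (p - q))) *
    beta q r μ ν (x k) ^ (p * (1 - q) / (p - q))) (fun _ _ => zero_le) (Finset.mem_range.2 hn)

/-- Every atom but the first is dominated by the part of `kern` coming from the preceding block. The
first atom leads to a functional on (x 0, ∞) that `exists_hardy_nesting` bounds by the end term. -/
theorem exists_hardyFun_atomMeasure_le (hr : 0 < r) (hrq : r ≤ q) (hqp : q < p) (hp1 : p < 1) :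
    ∃ c : ℝ≥0, ∀ (μ ν ω : Measure ℝ) (x : ℕ → ℝ) (m : ℕ → ℝ≥0∞) (n : ℕ) [IsFiniteMeasure μ]
      [NullSingletonClass μ], Dyadic ω x m → μ (Iic (x 0)) = 0 → μ (Ioi (x n)) = 0 →
      hardyFun p q r μ (atomMeasure p r ν x m n) ≤
        c * (kernEnergy p q r μ ν ω + endEnergy p q r (x 0) μ ν ω) := by
  have hq : 0 < q := by linarith
  have hp : 0 < p := by linarith
  have hpq : 0 < p - q := by linarith
  have hpr : 0 < p - r := by linarith
  have h1r : 0 < 1 - r := by linarith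
  have hst : r / (p - r) = p / (p - r) - 1 := by field_simp; ring
  obtain ⟨c, hc⟩ := exists_hardy_nesting hr (by linarith : r < 1) hq hqp hp1
  set γ := q * (p - r) / (r * (p - q)) with hγ
  have hγ0 : 0 ≤ γ := by positivity
  set κ := p / (p - r) with hκ
  have hκ0 : 0 ≤ κ := by positivity
  set α := p * (1 - r) / (p - r) with hα
  have hα0 : 0 ≤ α := by positivity
  refine ⟨2 ^ γ * (2 ^ κ) ^ γ + 2 ^ γ * c, fun μ ν ω x m n _ _ hx hμ0 hμ => ?_⟩
  have hmono := hx.strictMono.monotone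
  have hpt : ∀ k ≤ n, ∀ t ∈ Ioc (x k) (x (k + 1)), atomMeasure p r ν x m n (Iio t) ≤
      2 ^ κ * kern p r ν ω t + m 0 ^ (-(r / (p - r))) * ν (Ioo (x 0) t) ^ α := by
    intro k hk t ht
    rw [atomMeasure_Iio p r ν hx.strictMono m hk ht]
    cases k with
    | zero => simp
    | succ k =>
      rw [Finset.sum_range_succ']
      refine add_le_add ?_ ?_
      · calc ∑ j ∈ Finset.range k, atomWeight p r ν x m (j + 1)
            ≤ ∑ j ∈ Finset.range k, 2 ^ κ * ∫⁻ s in Ioc (x j) (x (j + 1)),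
                ω (Ioi s) ^ (-κ) * ν (Ioo s t) ^ α ∂ω := by
              refine Finset.sum_le_sum fun j hj =>
                hx.le_setLIntegral_block j hκ0 hst fun z hz => ?_
              refine ENNReal.rpow_le_rpow (measure_mono fun s hs => ?_) hα0
              have hj := Finset.mem_range.1 hj
              exact ⟨hz.2.trans_lt hs.1,
                (hs.2.trans (hmono (by omega : j + 1 + 1 ≤ k + 1))).trans_lt ht.1⟩
          _ = 2 ^ κ * ∫⁻ s in Ioc (x 0) (x k), ω (Ioi s) ^ (-κ) * ν (Ioo s t) ^ α ∂ω := by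
              rw [← Finset.mul_sum, setLIntegral_Ioc_eq_sum ω hmono]
          _ ≤ _ := by
              gcongr 2 ^ κ * ?_
              exact lintegral_mono_set fun s hs =>
                (hs.2.trans (hmono (Nat.le_succ k))).trans_lt ht.1
      · rw [atomWeight]
        refine mul_le_mul' le_rfl (ENNReal.rpow_le_rpow (measure_mono fun s hs => ?_) hα0)
        exact ⟨hs.1, (hs.2.trans (hmono (by omega))).trans_lt ht.1⟩
  have e1 : r / (p - r) * γ = q / (p - q) := by rw [hγ]; field_simp
  -- Raising ν^α to the power γ gives exactly the exponent in `exists_hardy_nesting`.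
  have e2 : α * γ = p * q * (1 - r) / (r * (p - q)) := by rw [hγ, hα]; field_simp
  have hm : Measurable fun t => μ (Ioi t) ^ (q / (p - q)) * kern p r ν ω t ^ γ :=
    (measurable_measure_Ioi_rpow μ _).mul
      ((monotone_kern hp.le (by linarith) (by linarith) ν ω).measurable.pow_const _)
  have hm' : Measurable fun t => μ (Ioi t) ^ (q / (p - q)) *
      (ν.restrict (Ioi (x 0))) (Iio t) ^ (p * q * (1 - r) / (r * (p - q))) :=
    (measurable_measure_Ioi_rpow μ _).mul (measurable_measure_Iio_rpow _ _)
  have hae : ∀ᵐ t ∂μ, μ (Ioi t) ^ (q / (p - q)) * atomMeasure p r ν x m n (Iio t) ^ γ ≤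
      2 ^ γ * (2 ^ κ) ^ γ * (μ (Ioi t) ^ (q / (p - q)) * kern p r ν ω t ^ γ) +
      2 ^ γ * m 0 ^ (-(q / (p - q))) * (μ (Ioi t) ^ (q / (p - q)) *
        (ν.restrict (Ioi (x 0))) (Iio t) ^ (p * q * (1 - r) / (r * (p - q)))) := by
    filter_upwards [ae_mem_Ioc hμ0 hμ] with t ht
    obtain ⟨k, hk, htk⟩ := exists_mem_block ht
    calc μ (Ioi t) ^ (q / (p - q)) * atomMeasure p r ν x m n (Iio t) ^ γ
        ≤ μ (Ioi t) ^ (q / (p - q)) * (2 ^ γ * ((2 ^ κ * kern p r ν ω t) ^ γ +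
            (m 0 ^ (-(r / (p - r))) * ν (Ioo (x 0) t) ^ α) ^ γ)) := by
          refine mul_le_mul' le_rfl ?_
          exact (ENNReal.rpow_le_rpow (hpt k hk.le t htk) hγ0).trans
            (add_rpow_le_two_rpow_mul _ _ hγ0)
      _ = _ := by
          rw [ENNReal.mul_rpow_of_nonneg _ _ hγ0, ENNReal.mul_rpow_of_nonneg _ _ hγ0,
            ← ENNReal.rpow_mul _ α, ← ENNReal.rpow_mul (m 0), neg_mul, e1, e2,
            restrict_Ioi_apply_Iio]
          ring
  calc hardyFun p q r μ (atomMeasure p r ν x m n)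
      ≤ 2 ^ γ * (2 ^ κ) ^ γ * kernEnergy p q r μ ν ω + 2 ^ γ * m 0 ^ (-(q / (p - q))) *
        ∫⁻ t, μ (Ioi t) ^ (q / (p - q)) *
          (ν.restrict (Ioi (x 0))) (Iio t) ^ (p * q * (1 - r) / (r * (p - q))) ∂μ := by
        refine (lintegral_mono_ae hae).trans (le_of_eq ?_)
        rw [lintegral_add_left (hm.const_mul _), lintegral_const_mul _ hm,
          lintegral_const_mul _ hm']
        rfl
    _ ≤ 2 ^ γ * (2 ^ κ) ^ γ * kernEnergy p q r μ ν ω + 2 ^ γ * m 0 ^ (-(q / (p - q))) *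
        (c * beta q r μ ν (x 0) ^ (p * (1 - q) / (p - q))) := by
        refine add_le_add le_rfl (mul_le_mul' le_rfl (hc _ _))
    _ = 2 ^ γ * (2 ^ κ) ^ γ * kernEnergy p q r μ ν ω + 2 ^ γ * c * endEnergy p q r (x 0) μ ν ω := by
        rw [endEnergy, hx.tail]; ring
    _ ≤ _ := by
        push_cast [ENNReal.coe_rpow_of_nonneg _ hκ0, ENNReal.coe_rpow_of_nonneg _ hγ0]
        rw [mul_add]
        gcongr
        · exact le_self_add
        · exact le_add_self

/-- From a point in block j to t there are the pieces g i with j ≤ i ≤ k. The weights m_j^{-r/(p-r)}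
increase geometrically, so the reflected Hardy inequality keeps only the diagonal terms: the full
blocks are atoms, and the last one is cut off at t. -/
theorem exists_kern_le (hr : 0 < r) (hrp : r < p) (hp1 : p < 1) :
    ∃ c : ℝ≥0, ∀ (ν ω : Measure ℝ) (x : ℕ → ℝ) (m : ℕ → ℝ≥0∞) (k : ℕ), Dyadic ω x m →
      ∀ t ∈ Ioc (x k) (x (k + 1)), kern p r ν ω t ≤
        c * (∑ j ∈ Finset.range k, atomWeight p r ν x m j +
          m k ^ (-(r / (p - r))) * ν (Ioo (x k) t) ^ (p * (1 - r) / (p - r))) := by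
  have hp : 0 < p := by linarith
  have hpr : 0 < p - r := by linarith
  have h1r : 0 < 1 - r := by linarith
  have hst : r / (p - r) = p / (p - r) - 1 := by field_simp; ring
  set κ := p / (p - r) with hκ
  have hκ0 : 0 ≤ κ := by positivity
  set α := p * (1 - r) / (p - r) with hα
  have hα0 : 0 < α := by positivity
  set s := r / (p - r) with hs
  have hs0 : 0 < s := by positivity
  obtain ⟨c, hc⟩ := exists_geom_hardy_reflect (α := α) (σ := 2 ^ (-s)) hα0 (by positivity)
    (Real.rpow_lt_one_of_one_lt_of_neg (by norm_num) (by linarith))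
  refine ⟨2 ^ s * c, fun ν ω x m k hx t ht => ?_⟩
  have hmono := hx.strictMono.monotone
  set g : ℕ → ℝ≥0∞ := fun i => ν (Ioc (x i) (x (i + 1)) ∩ Iio t) with hg
  have hsub : ∀ j ≤ k, ν (Ioo (x j) t) ≤ ∑ i ∈ Finset.Ico j (k + 1), g i := by
    intro j hj
    refine (measure_mono fun z hz => ?_).trans (measure_biUnion_finset_le _ _)
    have hz' : z ∈ Ioc ((fun i => x (j + i)) 0) ((fun i => x (j + i)) (k + 1 - j)) := by
      refine ⟨hz.1, ?_⟩
      simp only [show j + (k + 1 - j) = k + 1 by omega]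
      exact hz.2.le.trans ht.2
    obtain ⟨i, hi, hzi⟩ := exists_mem_block (x := fun i => x (j + i)) (n := k + 1 - j) hz'
    simp only [mem_iUnion, Finset.mem_Ico]
    exact ⟨j + i, ⟨by omega, by omega⟩, hzi, hz.2⟩
  have hw : ∀ i, i + 1 < k + 1 → m i ^ (-s) ≤ ENNReal.ofReal (2 ^ (-s)) * m (i + 1) ^ (-s) := by
    intro i _
    rw [hx.rpow_eq i (-s), ← ENNReal.ofReal_rpow_of_pos (by norm_num)]
    simp
  calc kern p r ν ω t
      ≤ ∫⁻ z in Iic (x 0) ∪ Ioc (x 0) (x (k + 1)), ω (Ioi z) ^ (-κ) * ν (Ioo z t) ^ α ∂ω := by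
        refine lintegral_mono_set fun z hz => ?_
        rcases le_or_gt z (x 0) with h | h
        · exact Or.inl h
        · exact Or.inr ⟨h, (le_of_lt hz).trans ht.2⟩
    _ ≤ ∫⁻ z in Ioc (x 0) (x (k + 1)), ω (Ioi z) ^ (-κ) * ν (Ioo z t) ^ α ∂ω := by
        refine (lintegral_union_le _ _ _).trans ?_
        rw [setLIntegral_measure_zero _ _ hx.null, zero_add]
    _ = ∑ j ∈ Finset.range (k + 1), ∫⁻ z in Ioc (x j) (x (j + 1)),
          ω (Ioi z) ^ (-κ) * ν (Ioo z t) ^ α ∂ω := setLIntegral_Ioc_eq_sum ω hmono _ _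
    _ ≤ ∑ j ∈ Finset.range (k + 1), 2 ^ s *
          (m j ^ (-s) * (∑ i ∈ Finset.Ico j (k + 1), g i) ^ α) := by
        refine Finset.sum_le_sum fun j hj =>
          hx.setLIntegral_block_le j hκ0 hst fun z hz => ENNReal.rpow_le_rpow ?_ hα0.le
        exact (measure_mono (Ioo_subset_Ioo_left hz.1.le)).trans
          (hsub j (Nat.lt_succ_iff.1 (Finset.mem_range.1 hj)))
    _ ≤ 2 ^ s * (c * ∑ j ∈ Finset.range (k + 1), m j ^ (-s) * g j ^ α) := by
        rw [← Finset.mul_sum]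
        gcongr
        exact hc (fun j => m j ^ (-s)) g (k + 1) hw
    _ ≤ 2 ^ s * (c * (∑ j ∈ Finset.range k, atomWeight p r ν x m j +
          m k ^ (-s) * ν (Ioo (x k) t) ^ α)) := by
        rw [Finset.sum_range_succ]
        gcongr with j hj
        · exact mul_le_mul' le_rfl
            (ENNReal.rpow_le_rpow (measure_mono inter_subset_left) hα0.le)
        · exact measure_mono fun z hz => ⟨hz.1.1, hz.2⟩
    _ = _ := by
        push_cast [ENNReal.coe_rpow_of_nonneg _ hs0.le]
        ring

/-- The atoms reproduce the Hardy functional of `atomMeasure`. The piece cut off at t in block k is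
controlled by a power of β(x k) through `exists_hardy_nesting`, which gives the k-th term of
`blockSum`. -/
theorem exists_kernEnergy_le (hr : 0 < r) (hrq : r ≤ q) (hqp : q < p) (hp1 : p < 1) :
    ∃ c : ℝ≥0, ∀ (μ ν ω : Measure ℝ) (x : ℕ → ℝ) (m : ℕ → ℝ≥0∞) (n : ℕ) [IsFiniteMeasure μ]
      [NullSingletonClass μ], Dyadic ω x m → μ (Iic (x 0)) = 0 → μ (Ioi (x n)) = 0 →
      kernEnergy p q r μ ν ω ≤
        c * (hardyFun p q r μ (atomMeasure p r ν x m n) + blockSum p q r μ ν x m n) := by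
  have hq : 0 < q := by linarith
  have hp : 0 < p := by linarith
  have hpq : 0 < p - q := by linarith
  have hpr : 0 < p - r := by linarith
  have h1r : 0 < 1 - r := by linarith
  obtain ⟨c₁, hc₁⟩ := exists_hardy_nesting hr (by linarith : r < 1) hq hqp hp1
  obtain ⟨c₂, hc₂⟩ := exists_kern_le hr (by linarith : r < p) hp1
  set γ := q * (p - r) / (r * (p - q)) with hγ
  have hγ0 : 0 ≤ γ := by positivity
  set α := p * (1 - r) / (p - r) with hα
  have hα0 : 0 ≤ α := by positivity
  have e1 : r / (p - r) * γ = q / (p - q) := by rw [hγ]; field_simp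
  have e2 : α * γ = p * q * (1 - r) / (r * (p - q)) := by rw [hγ, hα]; field_simp
  refine ⟨c₂ ^ γ * 2 ^ γ * (1 + c₁), fun μ ν ω x m n _ _ hx hμ0 hμ => ?_⟩
  have hmono := hx.strictMono.monotone
  set D : ℝ≥0∞ := (c₂ : ℝ≥0∞) ^ γ * 2 ^ γ with hD
  set η := atomMeasure p r ν x m n with hη
  have hblock : ∀ k < n, ∫⁻ t in Ioc (x k) (x (k + 1)),
      μ (Ioi t) ^ (q / (p - q)) * kern p r ν ω t ^ γ ∂μ ≤
      D * (∫⁻ t in Ioc (x k) (x (k + 1)), μ (Ioi t) ^ (q / (p - q)) * η (Iio t) ^ γ ∂μ +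
        c₁ * (m k ^ (-(q / (p - q))) * beta q r μ ν (x k) ^ (p * (1 - q) / (p - q)))) := by
    intro k hk
    have hm : Measurable fun t => μ (Ioi t) ^ (q / (p - q)) * η (Iio t) ^ γ :=
      (measurable_measure_Ioi_rpow μ _).mul (measurable_measure_Iio_rpow _ _)
    have hm' : Measurable fun t => μ (Ioi t) ^ (q / (p - q)) *
        (ν.restrict (Ioi (x k))) (Iio t) ^ (p * q * (1 - r) / (r * (p - q))) :=
      (measurable_measure_Ioi_rpow μ _).mul (measurable_measure_Iio_rpow _ _)
    calc ∫⁻ t in Ioc (x k) (x (k + 1)), μ (Ioi t) ^ (q / (p - q)) * kern p r ν ω t ^ γ ∂μ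
        ≤ ∫⁻ t in Ioc (x k) (x (k + 1)), (D * (μ (Ioi t) ^ (q / (p - q)) * η (Iio t) ^ γ) +
            D * m k ^ (-(q / (p - q))) * (μ (Ioi t) ^ (q / (p - q)) *
            (ν.restrict (Ioi (x k))) (Iio t) ^ (p * q * (1 - r) / (r * (p - q))))) ∂μ := by
          refine setLIntegral_mono' measurableSet_Ioc fun t ht => ?_
          have h := hc₂ ν ω x m k hx t ht
          rw [← atomMeasure_Iio p r ν hx.strictMono m hk.le ht] at h
          calc μ (Ioi t) ^ (q / (p - q)) * kern p r ν ω t ^ γ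
              ≤ μ (Ioi t) ^ (q / (p - q)) * (c₂ ^ γ * (2 ^ γ * (η (Iio t) ^ γ +
                (m k ^ (-(r / (p - r))) * ν (Ioo (x k) t) ^ α) ^ γ))) := by
                refine mul_le_mul' le_rfl ((ENNReal.rpow_le_rpow h hγ0).trans ?_)
                rw [ENNReal.mul_rpow_of_nonneg _ _ hγ0]
                exact mul_le_mul' le_rfl (add_rpow_le_two_rpow_mul _ _ hγ0)
            _ = _ := by
                rw [ENNReal.mul_rpow_of_nonneg _ _ hγ0, ← ENNReal.rpow_mul _ α,
                  ← ENNReal.rpow_mul (m k), neg_mul, e1, e2, restrict_Ioi_apply_Iio, hD]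
                ring
      _ = D * (∫⁻ t in Ioc (x k) (x (k + 1)), μ (Ioi t) ^ (q / (p - q)) * η (Iio t) ^ γ ∂μ) +
          D * m k ^ (-(q / (p - q))) * ∫⁻ t in Ioc (x k) (x (k + 1)), μ (Ioi t) ^ (q / (p - q)) *
            (ν.restrict (Ioi (x k))) (Iio t) ^ (p * q * (1 - r) / (r * (p - q))) ∂μ := by
          rw [lintegral_add_left (hm.const_mul _), lintegral_const_mul _ hm,
            lintegral_const_mul _ hm']
      _ ≤ D * (∫⁻ t in Ioc (x k) (x (k + 1)), μ (Ioi t) ^ (q / (p - q)) * η (Iio t) ^ γ ∂μ) +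
          D * m k ^ (-(q / (p - q))) *
            (c₁ * beta q r μ ν (x k) ^ (p * (1 - q) / (p - q))) := by
          refine add_le_add le_rfl (mul_le_mul' le_rfl ?_)
          exact (setLIntegral_le_lintegral _ _).trans (hc₁ _ _)
      _ = _ := by ring
  calc kernEnergy p q r μ ν ω
      ≤ ∫⁻ t in Ioc (x 0) (x n), μ (Ioi t) ^ (q / (p - q)) * kern p r ν ω t ^ γ ∂μ :=
        lintegral_le_setLIntegral_Ioc hμ0 (setLIntegral_measure_zero _ _ hμ)
    _ = ∑ k ∈ Finset.range n, ∫⁻ t in Ioc (x k) (x (k + 1)),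
          μ (Ioi t) ^ (q / (p - q)) * kern p r ν ω t ^ γ ∂μ := setLIntegral_Ioc_eq_sum μ hmono _ _
    _ ≤ _ := Finset.sum_le_sum fun k hk => hblock k (Finset.mem_range.1 hk)
    _ = D * (∫⁻ t in Ioc (x 0) (x n), μ (Ioi t) ^ (q / (p - q)) * η (Iio t) ^ γ ∂μ +
          c₁ * blockSum p q r μ ν x m n) := by
        rw [← Finset.mul_sum, Finset.sum_add_distrib, ← Finset.mul_sum,
          ← setLIntegral_Ioc_eq_sum μ hmono, blockSum]
    _ ≤ D * (1 * hardyFun p q r μ η + c₁ * blockSum p q r μ ν x m n) := by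
        rw [one_mul]
        exact mul_le_mul' le_rfl (add_le_add (setLIntegral_le_lintegral _ _) le_rfl)
    _ ≤ D * ((1 + c₁) * hardyFun p q r μ η + (1 + c₁) * blockSum p q r μ ν x m n) := by
        gcongr
        · exact le_self_add
        · exact le_add_self
    _ = _ := by
        push_cast [ENNReal.coe_rpow_of_nonneg _ hγ0]
        rw [hD]
        ring

end Comparison

end CesaroEmbedding

/-! ### Sufficiency: the inequality from the discrete quantities. -/

namespace CesaroEmbedding

open Set

/-- The inequality for measures, raised to the power `q`. -/
def MeasureIneq (p q r : ℝ) (μ ν ω : Measure ℝ) (C : ℝ≥0∞) : Prop :=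
  ∀ h : ℝ → ℝ≥0∞, Measurable h →
    ∫⁻ t, (∫⁻ s in Iio t, h s ^ r ∂ν) ^ (q / r) ∂μ ≤
      C * (∫⁻ t, (∫⁻ s in Iio t, h s ∂ν) ^ p ∂ω) ^ (q / p)

theorem exists_measurable_interpolation {x : ℕ → ℝ} (hx : StrictMono x) (y : ℕ → ℝ≥0∞) (n : ℕ) :
    ∃ g : ℝ → ℝ≥0∞, Measurable g ∧ ∀ j < n, g (x (j + 1)) = y j := by
  refine ⟨fun s => ∑ i ∈ Finset.range n, ({x (i + 1)} : Set ℝ).indicator (fun _ => y i) s,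
    Finset.measurable_sum _ fun i _ =>
      measurable_const.indicator (measurableSet_singleton _), fun j hj => ?_⟩
  beta_reduce
  rw [Finset.sum_eq_single_of_mem j (Finset.mem_range.2 hj)]
  · simp
  · intro i _ hij
    rw [indicator_of_notMem]
    simp only [mem_singleton_iff, hx.injective.eq_iff]
    omega

/-- For t in block k + 1 the inner integral contains all of block k, and the mass of block k + 1 is
m k / 4. -/
theorem sum_rpow_le_lintegral {p : ℝ} (hp : 0 ≤ p) {ν ω : Measure ℝ} {x : ℕ → ℝ} {m : ℕ → ℝ≥0∞}
    (hx : Dyadic ω x m) (n : ℕ) (h : ℝ → ℝ≥0∞) :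
    ∑ k ∈ Finset.range n, m k * (∫⁻ s in Ioc (x k) (x (k + 1)), h s ∂ν) ^ p ≤
      4 * ∫⁻ t, (∫⁻ s in Iio t, h s ∂ν) ^ p ∂ω := by
  calc ∑ k ∈ Finset.range n, m k * (∫⁻ s in Ioc (x k) (x (k + 1)), h s ∂ν) ^ p
      ≤ ∑ k ∈ Finset.range n,
        4 * ∫⁻ t in Ioc (x (k + 1)) (x (k + 2)), (∫⁻ s in Iio t, h s ∂ν) ^ p ∂ω := by
        refine Finset.sum_le_sum fun k _ => ?_
        rw [hx.half k, hx.half (k + 1), ← mul_assoc, show (2 : ℝ≥0∞) * 2 = 4 by norm_num,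
          mul_assoc, ← hx.measure_block (k + 1), mul_comm (ω _), ← setLIntegral_const]
        gcongr 4 * ?_
        refine setLIntegral_mono' measurableSet_Ioc fun t ht => ?_
        exact ENNReal.rpow_le_rpow (lintegral_mono_set fun s hs => hs.2.trans_lt ht.1) hp
    _ = 4 * ∑ k ∈ Finset.range n,
        ∫⁻ t in Ioc (x (k + 1)) (x (k + 2)), (∫⁻ s in Iio t, h s ∂ν) ^ p ∂ω := by
        rw [Finset.mul_sum]
    _ ≤ 4 * ∑ k ∈ Finset.range (n + 1),
        ∫⁻ t in Ioc (x k) (x (k + 1)), (∫⁻ s in Iio t, h s ∂ν) ^ p ∂ω := by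
        rw [Finset.sum_range_succ' _ n]; gcongr; exact le_self_add
    _ ≤ _ := by
        rw [← setLIntegral_Ioc_eq_sum ω hx.strictMono.monotone]
        gcongr 4 * ?_
        exact setLIntegral_le_lintegral _ _

/-- Hölder's inequality on a set, for the exponent `r < 1`. -/
theorem setLIntegral_rpow_le {r : ℝ} (hr : 0 < r) (hr1 : r < 1) (ν : Measure ℝ) (A : Set ℝ)
    {h : ℝ → ℝ≥0∞} (hh : Measurable h) :
    ∫⁻ s in A, h s ^ r ∂ν ≤ (∫⁻ s in A, h s ∂ν) ^ r * ν A ^ (1 - r) := by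
  have := lintegral_rpow_le_of_one_lt (ν.restrict A) (one_lt_one_div hr hr1)
    (hh.pow_const r).aemeasurable
  have e : (1 / r - 1) / (1 / r) = 1 - r := by field_simp
  simpa only [← ENNReal.rpow_mul, mul_one_div_cancel hr.ne', ENNReal.rpow_one, one_div_one_div, e,
    Measure.restrict_apply_univ] using this

/-- On each block the Hardy inequality with p = 1 applies to h^r, cut off at the right end of the
block, and gives β(x k)^{1-q} F_k^q. Inserting m_k^{q/p} m_k^{-q/p} prepares Hölder over k with
exponents q/p and 1 - q/p. -/
theorem exists_block_term_le {p q r : ℝ} (hr : 0 < r) (hrq : r ≤ q) (hqp : q < p) (hp1 : p < 1) :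
    ∃ c : ℝ≥0, ∀ (μ ν ω : Measure ℝ) (x : ℕ → ℝ) (m : ℕ → ℝ≥0∞) (n : ℕ) [IsFiniteMeasure μ]
      [NullSingletonClass μ], Dyadic ω x m → μ (Iic (x 0)) = 0 →
      ∀ h : ℝ → ℝ≥0∞, Measurable h →
      ∑ k ∈ Finset.range n, ∫⁻ t in Ioc (x k) (x (k + 1)),
        (∫⁻ s in Ioo (x k) t, h s ^ r ∂ν) ^ (q / r) ∂μ ≤
      c * blockSum p q r μ ν x m n ^ ((p - q) / p) *
        (∫⁻ t, (∫⁻ s in Iio t, h s ∂ν) ^ p ∂ω) ^ (q / p) := by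
  have hq : 0 < q := by linarith
  have hp : 0 < p := by linarith
  have hpq : 0 < p - q := by linarith
  have hθ : 1 - q / p = (p - q) / p := by field_simp
  obtain ⟨c, hc⟩ := exists_hardy_upper hr hrq (hqp.trans hp1)
  refine ⟨c * 4 ^ (q / p), fun μ ν ω x m n _ _ hx hμ h hh => ?_⟩
  have hmono := hx.strictMono.monotone
  set F : ℕ → ℝ≥0∞ := fun k => ∫⁻ s in Ioc (x k) (x (k + 1)), h s ∂ν with hF
  set S : ℕ → ℝ≥0∞ := fun k =>
    m k ^ (-(q / (p - q))) * beta q r μ ν (x k) ^ (p * (1 - q) / (p - q)) with hS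
  have hk : ∀ k, ∫⁻ t in Ioc (x k) (x (k + 1)),
      (∫⁻ s in Ioo (x k) t, h s ^ r ∂ν) ^ (q / r) ∂μ ≤
        c * ((m k * F k ^ p) ^ (q / p) * S k ^ (1 - q / p)) := by
    intro k
    set g : ℝ → ℝ≥0∞ := (Iic (x (k + 1))).indicator fun s => h s ^ r with hg
    have hgm : Measurable g := (hh.pow_const r).indicator measurableSet_Iic
    have h1 := hc (x 0) μ (ν.restrict (Ioi (x k))) hμ (by
      rw [restrict_Ioi_apply_Iio, Ioo_eq_empty (not_lt.2 (hmono (Nat.zero_le k))),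
        measure_empty]) g hgm
    have h2 : ∫⁻ s, g s ^ (1 / r) ∂(ν.restrict (Ioi (x k))) = F k := by
      have : (fun s => g s ^ (1 / r)) = (Iic (x (k + 1))).indicator h := by
        ext s
        by_cases hs : s ∈ Iic (x (k + 1))
        · simp only [hg, indicator_of_mem hs]
          rw [← ENNReal.rpow_mul, mul_one_div_cancel hr.ne', ENNReal.rpow_one]
        · simp only [hg, indicator_of_notMem hs]
          exact ENNReal.zero_rpow_of_pos (by positivity)
      rw [this, lintegral_indicator measurableSet_Iic, Measure.restrict_restrict measurableSet_Iic,
        inter_comm, Ioi_inter_Iic]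
    calc ∫⁻ t in Ioc (x k) (x (k + 1)), (∫⁻ s in Ioo (x k) t, h s ^ r ∂ν) ^ (q / r) ∂μ
        = ∫⁻ t in Ioc (x k) (x (k + 1)),
            (∫⁻ s in Iio t, g s ∂(ν.restrict (Ioi (x k)))) ^ (q / r) ∂μ := by
          refine setLIntegral_congr_fun measurableSet_Ioc fun t ht => ?_
          congr 1
          rw [Measure.restrict_restrict measurableSet_Iio, inter_comm, Ioi_inter_Iio]
          refine setLIntegral_congr_fun measurableSet_Ioo fun s hs => ?_
          simp only [hg]
          rw [indicator_of_mem]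
          exact hs.2.le.trans ht.2
      _ ≤ _ := (setLIntegral_le_lintegral _ _).trans h1
      _ = c * (beta q r μ ν (x k) ^ (1 - q) * F k ^ q) := by
          rw [h2, beta, div_one, div_one, mul_assoc]
      _ = _ := by
          congr 1
          rw [hS, ENNReal.mul_rpow_of_nonneg _ _ (by positivity), hθ,
            ENNReal.mul_rpow_of_nonneg _ _ (by positivity), ← ENNReal.rpow_mul,
            ← ENNReal.rpow_mul, ← ENNReal.rpow_mul, mul_div_cancel₀ q hp.ne']
          have e1 : p * (1 - q) / (p - q) * ((p - q) / p) = 1 - q := by field_simp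
          have e2 : -(q / (p - q)) * ((p - q) / p) = -(q / p) := by field_simp
          rw [e1, e2]
          have e3 : m k ^ (q / p) * m k ^ (-(q / p)) = 1 := by
            rw [← ENNReal.rpow_add _ _ (hx.ne_zero k) (hx.ne_top k)]; simp
          calc _ = (m k ^ (q / p) * m k ^ (-(q / p))) *
                (beta q r μ ν (x k) ^ (1 - q) * F k ^ q) := by rw [e3, one_mul]
            _ = _ := by ring
  calc _ ≤ ∑ k ∈ Finset.range n, c * ((m k * F k ^ p) ^ (q / p) * S k ^ (1 - q / p)) :=
        Finset.sum_le_sum fun k _ => hk k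
    _ ≤ c * ((∑ k ∈ Finset.range n, m k * F k ^ p) ^ (q / p) *
          (∑ k ∈ Finset.range n, S k) ^ (1 - q / p)) := by
        rw [← Finset.mul_sum]
        exact mul_le_mul' le_rfl
          (sum_rpow_mul_rpow_le _ _ _ (by positivity) ((div_lt_one hp).2 hqp))
    _ ≤ c * ((4 * ∫⁻ t, (∫⁻ s in Iio t, h s ∂ν) ^ p ∂ω) ^ (q / p) *
          blockSum p q r μ ν x m n ^ ((p - q) / p)) := by
        rw [hθ]
        refine mul_le_mul' le_rfl (mul_le_mul' (ENNReal.rpow_le_rpow ?_ (by positivity)) le_rfl)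
        exact sum_rpow_le_lintegral hp.le hx n h
    _ = _ := by
        push_cast [ENNReal.coe_rpow_of_nonneg _ (by positivity : 0 ≤ q / p)]
        rw [ENNReal.mul_rpow_of_nonneg _ _ (by positivity)]
        ring

theorem exists_atom_term_le {p q r : ℝ} (hr : 0 < r) (hrq : r ≤ q) (hqp : q < p) (hp1 : p < 1) :
    ∃ c : ℝ≥0, ∀ (μ ν ω : Measure ℝ) (x : ℕ → ℝ) (m : ℕ → ℝ≥0∞) (n : ℕ) [IsFiniteMeasure μ]
      [NullSingletonClass μ] [IsFiniteMeasure ν], Dyadic ω x m → μ (Iic (x 0)) = 0 →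
      ∀ h : ℝ → ℝ≥0∞, Measurable h →
      ∑ k ∈ Finset.range n, ∫⁻ _ in Ioc (x k) (x (k + 1)),
        (∑ j ∈ Finset.range k, ∫⁻ s in Ioc (x j) (x (j + 1)), h s ^ r ∂ν) ^ (q / r) ∂μ ≤
      c * hardyFun p q r μ (atomMeasure p r ν x m n) ^ ((p - q) / p) *
        (∫⁻ t, (∫⁻ s in Iio t, h s ∂ν) ^ p ∂ω) ^ (q / p) := by
  have hq : 0 < q := by linarith
  have hp : 0 < p := by linarith
  have hpq : 0 < p - q := by linarith
  have hpr : 0 < p - r := by linarith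
  have h1r : 0 < 1 - r := by linarith
  obtain ⟨c, hc⟩ := exists_hardy_upper hr hrq hqp
  refine ⟨c * 4 ^ (q / p), fun μ ν ω x m n _ _ _ hx hμ h hh => ?_⟩
  have hmono := hx.strictMono.monotone
  set F : ℕ → ℝ≥0∞ := fun k => ∫⁻ s in Ioc (x k) (x (k + 1)), h s ∂ν with hF
  set η := atomMeasure p r ν x m n with hη
  set N : ℕ → ℝ≥0∞ := fun k => ν (Ioc (x k) (x (k + 1))) with hN
  -- The values at the atoms are dictated by two demands: weight times g must equal the Hölder bound
  -- F^r N^{1-r} of the block, and weight times g^{p/r} must not exceed m F^p. On blocks with N = 0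
  -- the negative power is ∞, but F = 0 there.
  obtain ⟨g, hgm, hg⟩ := exists_measurable_interpolation hx.strictMono
    (fun j => F j ^ r * (m j ^ (r / (p - r)) * N j ^ (-((1 - r) * r / (p - r))))) n
  have hF0 : ∀ j, N j = 0 → F j = 0 := fun j hj => setLIntegral_measure_zero _ _ hj
  have hNt : ∀ j, N j ≠ ∞ := fun j => measure_ne_top _ _
  have hα : 0 < p * (1 - r) / (p - r) := by positivity
  have hg1 : ∀ j < n, atomWeight p r ν x m j * g (x (j + 1)) = F j ^ r * N j ^ (1 - r) := by
    intro j hj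
    rw [hg j hj, atomWeight]
    rcases eq_or_ne (N j) 0 with h0 | h0
    · rw [hF0 j h0, ENNReal.zero_rpow_of_pos hr, zero_mul, zero_mul, mul_zero]
    · have e1 : m j ^ (-(r / (p - r))) * m j ^ (r / (p - r)) = 1 := by
        rw [← ENNReal.rpow_add _ _ (hx.ne_zero j) (hx.ne_top j)]; simp
      have e2 : N j ^ (p * (1 - r) / (p - r)) * N j ^ (-((1 - r) * r / (p - r))) =
          N j ^ (1 - r) := by
        rw [← ENNReal.rpow_add _ _ h0 (hNt j)]
        congr 1; field_simp; ring
      calc _ = (m j ^ (-(r / (p - r))) * m j ^ (r / (p - r))) * F j ^ r *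
            (N j ^ (p * (1 - r) / (p - r)) * N j ^ (-((1 - r) * r / (p - r)))) := by ring
        _ = _ := by rw [e1, e2, one_mul]
  have hg2 : ∀ j < n, atomWeight p r ν x m j * g (x (j + 1)) ^ (p / r) ≤ m j * F j ^ p := by
    intro j hj
    rw [hg j hj, atomWeight]
    rcases eq_or_ne (N j) 0 with h0 | h0
    · have h0' : ν (Ioc (x j) (x (j + 1))) = 0 := h0
      rw [h0', ENNReal.zero_rpow_of_pos hα, mul_zero, zero_mul]
      exact zero_le
    · rw [ENNReal.mul_rpow_of_nonneg _ _ (by positivity),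
        ENNReal.mul_rpow_of_nonneg _ _ (by positivity), ← ENNReal.rpow_mul, ← ENNReal.rpow_mul,
        ← ENNReal.rpow_mul, mul_div_cancel₀ p hr.ne']
      have e1 : m j ^ (-(r / (p - r))) * m j ^ (r / (p - r) * (p / r)) = m j := by
        rw [← ENNReal.rpow_add _ _ (hx.ne_zero j) (hx.ne_top j)]
        have : -(r / (p - r)) + r / (p - r) * (p / r) = 1 := by field_simp; ring
        rw [this, ENNReal.rpow_one]
      have e2 : N j ^ (p * (1 - r) / (p - r)) * N j ^ (-((1 - r) * r / (p - r)) * (p / r)) = 1 := by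
        rw [← ENNReal.rpow_add _ _ h0 (hNt j)]
        have : p * (1 - r) / (p - r) + -((1 - r) * r / (p - r)) * (p / r) = 0 := by
          field_simp; ring
        rw [this, ENNReal.rpow_zero]
      refine le_of_eq ?_
      calc _ = (m j ^ (-(r / (p - r))) * m j ^ (r / (p - r) * (p / r))) * F j ^ p *
            (N j ^ (p * (1 - r) / (p - r)) * N j ^ (-((1 - r) * r / (p - r)) * (p / r))) := by ring
        _ = _ := by rw [e1, e2, mul_one]
  have hη0 : η (Iio (x 0)) = 0 := by
    have := lintegral_atomMeasure p r ν x m n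
      ((measurable_const (a := (1 : ℝ≥0∞))).indicator (measurableSet_Iio (a := x 0)))
    rw [lintegral_indicator measurableSet_Iio] at this
    simp only [lintegral_const, Measure.restrict_apply_univ, one_mul] at this
    rw [hη, this]
    refine Finset.sum_eq_zero fun j _ => ?_
    rw [indicator_of_notMem, mul_zero]
    exact not_lt.2 (hmono (Nat.zero_le _))
  calc ∑ k ∈ Finset.range n, ∫⁻ _ in Ioc (x k) (x (k + 1)),
        (∑ j ∈ Finset.range k, ∫⁻ s in Ioc (x j) (x (j + 1)), h s ^ r ∂ν) ^ (q / r) ∂μ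
      ≤ ∑ k ∈ Finset.range n, ∫⁻ t in Ioc (x k) (x (k + 1)),
        (∫⁻ s in Iio t, g s ∂η) ^ (q / r) ∂μ := by
        refine Finset.sum_le_sum fun k hk => ?_
        have hk := Finset.mem_range.1 hk
        refine setLIntegral_mono' measurableSet_Ioc fun t ht => ?_
        refine ENNReal.rpow_le_rpow ?_ (by positivity)
        rw [setLIntegral_Iio_atomMeasure p r ν hx.strictMono m hk.le ht hgm]
        refine Finset.sum_le_sum fun j hj => ?_
        rw [hg1 j ((Finset.mem_range.1 hj).trans hk)]
        exact setLIntegral_rpow_le hr (by linarith) ν _ hh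
    _ ≤ ∫⁻ t, (∫⁻ s in Iio t, g s ∂η) ^ (q / r) ∂μ := by
        rw [← setLIntegral_Ioc_eq_sum μ hmono]
        exact setLIntegral_le_lintegral _ _
    _ ≤ c * hardyFun p q r μ η ^ ((p - q) / p) * (∫⁻ s, g s ^ (p / r) ∂η) ^ (q / p) :=
        hc (x 0) μ η hμ hη0 g hgm
    _ ≤ c * hardyFun p q r μ η ^ ((p - q) / p) *
          (4 * ∫⁻ t, (∫⁻ s in Iio t, h s ∂ν) ^ p ∂ω) ^ (q / p) := by
        refine mul_le_mul' le_rfl (ENNReal.rpow_le_rpow ?_ (by positivity))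
        rw [lintegral_atomMeasure _ _ _ _ _ _ (hgm.pow_const _)]
        exact (Finset.sum_le_sum fun j hj => hg2 j (Finset.mem_range.1 hj)).trans
          (sum_rpow_le_lintegral hp.le hx n h)
    _ = _ := by
        push_cast [ENNReal.coe_rpow_of_nonneg _ (by positivity : 0 ≤ q / p)]
        rw [ENNReal.mul_rpow_of_nonneg _ _ (by positivity)]
        ring

theorem exists_measureIneq_of_blocks {p q r : ℝ} (hr : 0 < r) (hrq : r ≤ q) (hqp : q < p)
    (hp1 : p < 1) :
    ∃ c : ℝ≥0, ∀ (μ ν ω : Measure ℝ) (x : ℕ → ℝ) (m : ℕ → ℝ≥0∞) (n : ℕ) [IsFiniteMeasure μ]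
      [NullSingletonClass μ] [IsFiniteMeasure ν], Dyadic ω x m → μ (Iic (x 0)) = 0 →
      ν (Iic (x 0)) = 0 → μ (Ioi (x n)) = 0 →
      MeasureIneq p q r μ ν ω (c * (blockSum p q r μ ν x m n +
        hardyFun p q r μ (atomMeasure p r ν x m n)) ^ ((p - q) / p)) := by
  have hq : 0 < q := by linarith
  have hp : 0 < p := by linarith
  have hpq : 0 < p - q := by linarith
  have hQ : 0 ≤ q / r := by positivity
  obtain ⟨c₁, hc₁⟩ := exists_block_term_le hr hrq hqp hp1
  obtain ⟨c₂, hc₂⟩ := exists_atom_term_le hr hrq hqp hp1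
  refine ⟨2 ^ (q / r) * (c₂ + c₁), fun μ ν ω x m n _ _ _ hx hμ0 hν0 hμ h hh => ?_⟩
  have hmono := hx.strictMono.monotone
  set R := (∫⁻ t, (∫⁻ s in Iio t, h s ∂ν) ^ p ∂ω) ^ (q / p) with hR
  set B := blockSum p q r μ ν x m n with hB
  set H := hardyFun p q r μ (atomMeasure p r ν x m n) with hH
  have hsplit : ∀ k, ∀ t ∈ Ioc (x k) (x (k + 1)), ∫⁻ s in Iio t, h s ^ r ∂ν ≤
      ∑ j ∈ Finset.range k, ∫⁻ s in Ioc (x j) (x (j + 1)), h s ^ r ∂ν +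
        ∫⁻ s in Ioo (x k) t, h s ^ r ∂ν := by
    intro k t ht
    rw [← setLIntegral_Ioc_eq_sum ν hmono]
    have : Iio t ⊆ Iic (x 0) ∪ (Ioc (x 0) (x k) ∪ Ioo (x k) t) := by
      intro s hs
      rcases le_or_gt s (x 0) with h0 | h0
      · exact Or.inl h0
      rcases le_or_gt s (x k) with h1 | h1
      · exact Or.inr (Or.inl ⟨h0, h1⟩)
      · exact Or.inr (Or.inr ⟨h1, hs⟩)
    refine (lintegral_mono_set this).trans ((lintegral_union_le _ _ _).trans ?_)
    rw [setLIntegral_measure_zero _ _ hν0, zero_add]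
    exact lintegral_union_le _ _ _
  calc ∫⁻ t, (∫⁻ s in Iio t, h s ^ r ∂ν) ^ (q / r) ∂μ
      ≤ ∫⁻ t in Ioc (x 0) (x n), (∫⁻ s in Iio t, h s ^ r ∂ν) ^ (q / r) ∂μ :=
        lintegral_le_setLIntegral_Ioc hμ0 (setLIntegral_measure_zero _ _ hμ)
    _ = ∑ k ∈ Finset.range n, ∫⁻ t in Ioc (x k) (x (k + 1)),
          (∫⁻ s in Iio t, h s ^ r ∂ν) ^ (q / r) ∂μ := setLIntegral_Ioc_eq_sum μ hmono _ _
    _ ≤ ∑ k ∈ Finset.range n, 2 ^ (q / r) * (∫⁻ _ in Ioc (x k) (x (k + 1)),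
          (∑ j ∈ Finset.range k, ∫⁻ s in Ioc (x j) (x (j + 1)), h s ^ r ∂ν) ^ (q / r) ∂μ +
          ∫⁻ t in Ioc (x k) (x (k + 1)), (∫⁻ s in Ioo (x k) t, h s ^ r ∂ν) ^ (q / r) ∂μ) := by
        refine Finset.sum_le_sum fun k _ => ?_
        rw [← lintegral_add_left measurable_const, ← lintegral_const_mul' _ _ (by simp)]
        refine setLIntegral_mono' measurableSet_Ioc fun t ht => ?_
        exact (ENNReal.rpow_le_rpow (hsplit k t ht) hQ).trans (add_rpow_le_two_rpow_mul _ _ hQ)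
    _ ≤ 2 ^ (q / r) * (c₂ * H ^ ((p - q) / p) * R + c₁ * B ^ ((p - q) / p) * R) := by
        rw [← Finset.mul_sum, Finset.sum_add_distrib]
        exact mul_le_mul' le_rfl (add_le_add (hc₂ μ ν ω x m n hx hμ0 h hh)
          (hc₁ μ ν ω x m n hx hμ0 h hh))
    _ ≤ 2 ^ (q / r) * (c₂ * (B + H) ^ ((p - q) / p) * R + c₁ * (B + H) ^ ((p - q) / p) * R) := by
        gcongr
        · exact le_add_self
        · exact le_self_add
    _ = _ := by
        push_cast [ENNReal.coe_rpow_of_nonneg _ hQ]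
        ring

end CesaroEmbedding

/-! ### Necessity: test functions, and the two-sided estimate for regular measures. -/

namespace CesaroEmbedding

open Set

/-- Finiteness is what permits the absorption in `le_rpow_of_le_mul_rpow`. -/
theorem hardyFun_ne_top {p q r : ℝ} (hr : 0 < r) (hrp : r ≤ p) (hq : 0 < q) (hqp : q < p)
    (μ ν : Measure ℝ) [IsFiniteMeasure μ] [IsFiniteMeasure ν] : hardyFun p q r μ ν ≠ ∞ := by
  have hpq : 0 < p - q := by linarith
  have hpr : 0 ≤ p - r := by linarith
  have h1 : hardyFun p q r μ ν ≤
      ∫⁻ _, μ univ ^ (q / (p - q)) * ν univ ^ (q * (p - r) / (r * (p - q))) ∂μ :=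
    lintegral_mono fun t => mul_le_mul'
      (ENNReal.rpow_le_rpow (measure_mono (subset_univ _)) (by positivity))
      (ENNReal.rpow_le_rpow (measure_mono (subset_univ _)) (by positivity))
  refine ne_top_of_le_ne_top ?_ h1
  rw [lintegral_const]
  exact ENNReal.mul_ne_top (ENNReal.mul_ne_top
    (ENNReal.rpow_ne_top_of_nonneg (by positivity) (measure_ne_top _ _))
    (ENNReal.rpow_ne_top_of_nonneg (by positivity) (measure_ne_top _ _))) (measure_ne_top _ _)

/-- The converse of `sum_rpow_le_lintegral`: the integral up to t involves all earlier blocks, and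
the geometric decay of m removes them at the cost of a constant. -/
theorem exists_lintegral_le_iSup_sum {p : ℝ} (hp : 0 < p) :
    ∃ c : ℝ≥0, ∀ (ν ω : Measure ℝ) (x : ℕ → ℝ) (m : ℕ → ℝ≥0∞), Dyadic ω x m →
      ν (Iic (x 0)) = 0 → ∀ h : ℝ → ℝ≥0∞,
      ∫⁻ t, (∫⁻ s in Iio t, h s ∂ν) ^ p ∂ω ≤
        ⨆ n, c * ∑ k ∈ Finset.range n, m k * (∫⁻ s in Ioc (x k) (x (k + 1)), h s ∂ν) ^ p := by
  obtain ⟨c, hc⟩ := exists_geom_hardy (α := p) (σ := 1 / 2) hp (by norm_num) (by norm_num)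
  refine ⟨c, fun ν ω x m hx hν h => (hx.lintegral_le_iSup _).trans (iSup_mono fun n => ?_)⟩
  have hmono := hx.strictMono.monotone
  set H : ℕ → ℝ≥0∞ := fun k => ∫⁻ s in Ioc (x k) (x (k + 1)), h s ∂ν with hH
  have hsum : ∀ k, ∀ t ≤ x (k + 1), ∫⁻ s in Iio t, h s ∂ν ≤ ∑ j ∈ Finset.range (k + 1), H j := by
    intro k t ht
    rw [← setLIntegral_Ioc_eq_sum ν hmono]
    have : Iio t ⊆ Iic (x 0) ∪ Ioc (x 0) (x (k + 1)) := by
      intro s hs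
      rcases le_or_gt s (x 0) with h0 | h0
      · exact Or.inl h0
      · exact Or.inr ⟨h0, (le_of_lt hs).trans ht⟩
    refine (lintegral_mono_set this).trans ((lintegral_union_le _ _ _).trans ?_)
    rw [setLIntegral_measure_zero _ _ hν, zero_add]
  calc ∫⁻ t in Ioc (x 0) (x n), (∫⁻ s in Iio t, h s ∂ν) ^ p ∂ω
      = ∑ k ∈ Finset.range n, ∫⁻ t in Ioc (x k) (x (k + 1)), (∫⁻ s in Iio t, h s ∂ν) ^ p ∂ω :=
        setLIntegral_Ioc_eq_sum ω hmono _ _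
    _ ≤ ∑ k ∈ Finset.range n, m k * (∑ j ∈ Finset.range (k + 1), H j) ^ p := by
        refine Finset.sum_le_sum fun k _ => ?_
        calc ∫⁻ t in Ioc (x k) (x (k + 1)), (∫⁻ s in Iio t, h s ∂ν) ^ p ∂ω
            ≤ ∫⁻ _ in Ioc (x k) (x (k + 1)), (∑ j ∈ Finset.range (k + 1), H j) ^ p ∂ω :=
              setLIntegral_mono' measurableSet_Ioc fun t ht =>
                ENNReal.rpow_le_rpow (hsum k t ht.2) hp.le
          _ ≤ _ := by
              rw [setLIntegral_const, hx.measure_block, mul_comm, hx.half k, two_mul]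
              gcongr
              exact le_self_add
    _ ≤ _ := by
        refine hc m H n fun k _ => ?_
        rw [hx.half k, ← mul_assoc, one_div, ENNReal.ofReal_inv_of_pos (by norm_num)]
        simp [ENNReal.inv_mul_cancel]

/-- Although y k lives on all of (x k, ∞), the functions behave as if they were confined to separate
blocks. On block j only k ≤ j contribute, with a loss ρ^(j-k); with ρ = 3/2 and p < 1 the weights
m_j ρ^{jp} still decrease by the factor 3/4, so the geometric Hardy inequality leaves the diagonal.
-/
theorem exists_lintegral_superposition_le {p r : ℝ} (hr : 0 < r) (hp : 0 < p) (hp1 : p < 1) :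
    ∃ c : ℝ≥0, ∀ (ν ω : Measure ℝ) (x : ℕ → ℝ) (m : ℕ → ℝ≥0∞), Dyadic ω x m →
      ν (Iic (x 0)) = 0 → ∀ (n : ℕ) (y : ℕ → ℝ → ℝ≥0∞), (∀ k, Measurable (y k)) →
      (∀ k s, s ≤ x k → y k s = 0) → (∀ k s, n ≤ k → y k s = 0) →
      ∫⁻ t, (∫⁻ s in Iio t, (∑ k ∈ Finset.range n, y k s ^ r) ^ (1 / r) ∂ν) ^ p ∂ω ≤
        c * ∑ k ∈ Finset.range n, m k * (∫⁻ s, y k s ∂ν) ^ p := by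
  obtain ⟨c₁, hc₁⟩ := exists_lintegral_le_iSup_sum hp
  obtain ⟨A, hA⟩ := exists_rpow_sum_le (α := 1 / r) (ρ := 3 / 2) (by positivity) (by norm_num)
  obtain ⟨c₂, hc₂⟩ := exists_geom_hardy (α := p) (σ := 3 / 4) hp (by norm_num) (by norm_num)
  refine ⟨c₁ * A ^ p * c₂, fun ν ω x m hx hν n y hym hyx hyn => ?_⟩
  have hmono := hx.strictMono.monotone
  refine (hc₁ ν ω x m hx hν _).trans (iSup_le fun N => ?_)
  set Y : ℕ → ℝ≥0∞ := fun k => ∫⁻ s, y k s ∂ν with hY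
  set ρ : ℝ≥0∞ := ENNReal.ofReal (3 / 2) with hρ
  have hρ0 : ρ ≠ 0 := by simp [hρ]
  have hρt : ρ ≠ ∞ := ENNReal.ofReal_ne_top
  have hblock : ∀ j, ∫⁻ s in Ioc (x j) (x (j + 1)),
      (∑ k ∈ Finset.range n, y k s ^ r) ^ (1 / r) ∂ν ≤
        A * (ρ ^ j * ∑ k ∈ Finset.range (j + 1), (ρ⁻¹) ^ k * Y k) := by
    intro j
    calc ∫⁻ s in Ioc (x j) (x (j + 1)), (∑ k ∈ Finset.range n, y k s ^ r) ^ (1 / r) ∂ν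
        ≤ ∫⁻ s in Ioc (x j) (x (j + 1)),
          A * ∑ k ∈ Finset.range (j + 1), ρ ^ (j - k) * y k s ∂ν := by
          refine setLIntegral_mono' measurableSet_Ioc fun s hs => ?_
          have h1 : ∑ k ∈ Finset.range n, y k s ^ r ≤ ∑ k ∈ Finset.range (j + 1), y k s ^ r := by
            refine Finset.sum_le_sum_of_ne_zero fun k _ hk => ?_
            rw [Finset.mem_range]
            by_contra! hkj
            apply hk
            rw [hyx k s (hs.2.trans (hmono hkj)), ENNReal.zero_rpow_of_pos hr]
          refine (ENNReal.rpow_le_rpow h1 (by positivity)).trans ((hA _ j).trans (le_of_eq ?_))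
          congr 1
          refine Finset.sum_congr rfl fun k _ => ?_
          rw [← ENNReal.rpow_mul, mul_one_div_cancel hr.ne', ENNReal.rpow_one]
      _ ≤ ∫⁻ s, A * ∑ k ∈ Finset.range (j + 1), ρ ^ (j - k) * y k s ∂ν :=
          setLIntegral_le_lintegral _ _
      _ = A * ∑ k ∈ Finset.range (j + 1), ρ ^ (j - k) * Y k := by
          rw [lintegral_const_mul' _ _ (by simp),
            lintegral_finsetSum _ fun k _ => (hym k).const_mul _]
          congr 1
          exact Finset.sum_congr rfl fun k _ => lintegral_const_mul _ (hym k)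
      _ = _ := by
          congr 1
          rw [Finset.mul_sum]
          refine Finset.sum_congr rfl fun k hk => ?_
          have hk := Finset.mem_range.1 hk
          obtain ⟨i, rfl⟩ : ∃ i, j = i + k := ⟨j - k, by omega⟩
          rw [Nat.add_sub_cancel, ← mul_assoc, pow_add, mul_assoc (ρ ^ i), ← mul_pow,
            ENNReal.mul_inv_cancel hρ0 hρt, one_pow, mul_one]
  have hw : ∀ j, m (j + 1) * (ρ ^ (j + 1)) ^ p ≤ ENNReal.ofReal (3 / 4) * (m j * (ρ ^ j) ^ p) := by
    intro j
    have h1 : ρ ^ p ≤ ρ := by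
      conv_rhs => rw [← ENNReal.rpow_one ρ]
      exact ENNReal.rpow_le_rpow_of_exponent_le (by rw [hρ]; norm_num) hp1.le
    have h2 : ENNReal.ofReal (3 / 4) * 2 = ρ := by
      rw [hρ, show (2 : ℝ≥0∞) = ENNReal.ofReal 2 by simp, ← ENNReal.ofReal_mul (by norm_num)]
      norm_num
    rw [pow_succ, ENNReal.mul_rpow_of_nonneg _ _ hp.le, hx.half j]
    calc m (j + 1) * ((ρ ^ j) ^ p * ρ ^ p) ≤ m (j + 1) * ((ρ ^ j) ^ p * ρ) := by gcongr
      _ = _ := by rw [← h2]; ring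
  calc (c₁ : ℝ≥0∞) * ∑ j ∈ Finset.range N, m j * (∫⁻ s in Ioc (x j) (x (j + 1)),
        (∑ k ∈ Finset.range n, y k s ^ r) ^ (1 / r) ∂ν) ^ p
      ≤ c₁ * ∑ j ∈ Finset.range N, A ^ p * ((m j * (ρ ^ j) ^ p) *
          (∑ k ∈ Finset.range (j + 1), (ρ⁻¹) ^ k * Y k) ^ p) := by
        refine mul_le_mul' le_rfl (Finset.sum_le_sum fun j _ => ?_)
        refine (mul_le_mul' le_rfl (ENNReal.rpow_le_rpow (hblock j) hp.le)).trans (le_of_eq ?_)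
        rw [ENNReal.mul_rpow_of_nonneg _ _ hp.le, ENNReal.mul_rpow_of_nonneg _ _ hp.le]
        ring
    _ ≤ c₁ * (A ^ p * (c₂ * ∑ j ∈ Finset.range N, (m j * (ρ ^ j) ^ p) *
          ((ρ⁻¹) ^ j * Y j) ^ p)) := by
        rw [← Finset.mul_sum]
        refine mul_le_mul' le_rfl (mul_le_mul' le_rfl ?_)
        exact hc₂ (fun j => m j * (ρ ^ j) ^ p) (fun k => (ρ⁻¹) ^ k * Y k) N fun k _ => hw k
    _ = c₁ * (A ^ p * (c₂ * ∑ j ∈ Finset.range N, m j * Y j ^ p)) := by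
        congr 3
        refine Finset.sum_congr rfl fun j _ => ?_
        rw [mul_assoc, ← ENNReal.mul_rpow_of_nonneg _ _ hp.le, ← mul_assoc (ρ ^ j), ← mul_pow,
          ENNReal.mul_inv_cancel hρ0 hρt, one_pow, one_mul]
    _ ≤ c₁ * (A ^ p * (c₂ * ∑ j ∈ Finset.range n, m j * Y j ^ p)) := by
        refine mul_le_mul' le_rfl (mul_le_mul' le_rfl (mul_le_mul' le_rfl ?_))
        refine Finset.sum_le_sum_of_ne_zero fun k _ hk => ?_
        rw [Finset.mem_range]
        by_contra! hkn
        apply hk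
        have : Y k = 0 := by simp [hY, hyn k _ hkn]
        rw [this, ENNReal.zero_rpow_of_pos hp, mul_zero]
    _ = _ := by
        push_cast [ENNReal.coe_rpow_of_nonneg _ hp.le]
        ring

/-- The test function is h = (Σ y_k^r)^{1/r} with y_k^r a multiple of the Hardy extremal for p = 1
on (x k, ∞). On the left the terms separate by superadditivity of the power q/r ≥ 1; on the right by
the superposition lemma. -/
theorem exists_blockSum_le_of_measureIneq {p q r : ℝ} (hr : 0 < r) (hrq : r ≤ q) (hqp : q < p)
    (hp1 : p < 1) :
    ∃ c : ℝ≥0, ∀ (μ ν ω : Measure ℝ) (x : ℕ → ℝ) (m : ℕ → ℝ≥0∞) (n : ℕ) [IsFiniteMeasure μ]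
      [NullSingletonClass μ] [IsFiniteMeasure ν], Dyadic ω x m → ν (Iic (x 0)) = 0 →
      ∀ C, MeasureIneq p q r μ ν ω C → blockSum p q r μ ν x m n ≤ c * C ^ (p / (p - q)) := by
  have hq : 0 < q := by linarith
  have hp : 0 < p := by linarith
  have hpq : 0 < p - q := by linarith
  have h1q : 0 < 1 - q := by linarith
  have h1p : 0 < 1 - p := by linarith
  have hQ : 0 ≤ q / r := by positivity
  obtain ⟨c₁, hc₁⟩ := exists_hardyFun_le_lintegral_hardyTest hr hrq (hqp.trans hp1)
  obtain ⟨c₂, hc₂⟩ := exists_lintegral_superposition_le hr hp hp1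
  refine ⟨(c₁ * (c₂ * (2 ^ (1 / (1 - q))) ^ p) ^ (q / p)) ^ (p / (p - q)),
    fun μ ν ω x m n _ _ _ hx hν C hC => ?_⟩
  set β : ℕ → ℝ≥0∞ := fun k => beta q r μ ν (x k) with hβ
  have hβt : ∀ k, β k ≠ ∞ := fun k => hardyFun_ne_top hr (by linarith) hq (by linarith) _ _
  set S := blockSum p q r μ ν x m n with hS
  -- The coefficient solves a^q β = m (aβ)^p, so that both sides of the tested inequality become the
  -- same sum S.
  set a : ℕ → ℝ≥0∞ := fun k => if k < n then (m k ^ (-1 : ℝ) * β k ^ (1 - p)) ^ (1 / (p - q)) else 0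
    with ha
  set g : ℕ → ℝ → ℝ≥0∞ := fun k =>
    (Ioi (x k)).indicator (hardyTest 1 q r μ (ν.restrict (Ioi (x k)))) with hg
  have hgm : ∀ k, Measurable (g k) := fun k =>
    (measurable_hardyTest _ _ _ _ _).indicator measurableSet_Ioi
  set y : ℕ → ℝ → ℝ≥0∞ := fun k s => a k * g k s ^ (1 / r) with hy
  have hym : ∀ k, Measurable (y k) := fun k => ((hgm k).pow_const _).const_mul _
  have hyr : ∀ k s, y k s ^ r = a k ^ r * g k s := by
    intro k s
    simp only [hy]
    rw [ENNReal.mul_rpow_of_nonneg _ _ hr.le, ← ENNReal.rpow_mul, one_div_mul_cancel hr.ne',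
      ENNReal.rpow_one]
  have hS1 : S = ∑ k ∈ Finset.range n, a k ^ q * β k := by
    rw [hS, blockSum]
    refine Finset.sum_congr rfl fun k hk => ?_
    simp only [ha, if_pos (Finset.mem_range.1 hk)]
    rw [← ENNReal.rpow_mul, ENNReal.mul_rpow_of_nonneg _ _ (by positivity), ← ENNReal.rpow_mul,
      ← ENNReal.rpow_mul, mul_assoc]
    have e1 : -1 * (1 / (p - q) * q) = -(q / (p - q)) := by ring
    have e2 : p * (1 - q) / (p - q) = (1 - p) * (1 / (p - q) * q) + 1 := by field_simp; ring
    rw [e1, e2, ENNReal.rpow_add_of_nonneg _ _ (by positivity) zero_le_one, ENNReal.rpow_one]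
  have hS2 : S = ∑ k ∈ Finset.range n, m k * (a k * β k) ^ p := by
    rw [hS, blockSum]
    refine Finset.sum_congr rfl fun k hk => ?_
    simp only [ha, if_pos (Finset.mem_range.1 hk)]
    rw [ENNReal.mul_rpow_of_nonneg _ _ hp.le, ← ENNReal.rpow_mul,
      ENNReal.mul_rpow_of_nonneg _ _ (by positivity), ← ENNReal.rpow_mul,
      ← ENNReal.rpow_mul, ← mul_assoc, ← mul_assoc, mul_assoc]
    have e1 : -1 * (1 / (p - q) * p) = -(p / (p - q)) := by ring
    have e2 : p * (1 - q) / (p - q) = (1 - p) * (1 / (p - q) * p) + p := by field_simp; ring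
    rw [e1, e2, ENNReal.rpow_add_of_nonneg _ _ (by positivity) hp.le, mul_comm (m k),
      hx.rpow_mul_self k (t := q / (p - q)) (by field_simp; ring)]
  have hSt : S ≠ ∞ := by
    rw [hS, blockSum]
    refine ENNReal.sum_ne_top.2 fun k _ => ENNReal.mul_ne_top ?_
      (ENNReal.rpow_ne_top_of_nonneg (by positivity) (hβt k))
    exact ENNReal.rpow_ne_top_of_ne_zero (hx.ne_zero k) (hx.ne_top k)
  set h : ℝ → ℝ≥0∞ := fun s => (∑ k ∈ Finset.range n, y k s ^ r) ^ (1 / r) with hh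
  have hhm : Measurable h :=
    (Finset.measurable_sum _ fun k _ => (hym k).pow_const _).pow_const _
  have hL : S ≤ c₁ * ∫⁻ t, (∫⁻ s in Iio t, h s ^ r ∂ν) ^ (q / r) ∂μ := by
    have hint : ∀ t, ∫⁻ s in Iio t, h s ^ r ∂ν = ∑ k ∈ Finset.range n,
        a k ^ r * ∫⁻ s in Iio t, hardyTest 1 q r μ (ν.restrict (Ioi (x k))) s
          ∂(ν.restrict (Ioi (x k))) := by
      intro t
      have : ∀ s, h s ^ r = ∑ k ∈ Finset.range n, a k ^ r * g k s := by
        intro s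
        simp only [hh]
        rw [← ENNReal.rpow_mul, one_div_mul_cancel hr.ne', ENNReal.rpow_one]
        exact Finset.sum_congr rfl fun k _ => hyr k s
      simp only [this]
      rw [lintegral_finsetSum _ fun k _ => (hgm k).const_mul _]
      refine Finset.sum_congr rfl fun k _ => ?_
      rw [lintegral_const_mul _ (hgm k), hg, lintegral_indicator measurableSet_Ioi,
        Measure.restrict_restrict measurableSet_Ioi, Measure.restrict_restrict measurableSet_Iio,
        inter_comm]
    rw [hS1, ← lintegral_const_mul' _ _ (by simp)]
    calc ∑ k ∈ Finset.range n, a k ^ q * β k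
        ≤ ∑ k ∈ Finset.range n, a k ^ q * (c₁ * ∫⁻ t, (∫⁻ s in Iio t,
            hardyTest 1 q r μ (ν.restrict (Ioi (x k))) s ∂(ν.restrict (Ioi (x k)))) ^ (q / r) ∂μ) :=
          Finset.sum_le_sum fun k _ => mul_le_mul' le_rfl (hc₁ _ _)
      _ = ∑ k ∈ Finset.range n, ∫⁻ t, c₁ * (a k ^ r * ∫⁻ s in Iio t,
            hardyTest 1 q r μ (ν.restrict (Ioi (x k))) s
              ∂(ν.restrict (Ioi (x k)))) ^ (q / r) ∂μ := by
          refine Finset.sum_congr rfl fun k _ => ?_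
          have hm : Measurable fun t => (∫⁻ s in Iio t, hardyTest 1 q r μ
              (ν.restrict (Ioi (x k))) s ∂(ν.restrict (Ioi (x k)))) ^ (q / r) :=
            (monotone_setLIntegral_Iio _ _).measurable.pow_const _
          rw [← mul_assoc, ← lintegral_const_mul _ hm]
          refine lintegral_congr fun t => ?_
          rw [ENNReal.mul_rpow_of_nonneg _ _ hQ, ← ENNReal.rpow_mul, mul_div_cancel₀ q hr.ne']
          ring
      _ = ∫⁻ t, ∑ k ∈ Finset.range n, c₁ * (a k ^ r * ∫⁻ s in Iio t,
            hardyTest 1 q r μ (ν.restrict (Ioi (x k))) s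
              ∂(ν.restrict (Ioi (x k)))) ^ (q / r) ∂μ := by
          rw [lintegral_finsetSum]
          intro k _
          exact ((((monotone_setLIntegral_Iio _ _).measurable).const_mul _).pow_const _).const_mul _
      _ ≤ _ := by
          refine lintegral_mono fun t => ?_
          rw [← Finset.mul_sum, hint]
          exact mul_le_mul' le_rfl (sum_rpow_le_rpow_sum _ _ ((one_le_div hr).2 hrq))
  have hY : ∀ k, ∫⁻ s, y k s ∂ν ≤ 2 ^ (1 / (1 - q)) * (a k * β k) := by
    intro k
    have h1 : ∀ s, g k s ^ (1 / r) = (Ioi (x k)).indicator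
        (fun s => hardyTest 1 q r μ (ν.restrict (Ioi (x k))) s ^ (1 / r)) s := by
      intro s
      simp only [hg]
      by_cases hs : s ∈ Ioi (x k)
      · simp only [indicator_of_mem hs]
      · simp only [indicator_of_notMem hs]
        exact ENNReal.zero_rpow_of_pos (by positivity)
    simp only [hy]
    rw [lintegral_const_mul _ ((hgm k).pow_const _)]
    simp only [h1]
    rw [lintegral_indicator measurableSet_Ioi, mul_left_comm]
    exact mul_le_mul' le_rfl (lintegral_hardyTest_rpow_le hr hrq (hqp.trans hp1) _ _)
  have hR : ∫⁻ t, (∫⁻ s in Iio t, h s ∂ν) ^ p ∂ω ≤ c₂ * (2 ^ (1 / (1 - q))) ^ p * S := by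
    refine (hc₂ ν ω x m hx hν n y hym (fun k s hs => ?_) fun k s hk => ?_).trans ?_
    · have hs' : s ∉ Ioi (x k) := not_lt.2 hs
      simp only [hy, hg]
      rw [indicator_of_notMem hs', ENNReal.zero_rpow_of_pos (by positivity), mul_zero]
    · simp [hy, ha, not_lt.2 hk]
    · rw [hS2, mul_assoc, Finset.mul_sum (a := ((2 : ℝ≥0∞) ^ (1 / (1 - q))) ^ p)]
      refine mul_le_mul' le_rfl (Finset.sum_le_sum fun k _ => ?_)
      refine (mul_le_mul' le_rfl (ENNReal.rpow_le_rpow (hY k) hp.le)).trans (le_of_eq ?_)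
      rw [ENNReal.mul_rpow_of_nonneg _ _ hp.le]
      ring
  have hfin : S ≤ (c₁ * C * (c₂ * (2 ^ (1 / (1 - q))) ^ p) ^ (q / p)) * S ^ (q / p) := by
    calc S ≤ c₁ * (C * (c₂ * (2 ^ (1 / (1 - q))) ^ p * S) ^ (q / p)) := by
          refine hL.trans (mul_le_mul' le_rfl ((hC h hhm).trans ?_))
          exact mul_le_mul' le_rfl (ENNReal.rpow_le_rpow hR (by positivity))
      _ = _ := by
          rw [ENNReal.mul_rpow_of_nonneg _ S (by positivity)]
          ring
  refine (le_rpow_of_le_mul_rpow ((div_lt_one hp).2 hqp) hSt hfin).trans (le_of_eq ?_)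
  have e : 1 / (1 - q / p) = p / (p - q) := by field_simp
  rw [e, mul_right_comm, ENNReal.mul_rpow_of_nonneg _ C (by positivity)]
  push_cast [ENNReal.coe_rpow_of_nonneg _ hp.le,
    ENNReal.coe_rpow_of_nonneg _ (by positivity : 0 ≤ 1 / (1 - q)),
    ENNReal.coe_rpow_of_nonneg _ (by positivity : 0 ≤ q / p),
    ENNReal.coe_rpow_of_nonneg _ (by positivity : 0 ≤ p / (p - q))]
  rfl

theorem exists_hardyFun_atomMeasure_le_of_measureIneq {p q r : ℝ} (hr : 0 < r) (hrq : r ≤ q)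
    (hqp : q < p) (hp1 : p < 1) :
    ∃ c : ℝ≥0, ∀ (μ ν ω : Measure ℝ) (x : ℕ → ℝ) (m : ℕ → ℝ≥0∞) (n : ℕ) [IsFiniteMeasure μ]
      [NullSingletonClass μ] [IsFiniteMeasure ν], Dyadic ω x m → μ (Iic (x 0)) = 0 →
      ν (Iic (x 0)) = 0 → μ (Ioi (x n)) = 0 → ∀ C, MeasureIneq p q r μ ν ω C →
      hardyFun p q r μ (atomMeasure p r ν x m n) ≤ c * C ^ (p / (p - q)) := by
  have hq : 0 < q := by linarith
  have hp : 0 < p := by linarith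
  have hpq : 0 < p - q := by linarith
  have hpr : 0 < p - r := by linarith
  have h1r : 0 < 1 - r := by linarith
  have h1p : 0 < 1 - p := by linarith
  have hQ : 0 ≤ q / r := by positivity
  obtain ⟨c₁, hc₁⟩ := exists_hardyFun_le_lintegral_hardyTest hr hrq hqp
  obtain ⟨c₂, hc₂⟩ := exists_lintegral_le_iSup_sum hp
  refine ⟨(c₁ * (c₂ * 2 ^ (p / (p - q))) ^ (q / p)) ^ (p / (p - q)),
    fun μ ν ω x m n _ _ _ hx hμ0 hν hμ C hC => ?_⟩
  have hmono := hx.strictMono.monotone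
  set η := atomMeasure p r ν x m n with hη
  set N : ℕ → ℝ≥0∞ := fun k => ν (Ioc (x k) (x (k + 1))) with hN
  have hNt : ∀ j, N j ≠ ∞ := fun j => measure_ne_top _ _
  set ε := r * (1 - p) / (p - r) with hε
  have hε0 : 0 ≤ ε := by positivity
  have hηfin : IsFiniteMeasure η := by
    refine ⟨?_⟩
    have := lintegral_atomMeasure p r ν x m n (measurable_const (a := (1 : ℝ≥0∞)))
    simp only [lintegral_const, one_mul, mul_one] at this
    rw [hη, this]
    refine ENNReal.sum_lt_top.2 fun j _ => (ENNReal.mul_ne_top ?_ ?_).lt_top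
    · exact ENNReal.rpow_ne_top_of_ne_zero (hx.ne_zero j) (hx.ne_top j)
    · exact ENNReal.rpow_ne_top_of_nonneg (by positivity) (hNt j)
  set S := hardyFun p q r μ η with hS
  have hSt : S ≠ ∞ := hardyFun_ne_top hr (by linarith) hq hqp _ _
  set g := hardyTest p q r μ η with hg
  have hgm : Measurable g := measurable_hardyTest _ _ _ _ _
  -- The step heights make the ν-integral of h^r over block j equal to the integral of the extremal
  -- g over atom j; the choice of ε also makes m_j (b_j N_j)^p equal to that atom's share of the
  -- integral of g^{p/r}.
  set b : ℕ → ℝ≥0∞ := fun j => if j < n then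
    (g (x (j + 1)) * (m j ^ (-(r / (p - r))) * N j ^ ε)) ^ (1 / r) else 0 with hb
  set h : ℝ → ℝ≥0∞ := fun s =>
    ∑ j ∈ Finset.range n, (Ioc (x j) (x (j + 1))).indicator (fun _ => b j) s with hh
  have hhm : Measurable h :=
    Finset.measurable_sum _ fun j _ => measurable_const.indicator measurableSet_Ioc
  have hhb : ∀ j, ∀ s ∈ Ioc (x j) (x (j + 1)), h s = b j := by
    intro j s hs
    have hz : ∀ i, i ≠ j → (Ioc (x i) (x (i + 1))).indicator (fun _ => b i) s = 0 := by
      intro i hij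
      refine indicator_of_notMem (fun hs' => ?_) _
      rcases lt_or_gt_of_ne hij with hlt | hlt
      · exact not_lt.2 (hs'.2.trans (hmono hlt)) hs.1
      · exact not_lt.2 (hs.2.trans (hmono hlt)) hs'.1
    by_cases hj : j < n
    · simp only [hh]
      rw [Finset.sum_eq_single_of_mem j (Finset.mem_range.2 hj) fun i _ hij => hz i hij,
        indicator_of_mem hs]
    · simp only [hh]
      rw [Finset.sum_eq_zero fun i hi => hz i (by have := Finset.mem_range.1 hi; omega)]
      simp [hb, hj]
  have hblock : ∀ j < n, ∫⁻ s in Ioc (x j) (x (j + 1)), h s ^ r ∂ν =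
      atomWeight p r ν x m j * g (x (j + 1)) := by
    intro j hj
    have h1 : ∫⁻ s in Ioc (x j) (x (j + 1)), h s ^ r ∂ν = b j ^ r * N j := by
      rw [← setLIntegral_const]
      exact setLIntegral_congr_fun measurableSet_Ioc fun s hs => congrArg (· ^ r) (hhb j s hs)
    rw [h1]
    simp only [hb, if_pos hj]
    rw [← ENNReal.rpow_mul, one_div_mul_cancel hr.ne', ENNReal.rpow_one, atomWeight]
    have e : p * (1 - r) / (p - r) = ε + 1 := by rw [hε]; field_simp; ring
    rw [e, ENNReal.rpow_add_of_nonneg _ _ hε0 zero_le_one, ENNReal.rpow_one]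
    ring
  have hL : S ≤ c₁ * ∫⁻ t, (∫⁻ s in Iio t, h s ^ r ∂ν) ^ (q / r) ∂μ := by
    refine (hc₁ μ η).trans (mul_le_mul' le_rfl (lintegral_mono_ae ?_))
    filter_upwards [ae_mem_Ioc hμ0 hμ] with t ht
    obtain ⟨k, hk, htk⟩ := exists_mem_block ht
    refine ENNReal.rpow_le_rpow ?_ hQ
    rw [setLIntegral_Iio_atomMeasure p r ν hx.strictMono m hk.le htk hgm]
    calc ∑ j ∈ Finset.range k, atomWeight p r ν x m j * g (x (j + 1))
        = ∑ j ∈ Finset.range k, ∫⁻ s in Ioc (x j) (x (j + 1)), h s ^ r ∂ν :=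
          Finset.sum_congr rfl fun j hj => (hblock j ((Finset.mem_range.1 hj).trans hk)).symm
      _ = ∫⁻ s in Ioc (x 0) (x k), h s ^ r ∂ν := (setLIntegral_Ioc_eq_sum ν hmono _ _).symm
      _ ≤ _ := lintegral_mono_set fun s hs => hs.2.trans_lt htk.1
  have hR : ∫⁻ t, (∫⁻ s in Iio t, h s ∂ν) ^ p ∂ω ≤ c₂ * 2 ^ (p / (p - q)) * S := by
    refine (hc₂ ν ω x m hx hν h).trans (iSup_le fun M => ?_)
    rw [mul_assoc]
    refine mul_le_mul' le_rfl (le_trans ?_ (lintegral_hardyTest_rpow_le hr hrq hqp μ η))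
    rw [lintegral_atomMeasure _ _ _ _ _ _ (hgm.pow_const _)]
    calc ∑ j ∈ Finset.range M, m j * (∫⁻ s in Ioc (x j) (x (j + 1)), h s ∂ν) ^ p
        = ∑ j ∈ Finset.range M, m j * (b j * N j) ^ p := by
          refine Finset.sum_congr rfl fun j _ => ?_
          rw [setLIntegral_congr_fun measurableSet_Ioc (hhb j), setLIntegral_const]
      _ ≤ ∑ j ∈ Finset.range n, m j * (b j * N j) ^ p := by
          refine Finset.sum_le_sum_of_ne_zero fun j _ hj => ?_
          rw [Finset.mem_range]
          by_contra! hjn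
          apply hj
          simp [hb, not_lt.2 hjn, hp]
      _ ≤ _ := by
          refine Finset.sum_le_sum fun j hj => le_of_eq ?_
          simp only [hb, if_pos (Finset.mem_range.1 hj)]
          rw [ENNReal.mul_rpow_of_nonneg _ _ hp.le, ← ENNReal.rpow_mul, one_div_mul_eq_div,
            ENNReal.mul_rpow_of_nonneg _ _ (by positivity),
            ENNReal.mul_rpow_of_nonneg _ _ (by positivity), ← ENNReal.rpow_mul,
            ← ENNReal.rpow_mul, atomWeight]
          have e1 : -(r / (p - r)) * (p / r) = -(p / (p - r)) := by field_simp
          have e2 : p * (1 - r) / (p - r) = ε * (p / r) + p := by rw [hε]; field_simp; ring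
          rw [e1, e2, ENNReal.rpow_add_of_nonneg _ _ (by positivity) hp.le,
            ← hx.rpow_mul_self j (s := p / (p - r)) (t := r / (p - r)) (by field_simp; ring)]
          ring
  have hfin : S ≤ (c₁ * C * (c₂ * 2 ^ (p / (p - q))) ^ (q / p)) * S ^ (q / p) := by
    calc S ≤ c₁ * (C * (c₂ * 2 ^ (p / (p - q)) * S) ^ (q / p)) := by
          refine hL.trans (mul_le_mul' le_rfl ((hC h hhm).trans ?_))
          exact mul_le_mul' le_rfl (ENNReal.rpow_le_rpow hR (by positivity))
      _ = _ := by
          rw [ENNReal.mul_rpow_of_nonneg _ S (by positivity)]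
          ring
  refine (le_rpow_of_le_mul_rpow ((div_lt_one hp).2 hqp) hSt hfin).trans (le_of_eq ?_)
  have e : 1 / (1 - q / p) = p / (p - q) := by field_simp
  rw [e, mul_right_comm, ENNReal.mul_rpow_of_nonneg _ C (by positivity)]
  push_cast [ENNReal.coe_rpow_of_nonneg _ (by positivity : 0 ≤ q / p),
    ENNReal.coe_rpow_of_nonneg _ (by positivity : 0 ≤ p / (p - q))]
  rfl

/-- The sum of the three quantities that together characterize the inequality. -/
noncomputable def energy (p q r a : ℝ) (μ ν ω : Measure ℝ) : ℝ≥0∞ :=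
  tailEnergy p q r μ ν ω + endEnergy p q r a μ ν ω + kernEnergy p q r μ ν ω

/-- The assumptions under which the blocks of a dyadic sequence can be used. -/
structure IsRegular (a : ℝ) (μ ν ω : Measure ℝ) : Prop where
  finite_left : IsFiniteMeasure μ
  atomless_left : NullSingletonClass μ
  finite_mid : IsFiniteMeasure ν
  finite_right : IsFiniteMeasure ω
  atomless_right : NullSingletonClass ω
  null_left : μ (Iic a) = 0
  null_mid : ν (Iic a) = 0
  null_right : ω (Iic a) = 0
  ne_zero : ω ≠ 0
  tail_pos : ∃ ε : ℝ≥0∞, 0 < ε ∧ μ {t | ω (Ioi t) < ε} = 0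

theorem IsRegular.exists_blocks {a : ℝ} {μ ν ω : Measure ℝ} (h : IsRegular a μ ν ω) :
    ∃ x m n, Dyadic ω x m ∧ x 0 = a ∧ 0 < n ∧ μ (Ioi (x n)) = 0 := by
  have := h.finite_right
  have := h.atomless_right
  obtain ⟨x, m, hx, hx0, -⟩ := exists_dyadic ω a h.null_right h.ne_zero
  obtain ⟨ε, hε, hμ⟩ := h.tail_pos
  obtain ⟨n, hn⟩ := hx.exists_lt hε
  -- The index n already works for μ; n + 1 ensures that there is at least one block, as
  -- `endEnergy_le` requires.
  refine ⟨x, m, n + 1, hx, hx0, n.succ_pos, measure_mono_null (fun t ht => ?_) hμ⟩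
  exact (hx.tail_le ((hx.strictMono.monotone n.le_succ).trans (le_of_lt ht))).trans_lt hn

theorem exists_energy_le_of_isRegular {p q r : ℝ} (hr : 0 < r) (hrq : r ≤ q) (hqp : q < p)
    (hp1 : p < 1) : ∃ c : ℝ≥0, ∀ (a : ℝ) (μ ν ω : Measure ℝ), IsRegular a μ ν ω →
      ∀ C, MeasureIneq p q r μ ν ω C → energy p q r a μ ν ω ≤ c * C ^ (p / (p - q)) := by
  have hq : 0 < q := by linarith
  have hpq : 0 < p - q := by linarith
  obtain ⟨c₁, hc₁⟩ := exists_blockSum_le_of_measureIneq hr hrq hqp hp1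
  obtain ⟨c₂, hc₂⟩ := exists_hardyFun_atomMeasure_le_of_measureIneq hr hrq hqp hp1
  obtain ⟨c₃, hc₃⟩ := exists_kernEnergy_le hr hrq hqp hp1
  refine ⟨2 ^ (q / (p - q)) * c₁ + c₁ + c₃ * (c₂ + c₁), fun a μ ν ω h C hC => ?_⟩
  have := h.finite_left
  have := h.atomless_left
  have := h.finite_mid
  obtain ⟨x, m, n, hx, rfl, hn, hμ⟩ := h.exists_blocks
  have h1 := hc₁ μ ν ω x m n hx h.null_mid C hC
  have h2 := hc₂ μ ν ω x m n hx h.null_left h.null_mid hμ C hC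
  have h3 := hc₃ μ ν ω x m n hx h.null_left hμ
  calc energy p q r (x 0) μ ν ω
      ≤ 2 ^ (q / (p - q)) * (c₁ * C ^ (p / (p - q))) + c₁ * C ^ (p / (p - q)) +
        c₃ * (c₂ * C ^ (p / (p - q)) + c₁ * C ^ (p / (p - q))) := by
        refine add_le_add (add_le_add ?_ ((endEnergy_le hx hn).trans h1))
          (h3.trans (mul_le_mul' le_rfl (add_le_add h2 h1)))
        exact (tailEnergy_le hr (by linarith) hq hqp hp1 hx hμ).trans (mul_le_mul' le_rfl h1)
    _ = _ := by
        push_cast [ENNReal.coe_rpow_of_nonneg _ (by positivity : 0 ≤ q / (p - q))]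
        ring

theorem exists_measureIneq_of_isRegular {p q r : ℝ} (hr : 0 < r) (hrq : r ≤ q) (hqp : q < p)
    (hp1 : p < 1) : ∃ c : ℝ≥0, ∀ (a : ℝ) (μ ν ω : Measure ℝ), IsRegular a μ ν ω →
      MeasureIneq p q r μ ν ω (c * energy p q r a μ ν ω ^ ((p - q) / p)) := by
  have hq : 0 < q := by linarith
  have hp : 0 < p := by linarith
  have hpq : 0 < p - q := by linarith
  obtain ⟨c₁, hc₁⟩ := exists_measureIneq_of_blocks hr hrq hqp hp1
  obtain ⟨c₂, hc₂⟩ := exists_hardyFun_atomMeasure_le hr hrq hqp hp1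
  refine ⟨c₁ * (2 ^ (p / (p - q)) + 1 + c₂) ^ ((p - q) / p), fun a μ ν ω h g hg => ?_⟩
  have := h.finite_left
  have := h.atomless_left
  have := h.finite_mid
  obtain ⟨x, m, n, hx, rfl, hn, hμ⟩ := h.exists_blocks
  refine (hc₁ μ ν ω x m n hx h.null_left h.null_mid hμ g hg).trans (mul_le_mul' ?_ le_rfl)
  push_cast [ENNReal.coe_rpow_of_nonneg _ (by positivity : 0 ≤ (p - q) / p),
    ENNReal.coe_rpow_of_nonneg _ (by positivity : 0 ≤ p / (p - q))]
  rw [mul_assoc, ← ENNReal.mul_rpow_of_nonneg _ _ (by positivity)]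
  refine mul_le_mul' le_rfl (ENNReal.rpow_le_rpow ?_ (by positivity))
  have h1 := blockSum_le (μ := μ) (ν := ν) (n := n) hr (by linarith) hq hqp hp1 hx
  have h2 := hc₂ μ ν ω x m n hx h.null_left hμ
  set T := tailEnergy p q r μ ν ω
  set E := endEnergy p q r (x 0) μ ν ω
  set K := kernEnergy p q r μ ν ω
  calc _ ≤ (2 ^ (p / (p - q)) * T + E) + c₂ * (K + E) := add_le_add h1 h2
    _ ≤ (2 ^ (p / (p - q)) * (T + E + K) + 1 * (T + E + K)) + c₂ * (T + E + K) := by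
        rw [one_mul]
        have hT : T ≤ T + E + K := le_self_add.trans le_self_add
        have hE : E ≤ T + E + K := le_add_self.trans le_self_add
        have hK : K + E ≤ T + E + K := by rw [add_comm K, add_assoc]; exact le_add_self
        exact add_le_add (add_le_add (mul_le_mul' le_rfl hT) hE) (mul_le_mul' le_rfl hK)
    _ = _ := by rw [energy]; ring

end CesaroEmbedding

/-! ### Truncation and monotone convergence. -/

namespace CesaroEmbedding

open Set

theorem iSup_mul_iSup_of_monotone {f g : ℕ → ℝ≥0∞} (hf : Monotone f) (hg : Monotone g) :
    ⨆ n, f n * g n = (⨆ n, f n) * ⨆ n, g n := by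
  refine le_antisymm (iSup_le fun n => mul_le_mul' (le_iSup f n) (le_iSup g n)) ?_
  rw [ENNReal.iSup_mul]
  refine iSup_le fun i => ?_
  rw [ENNReal.mul_iSup]
  exact iSup_le fun j => le_iSup_of_le (max i j)
    (mul_le_mul' (hf (le_max_left i j)) (hg (le_max_right i j)))

theorem iSup_rpow (f : ℕ → ℝ≥0∞) {s : ℝ} (hs : 0 < s) : ⨆ n, f n ^ s = (⨆ n, f n) ^ s :=
  ((ENNReal.orderIsoRpow s hs).map_iSup f).symm

/-- An increasing sequence of measurable sets exhausting a measure. -/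
structure Exhausts (μ : Measure ℝ) (P : ℕ → Set ℝ) : Prop where
  mono : Monotone P
  measurable : ∀ n, MeasurableSet (P n)
  null : μ (⋃ n, P n)ᶜ = 0

namespace Exhausts

variable {μ : Measure ℝ} {P : ℕ → Set ℝ}

/-- Monotone convergence with the domain and the integrand growing together. -/
theorem iSup_setLIntegral (h : Exhausts μ P) {f : ℕ → ℝ → ℝ≥0∞} (hf : ∀ n, Measurable (f n))
    (hm : ∀ t, Monotone fun n => f n t) :
    ⨆ n, ∫⁻ t in P n, f n t ∂μ = ∫⁻ t, ⨆ n, f n t ∂μ := by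
  simp only [← lintegral_indicator (h.measurable _)]
  rw [← lintegral_iSup fun n => (hf n).indicator (h.measurable n)]
  · refine lintegral_congr_ae ?_
    have hmem : ∀ᵐ t ∂μ, t ∈ ⋃ n, P n := h.null
    filter_upwards [hmem] with t ht
    obtain ⟨N, hN⟩ := mem_iUnion.1 ht
    refine le_antisymm (iSup_mono fun n => indicator_le_self _ _ _) (iSup_le fun n => ?_)
    refine le_iSup_of_le (max n N) ?_
    rw [indicator_of_mem (h.mono (le_max_right n N) hN)]
    exact hm t (le_max_left n N)
  · intro i j hij t
    beta_reduce
    by_cases ht : t ∈ P i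
    · rw [indicator_of_mem ht, indicator_of_mem (h.mono hij ht)]
      exact hm t hij
    · rw [indicator_of_notMem ht]
      exact zero_le

theorem iSup_restrict_apply (h : Exhausts μ P) {B : Set ℝ} (hB : MeasurableSet B) :
    ⨆ n, μ.restrict (P n) B = μ B := by
  have := h.iSup_setLIntegral (f := fun _ => B.indicator 1)
    (fun _ => measurable_one.indicator hB) fun _ => monotone_const
  simpa [lintegral_indicator_one hB, ciSup_const] using this

theorem restrict_mono (h : Exhausts μ P) (B : Set ℝ) : Monotone fun n => μ.restrict (P n) B :=
  fun _ _ hij => Measure.restrict_mono (h.mono hij) le_rfl B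

theorem restrict (h : Exhausts μ P) (A : Set ℝ) : Exhausts (μ.restrict A) P :=
  ⟨h.mono, h.measurable, Measure.absolutelyContinuous_of_le Measure.restrict_le_self h.null⟩

end Exhausts

section Truncation

variable {p q r : ℝ} {μ ν ω : Measure ℝ} {P Q : ℕ → Set ℝ} {A : ℕ → ℝ}

theorem monotone_beta_restrict (hr : 0 < r) (hr1 : r < 1) (hq : 0 < q) (hq1 : q < 1)
    (hP : Exhausts μ P) (hQ : Exhausts ν Q) (x : ℝ) :
    Monotone fun n => beta q r (μ.restrict (P n)) (ν.restrict (Q n)) x := by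
  intro i j hij
  have h1 : 0 < 1 - r := by linarith
  have h2 : 0 < 1 - q := by linarith
  simp only [beta_eq]
  refine lintegral_mono' (Measure.restrict_mono (hP.mono hij) le_rfl) fun t => ?_
  exact mul_le_mul' (ENNReal.rpow_le_rpow (hP.restrict_mono _ hij) (by positivity))
    (ENNReal.rpow_le_rpow (hQ.restrict_mono _ hij) (by positivity))

theorem iSup_beta_restrict (hr : 0 < r) (hr1 : r < 1) (hq : 0 < q) (hq1 : q < 1)
    (hP : Exhausts μ P) (hQ : Exhausts ν Q) (x : ℝ) :
    ⨆ n, beta q r (μ.restrict (P n)) (ν.restrict (Q n)) x = beta q r μ ν x := by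
  have h1 : 0 < 1 - r := by linarith
  have h2 : 0 < 1 - q := by linarith
  have hs : 0 < q / (1 - q) := by positivity
  have hs' : 0 < q * (1 - r) / (r * (1 - q)) := by positivity
  simp only [beta_eq]
  rw [hP.iSup_setLIntegral]
  · refine lintegral_congr fun t => ?_
    rw [iSup_mul_iSup_of_monotone, iSup_rpow _ hs, iSup_rpow _ hs',
      hP.iSup_restrict_apply measurableSet_Ioi, hQ.iSup_restrict_apply measurableSet_Ioo]
    · exact fun i j hij => ENNReal.rpow_le_rpow (hP.restrict_mono _ hij) hs.le
    · exact fun i j hij => ENNReal.rpow_le_rpow (hQ.restrict_mono _ hij) hs'.le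
  · intro n
    refine (measurable_measure_Ioi_rpow _ _).mul (Measurable.pow_const ?_ _)
    exact Monotone.measurable fun s t hst => measure_mono (Ioo_subset_Ioo_right hst)
  · exact fun t i j hij => mul_le_mul' (ENNReal.rpow_le_rpow (hP.restrict_mono _ hij) hs.le)
      (ENNReal.rpow_le_rpow (hQ.restrict_mono _ hij) hs'.le)

/-- The reason for truncating ω only from the left: its tails enter with negative exponents, and
they stay the same, so the energies still increase with the truncation. -/
theorem restrict_Ioi_apply_Ioi (ω : Measure ℝ) {a s : ℝ} (h : a ≤ s) :
    ω.restrict (Ioi a) (Ioi s) = ω (Ioi s) := by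
  rw [Measure.restrict_apply measurableSet_Ioi, Ioi_inter_Ioi, sup_eq_left.2 h]

theorem kern_restrict (t a : ℝ) (p r : ℝ) (ν ω : Measure ℝ) : kern p r ν (ω.restrict (Ioi a)) t =
    ∫⁻ s in Ioi a, ω (Ioi s) ^ (-(p / (p - r))) * ν (Ioo s t) ^ (p * (1 - r) / (p - r))
      ∂(ω.restrict (Iio t)) := by
  rw [kern, Measure.restrict_restrict measurableSet_Iio, Measure.restrict_restrict measurableSet_Ioi,
    inter_comm]
  refine setLIntegral_congr_fun (measurableSet_Ioi.inter measurableSet_Iio) fun s hs => ?_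
  rw [restrict_Ioi_apply_Ioi ω (le_of_lt hs.1)]

theorem monotone_kern_restrict (hr : 0 < r) (hrp : r < p) (hr1 : r < 1)
    (hQ : Exhausts ν Q) (hA : Exhausts ω fun n => Ioi (A n)) (t : ℝ) :
    Monotone fun n => kern p r (ν.restrict (Q n)) (ω.restrict (Ioi (A n))) t := by
  intro i j hij
  have h1 : 0 < 1 - r := by linarith
  have h2 : 0 < p - r := by linarith
  have hp : 0 < p := by linarith
  simp only [kern_restrict]
  refine lintegral_mono' (Measure.restrict_mono (hA.mono hij) le_rfl) fun s => ?_
  exact mul_le_mul' le_rfl (ENNReal.rpow_le_rpow (hQ.restrict_mono _ hij) (by positivity))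

theorem iSup_kern_restrict (hr : 0 < r) (hrp : r < p) (hr1 : r < 1)
    (hQ : Exhausts ν Q) (hA : Exhausts ω fun n => Ioi (A n)) (t : ℝ) :
    ⨆ n, kern p r (ν.restrict (Q n)) (ω.restrict (Ioi (A n))) t = kern p r ν ω t := by
  have h1 : 0 < 1 - r := by linarith
  have h2 : 0 < p - r := by linarith
  have hp : 0 < p := by linarith
  have hα : 0 < p * (1 - r) / (p - r) := by positivity
  simp only [kern_restrict]
  rw [(hA.restrict (Iio t)).iSup_setLIntegral, kern]
  · refine lintegral_congr fun s => ?_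
    rw [← ENNReal.mul_iSup, iSup_rpow _ hα, hQ.iSup_restrict_apply measurableSet_Ioo]
  · intro n
    refine (measurable_measure_Ioi_rpow _ _).mul (Measurable.pow_const ?_ _)
    exact Antitone.measurable fun s s' hst => measure_mono (Ioo_subset_Ioo_left hst)
  · exact fun s i j hij => mul_le_mul' le_rfl
      (ENNReal.rpow_le_rpow (hQ.restrict_mono _ hij) hα.le)

theorem iSup_tailEnergy_restrict (hr : 0 < r) (hr1 : r < 1) (hq : 0 < q) (hqp : q < p)
    (hp1 : p < 1) (hP : Exhausts μ P) (hQ : Exhausts ν Q) (hA : Exhausts ω fun n => Ioi (A n)) :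
    ⨆ n, tailEnergy p q r (μ.restrict (P n)) (ν.restrict (Q n)) (ω.restrict (Ioi (A n))) =
      tailEnergy p q r μ ν ω := by
  have h1 : 0 < 1 - q := by linarith
  have h2 : 0 < p - q := by linarith
  have hp : 0 < p := by linarith
  have he : 0 < p * (1 - q) / (p - q) := by positivity
  have hq1 : q < 1 := by linarith
  have hn : ∀ n, tailEnergy p q r (μ.restrict (P n)) (ν.restrict (Q n)) (ω.restrict (Ioi (A n))) =
      ∫⁻ x in Ioi (A n), ω (Ioi x) ^ (-(p / (p - q))) *
        beta q r (μ.restrict (P n)) (ν.restrict (Q n)) x ^ (p * (1 - q) / (p - q)) ∂ω := fun n =>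
    setLIntegral_congr_fun measurableSet_Ioi fun x hx => by
      rw [restrict_Ioi_apply_Ioi ω (le_of_lt hx)]
  simp only [hn]
  rw [hA.iSup_setLIntegral, tailEnergy]
  · refine lintegral_congr fun x => ?_
    rw [← ENNReal.mul_iSup, iSup_rpow _ he, iSup_beta_restrict hr hr1 hq hq1 hP hQ]
  · exact fun n => (measurable_measure_Ioi_rpow _ _).mul
      ((antitone_beta hq.le hq1.le hr.le hr1.le _ _).measurable.pow_const _)
  · exact fun x i j hij => mul_le_mul' le_rfl
      (ENNReal.rpow_le_rpow (monotone_beta_restrict hr hr1 hq hq1 hP hQ x hij) he.le)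

theorem iSup_kernEnergy_restrict (hr : 0 < r) (hrq : r ≤ q) (hqp : q < p)
    (hp1 : p < 1) (hP : Exhausts μ P) (hQ : Exhausts ν Q) (hA : Exhausts ω fun n => Ioi (A n)) :
    ⨆ n, kernEnergy p q r (μ.restrict (P n)) (ν.restrict (Q n)) (ω.restrict (Ioi (A n))) =
      kernEnergy p q r μ ν ω := by
  have hq : 0 < q := by linarith
  have h1 : 0 < p - r := by linarith
  have h2 : 0 < p - q := by linarith
  have hp : 0 < p := by linarith
  have hs : 0 < q / (p - q) := by positivity
  have hγ : 0 < q * (p - r) / (r * (p - q)) := by positivity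
  have hk := fun t => monotone_kern_restrict hr (by linarith : r < p) (by linarith) hQ hA t
  simp only [kernEnergy]
  rw [hP.iSup_setLIntegral]
  · refine lintegral_congr fun t => ?_
    rw [iSup_mul_iSup_of_monotone, iSup_rpow _ hs, iSup_rpow _ hγ,
      hP.iSup_restrict_apply measurableSet_Ioi,
      iSup_kern_restrict hr (by linarith) (by linarith) hQ hA]
    · exact fun i j hij => ENNReal.rpow_le_rpow (hP.restrict_mono _ hij) hs.le
    · exact fun i j hij => ENNReal.rpow_le_rpow (hk t hij) hγ.le
  · exact fun n => (measurable_measure_Ioi_rpow _ _).mul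
      ((monotone_kern hp.le (by linarith) (by linarith) _ _).measurable.pow_const _)
  · exact fun t i j hij => mul_le_mul' (ENNReal.rpow_le_rpow (hP.restrict_mono _ hij) hs.le)
      (ENNReal.rpow_le_rpow (hk t hij) hγ.le)

/-- Testing with `D.indicator g` truncates ν. As D lies to the right of a, the inner integral on the
right vanishes for t ≤ a, so truncating ω changes nothing. -/
theorem MeasureIneq.restrict (hr : 0 < r) (hp : 0 < p) {C : ℝ≥0∞} (h : MeasureIneq p q r μ ν ω C)
    (B : Set ℝ) {D : Set ℝ} {a : ℝ} (hD : MeasurableSet D) (hDa : D ⊆ Ioi a) :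
    MeasureIneq p q r (μ.restrict B) (ν.restrict D) (ω.restrict (Ioi a)) C := by
  intro g hg
  have hin : ∀ (t : ℝ) (f : ℝ → ℝ≥0∞), ∫⁻ s in Iio t, D.indicator f s ∂ν =
      ∫⁻ s in Iio t, f s ∂(ν.restrict D) := by
    intro t f
    rw [lintegral_indicator hD, Measure.restrict_restrict hD,
      Measure.restrict_restrict measurableSet_Iio, inter_comm]
  have hpow : ∀ s, D.indicator g s ^ r = D.indicator (fun s => g s ^ r) s := by
    intro s
    by_cases hs : s ∈ D
    · simp only [indicator_of_mem hs]
    · simp only [indicator_of_notMem hs, ENNReal.zero_rpow_of_pos hr]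
  have key := h (D.indicator g) (hg.indicator hD)
  simp only [hpow, hin] at key
  have hω : ∫⁻ t, (∫⁻ s in Iio t, g s ∂(ν.restrict D)) ^ p ∂ω =
      ∫⁻ t in Ioi a, (∫⁻ s in Iio t, g s ∂(ν.restrict D)) ^ p ∂ω := by
    rw [← lintegral_indicator measurableSet_Ioi]
    refine lintegral_congr fun t => ?_
    by_cases ht : t ∈ Ioi a
    · rw [indicator_of_mem ht]
    · have hempty : Iio t ∩ D = ∅ := by
        ext s
        simp only [mem_inter_iff, mem_Iio, mem_empty_iff_false, iff_false, not_and]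
        exact fun hs hsD => ht ((mem_Ioi.1 (hDa hsD)).trans hs)
      rw [indicator_of_notMem ht, Measure.restrict_restrict measurableSet_Iio, hempty]
      simp [hp]
  rw [hω] at key
  exact (setLIntegral_le_lintegral _ _).trans key

/-- The left side is the supremum of its truncations, while the right side only decreases under
truncation. -/
theorem measureIneq_of_restrict (hr : 0 < r) (hq : 0 < q) (hp : 0 < p) {C : ℝ≥0∞}
    (hP : Exhausts μ P) (hQ : Exhausts ν Q)
    (h : ∀ n, MeasureIneq p q r (μ.restrict (P n)) (ν.restrict (Q n)) (ω.restrict (Ioi (A n))) C) :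
    MeasureIneq p q r μ ν ω C := by
  intro g hg
  have hQr : 0 < q / r := by positivity
  have hrew : ∀ n t, ∫⁻ s in Iio t, g s ^ r ∂(ν.restrict (Q n)) =
      ∫⁻ s in Q n, g s ^ r ∂(ν.restrict (Iio t)) := by
    intro n t
    rw [Measure.restrict_restrict measurableSet_Iio, Measure.restrict_restrict (hQ.measurable n),
      inter_comm]
  have hmono : ∀ t, Monotone fun n => ∫⁻ s in Iio t, g s ^ r ∂(ν.restrict (Q n)) := by
    intro t i j hij
    refine lintegral_mono' (Measure.restrict_mono le_rfl ?_) fun _ => le_rfl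
    exact Measure.restrict_mono (hQ.mono hij) le_rfl
  have hsup : ∫⁻ t, (∫⁻ s in Iio t, g s ^ r ∂ν) ^ (q / r) ∂μ =
      ⨆ n, ∫⁻ t in P n, (∫⁻ s in Iio t, g s ^ r ∂(ν.restrict (Q n))) ^ (q / r) ∂μ := by
    rw [hP.iSup_setLIntegral]
    · refine lintegral_congr fun t => ?_
      rw [iSup_rpow _ hQr]
      simp only [hrew]
      rw [(hQ.restrict (Iio t)).iSup_setLIntegral (fun _ => hg.pow_const r)
        fun _ => monotone_const]
      simp [ciSup_const]
    · exact fun n => (monotone_setLIntegral_Iio _ _).measurable.pow_const _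
    · exact fun t i j hij => ENNReal.rpow_le_rpow (hmono t hij) hQr.le
  rw [hsup]
  refine iSup_le fun n => (h n g hg).trans (mul_le_mul' le_rfl ?_)
  refine ENNReal.rpow_le_rpow ?_ (by positivity)
  refine lintegral_mono' Measure.restrict_le_self fun t => ENNReal.rpow_le_rpow ?_ hp.le
  exact lintegral_mono' (Measure.restrict_mono le_rfl Measure.restrict_le_self) fun _ => le_rfl

end Truncation

end CesaroEmbedding

/-! ### Passage from regular to admissible measures. -/

namespace CesaroEmbedding

open Set

/-- The properties of the measures given by weights on an interval with left end point `a`. -/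
structure IsAdmissible (a : ℝ) (μ ν ω : Measure ℝ) : Prop where
  sigmaFinite_left : SigmaFinite μ
  atomless_left : NullSingletonClass μ
  sigmaFinite_mid : SigmaFinite ν
  atomless_right : NullSingletonClass ω
  null_left : μ (Iic a) = 0
  null_mid : ν (Iic a) = 0
  null_right : ω (Iic a) = 0
  ne_zero : ω ≠ 0
  tail_ne_top : ∀ x, a < x → ω (Ioi x) ≠ ∞
  tail_pos : ∀ᵐ t ∂μ, 0 < ω (Ioi t)

variable {p q r a : ℝ} {μ ν ω : Measure ℝ}

theorem exhausts_Ioi_seq {A : ℕ → ℝ} (hA : Antitone A) (hω : ω (Iic a) = 0)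
    (hlim : ∀ t, a < t → ∃ n, A n < t) : Exhausts ω fun n => Ioi (A n) := by
  refine ⟨fun i j hij => Ioi_subset_Ioi (hA hij), fun n => measurableSet_Ioi, ?_⟩
  refine measure_mono_null (fun t ht => ?_) hω
  by_contra hta
  obtain ⟨n, hn⟩ := hlim t (not_le.1 hta)
  exact ht (mem_iUnion.2 ⟨n, hn⟩)

theorem exists_lt_measure_Ioi (hω : ω (Iic a) = 0) {y : ℝ≥0∞} (hy : y < ω univ) :
    ∃ z, a < z ∧ y < ω (Ioi z) := by
  have hA : Antitone fun n : ℕ => a + 1 / ((n : ℝ) + 1) := fun i j hij => by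
    have : (i : ℝ) ≤ j := Nat.cast_le.2 hij
    have hi : (0 : ℝ) ≤ i := Nat.cast_nonneg i
    beta_reduce
    gcongr
  have hex := exhausts_Ioi_seq (ω := ω) hA hω fun t ht => by
    obtain ⟨n, hn⟩ := exists_nat_one_div_lt (sub_pos.2 ht)
    exact ⟨n, by linarith⟩
  have := hex.iSup_restrict_apply MeasurableSet.univ
  simp only [Measure.restrict_apply_univ] at this
  rw [← this] at hy
  obtain ⟨n, hn⟩ := lt_iSup_iff.1 hy
  exact ⟨_, lt_add_of_pos_right a (by positivity), hn⟩

namespace IsAdmissible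

theorem measure_Ioi (h : IsAdmissible a μ ν ω) : ω (Ioi a) = ω univ := by
  rw [← Iic_union_Ioi (a := a), measure_union _ measurableSet_Ioi, h.null_right, zero_add]
  exact Set.disjoint_left.2 fun t ht ht' => not_lt.2 (mem_Iic.1 ht) (mem_Ioi.1 ht')

/-- Truncation points converging to the left end point. -/
theorem exists_seq (h : IsAdmissible a μ ν ω) : ∃ A : ℕ → ℝ, Antitone A ∧
    (∀ t, a < t → ∃ n, A n < t) ∧ (∀ n, a ≤ A n) ∧ (∀ n, ω (Ioi (A n)) ≠ 0) ∧
    (∀ n, ω (Ioi (A n)) ≠ ∞) ∧ (ω (Ioi a) = ∞ ∨ ∀ n, A n = a) := by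
  have hpos : 0 < ω univ := by simpa [pos_iff_ne_zero] using h.ne_zero
  -- If ω is infinite near a, the cut points decrease to a from a point that still has positive
  -- tail. Otherwise no cut is made, which preserves the end term.
  by_cases htop : ω (Ioi a) = ∞
  · obtain ⟨z, haz, hz⟩ := exists_lt_measure_Ioi h.null_right hpos
    have hd : 0 < z - a := sub_pos.2 haz
    have hgt : ∀ n : ℕ, a < a + (z - a) * (1 / ((n : ℝ) + 1)) := fun n =>
      lt_add_of_pos_right a (by positivity)
    refine ⟨fun n => a + (z - a) * (1 / ((n : ℝ) + 1)), fun i j hij => ?_, fun t ht => ?_,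
      fun n => (hgt n).le, fun n => ?_, fun n => h.tail_ne_top _ (hgt n), Or.inl htop⟩
    · have : (i : ℝ) ≤ j := Nat.cast_le.2 hij
      have hi : (0 : ℝ) ≤ i := Nat.cast_nonneg i
      beta_reduce
      gcongr
    · obtain ⟨n, hn⟩ := exists_nat_one_div_lt (div_pos (sub_pos.2 ht) hd)
      rw [lt_div_iff₀ hd] at hn
      exact ⟨n, by linarith⟩
    · refine (hz.trans_le (antitone_measure_Ioi ω ?_)).ne'
      have : 1 / ((n : ℝ) + 1) ≤ 1 := by
        rw [div_le_one (by positivity)]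
        have := Nat.cast_nonneg (α := ℝ) n
        linarith
      nlinarith
  · exact ⟨fun _ => a, antitone_const, fun t ht => ⟨0, ht⟩, fun _ => le_rfl,
      fun _ => by rw [h.measure_Ioi]; exact hpos.ne', fun _ => htop, Or.inr fun _ => rfl⟩

/-- Besides the cut at A n and the spanning sets, μ is confined to where the tail of ω is at least
1/(n+1); then finitely many dyadic blocks cover it. -/
theorem exists_truncation (h : IsAdmissible a μ ν ω) :
    ∃ (A : ℕ → ℝ) (P Q : ℕ → Set ℝ), Exhausts μ P ∧ Exhausts ν Q ∧
      (Exhausts ω fun n => Ioi (A n)) ∧ (∀ n, Q n ⊆ Ioi (A n)) ∧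
      (∀ n, a ≤ A n) ∧ (ω (Ioi a) = ∞ ∨ ∀ n, A n = a) ∧
      ∀ n, IsRegular (A n) (μ.restrict (P n)) (ν.restrict (Q n)) (ω.restrict (Ioi (A n))) := by
  obtain ⟨A, hAm, hAlim, hAa, hA0, hAt, hAor⟩ := h.exists_seq
  have := h.sigmaFinite_left
  have := h.sigmaFinite_mid
  have := h.atomless_left
  have := h.atomless_right
  have hAμ := exhausts_Ioi_seq hAm h.null_left hAlim
  have hAν := exhausts_Ioi_seq hAm h.null_mid hAlim
  have hAω := exhausts_Ioi_seq hAm h.null_right hAlim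
  set L : ℕ → Set ℝ := fun n => {t | ((n : ℝ≥0∞) + 1)⁻¹ ≤ ω (Ioi t)} with hL
  have hLm : ∀ n, MeasurableSet (L n) := fun n =>
    measurableSet_le measurable_const (antitone_measure_Ioi ω).measurable
  have hLmono : Monotone L := fun i j hij t ht => le_trans
    (ENNReal.inv_le_inv.2 (add_le_add (Nat.cast_le.2 hij) le_rfl)) ht
  refine ⟨A, fun n => spanningSets μ n ∩ (Ioi (A n) ∩ L n), fun n => spanningSets ν n ∩ Ioi (A n),
    ⟨?_, ?_, ?_⟩, ⟨?_, ?_, ?_⟩, hAω, fun n => inter_subset_right, hAa, hAor, fun n => ?_⟩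
  · exact fun i j hij => inter_subset_inter (monotone_spanningSets μ hij)
      (inter_subset_inter (hAμ.mono hij) (hLmono hij))
  · exact fun n => (measurableSet_spanningSets μ n).inter (measurableSet_Ioi.inter (hLm n))
  · have h1 : ∀ᵐ t ∂μ, t ∈ ⋃ n, Ioi (A n) := hAμ.null
    have h2 : ∀ᵐ t ∂μ, t ∈ ⋃ n, spanningSets μ n ∩ (Ioi (A n) ∩ L n) := by
      filter_upwards [h1, h.tail_pos] with t ht1 ht2
      obtain ⟨i, hi⟩ := mem_iUnion.1 ht1
      obtain ⟨j, hj⟩ := ENNReal.exists_inv_nat_lt ht2.ne'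
      obtain ⟨k, hk⟩ := mem_iUnion.1 ((iUnion_spanningSets μ).symm ▸ mem_univ t :
        t ∈ ⋃ n, spanningSets μ n)
      set N := max i (max j k)
      have hiN : i ≤ N := le_max_left _ _
      have hjN : j ≤ N := (le_max_left _ _).trans (le_max_right _ _)
      have hkN : k ≤ N := (le_max_right _ _).trans (le_max_right _ _)
      refine mem_iUnion.2 ⟨N, monotone_spanningSets μ hkN hk, hAμ.mono hiN hi, ?_⟩
      refine le_trans (ENNReal.inv_le_inv.2 ?_) hj.le
      exact (Nat.cast_le.2 hjN).trans le_self_add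
    exact h2
  · exact fun i j hij => inter_subset_inter (monotone_spanningSets ν hij) (hAν.mono hij)
  · exact fun n => (measurableSet_spanningSets ν n).inter measurableSet_Ioi
  · have h1 : ∀ᵐ t ∂ν, t ∈ ⋃ n, Ioi (A n) := hAν.null
    have h2 : ∀ᵐ t ∂ν, t ∈ ⋃ n, spanningSets ν n ∩ Ioi (A n) := by
      filter_upwards [h1] with t ht1
      obtain ⟨i, hi⟩ := mem_iUnion.1 ht1
      obtain ⟨k, hk⟩ := mem_iUnion.1 ((iUnion_spanningSets ν).symm ▸ mem_univ t :
        t ∈ ⋃ n, spanningSets ν n)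
      exact mem_iUnion.2 ⟨max i k, monotone_spanningSets ν (le_max_right _ _) hk,
        hAν.mono (le_max_left _ _) hi⟩
    exact h2
  · have hdisj : ∀ B : Set ℝ, B ⊆ Ioi (A n) → Iic (A n) ∩ B = ∅ := fun B hB =>
      Set.disjoint_iff_inter_eq_empty.1
        (Set.disjoint_left.2 fun t ht ht' => not_lt.2 (mem_Iic.1 ht) (mem_Ioi.1 (hB ht')))
    refine ⟨⟨?_⟩, inferInstance, ⟨?_⟩, ⟨?_⟩, inferInstance, ?_, ?_, ?_, ?_,
      ((n : ℝ≥0∞) + 1)⁻¹, ?_, ?_⟩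
    · rw [Measure.restrict_apply_univ]
      exact (measure_mono inter_subset_left).trans_lt (measure_spanningSets_lt_top μ n)
    · rw [Measure.restrict_apply_univ]
      exact (measure_mono inter_subset_left).trans_lt (measure_spanningSets_lt_top ν n)
    · rw [Measure.restrict_apply_univ]
      exact (hAt n).lt_top
    · rw [Measure.restrict_apply measurableSet_Iic,
        hdisj _ (inter_subset_right.trans inter_subset_left), measure_empty]
    · rw [Measure.restrict_apply measurableSet_Iic, hdisj _ inter_subset_right, measure_empty]
    · rw [Measure.restrict_apply measurableSet_Iic, hdisj _ subset_rfl, measure_empty]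
    · rw [Ne, Measure.restrict_eq_zero]
      exact hA0 n
    · simp
    · rw [Measure.restrict_apply (measurableSet_lt (antitone_measure_Ioi _).measurable
        measurable_const)]
      refine measure_mono_null (fun t ht => ?_) (measure_empty (μ := μ))
      obtain ⟨ht1, -, ht2, ht3⟩ := ht
      simp only [mem_ofPred_eq, restrict_Ioi_apply_Ioi ω (le_of_lt ht2)] at ht1
      exact absurd ht1 (not_lt.2 ht3)

/-- When ω is infinite the end term at a is zero, but each truncation has one at its cut point.
Infinite mass leaves room to the left of z for a block (x, z] of the same mass as the tail at z, and
there the integrand of `tailEnergy` is large enough. -/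
theorem rpow_mul_le_tailEnergy (h : IsAdmissible a μ ν ω) (hr : 0 < r) (hr1 : r < 1) (hq : 0 < q)
    (hqp : q < p) (hp1 : p < 1) (htop : ω (Ioi a) = ∞) {z : ℝ} (hz0 : ω (Ioi z) ≠ 0)
    (hzt : ω (Ioi z) ≠ ∞) :
    ω (Ioi z) ^ (-(q / (p - q))) * beta q r μ ν z ^ (p * (1 - q) / (p - q)) ≤
      2 ^ (p / (p - q)) * tailEnergy p q r μ ν ω := by
  have h1q : 0 < 1 - q := by linarith
  have hpq : 0 < p - q := by linarith
  have hp : 0 < p := by linarith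
  have hκ : 0 ≤ p / (p - q) := by positivity
  have hst : q / (p - q) = p / (p - q) - 1 := by field_simp; ring
  have := h.atomless_right
  set y := ω (Ioi z) with hy
  have h2y : 2 * y ≠ ∞ := ENNReal.mul_ne_top (by simp) hzt
  -- The auxiliary cut at z₀ makes the measure finite, as `exists_measure_Ioi_eq` requires, while
  -- keeping a tail larger than 2y.
  obtain ⟨z₀, haz, hz₀⟩ := exists_lt_measure_Ioi h.null_right (y := 2 * y)
    (by rw [← h.measure_Ioi, htop]; exact h2y.lt_top)
  have hfin : IsFiniteMeasure (ω.restrict (Ioi z₀)) :=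
    ⟨by rw [Measure.restrict_apply_univ]; exact (h.tail_ne_top _ haz).lt_top⟩
  obtain ⟨x, hx, hxy⟩ := exists_measure_Ioi_eq (ω.restrict (Ioi z₀)) z₀ (y := 2 * y)
    (pos_iff_ne_zero.2 (mul_ne_zero two_ne_zero hz0))
    (by rw [restrict_Ioi_apply_Ioi ω le_rfl]; exact hz₀.le)
  rw [restrict_Ioi_apply_Ioi ω hx] at hxy
  have hxz : x ≤ z := by
    by_contra! hlt
    have := antitone_measure_Ioi ω hlt.le
    simp only [hxy, ← hy] at this
    rw [two_mul] at this
    exact not_lt.2 this (ENNReal.lt_add_right hzt hz0)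
  have hb : ω (Ioc x z) = y := by
    have h1 : ω (Ioi x) = ω (Ioc x z) + ω (Ioi z) := by
      rw [← Ioc_union_Ioi_eq_Ioi hxz, measure_union _ measurableSet_Ioi]
      exact Set.disjoint_left.2 fun t ht ht' => not_lt.2 ht.2 ht'
    rw [hxy, ← hy, two_mul] at h1
    exact ((ENNReal.add_left_inj hzt).1 h1).symm
  calc y ^ (-(q / (p - q))) * beta q r μ ν z ^ (p * (1 - q) / (p - q))
      = 2 ^ (p / (p - q)) * ∫⁻ _ in Ioc x z, (2 * y) ^ (-(p / (p - q))) *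
          beta q r μ ν z ^ (p * (1 - q) / (p - q)) ∂ω := by
        rw [setLIntegral_const, hb, ENNReal.mul_rpow_of_ne_zero two_ne_zero hz0]
        have e1 : (2 : ℝ≥0∞) ^ (p / (p - q)) * 2 ^ (-(p / (p - q))) = 1 := by
          rw [← ENNReal.rpow_add _ _ two_ne_zero (by simp)]; simp
        have e2 : y ^ (-(q / (p - q))) = y ^ (-(p / (p - q))) * y := by
          rw [hst, show -(p / (p - q) - 1) = -(p / (p - q)) + 1 by ring,
            ENNReal.rpow_add _ _ hz0 hzt, ENNReal.rpow_one]
        rw [e2]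
        calc _ = ((2 : ℝ≥0∞) ^ (p / (p - q)) * 2 ^ (-(p / (p - q)))) *
              (y ^ (-(p / (p - q))) * y * beta q r μ ν z ^ (p * (1 - q) / (p - q))) := by
              rw [e1, one_mul]
          _ = _ := by ring
    _ ≤ 2 ^ (p / (p - q)) * ∫⁻ s in Ioc x z, ω (Ioi s) ^ (-(p / (p - q))) *
          beta q r μ ν s ^ (p * (1 - q) / (p - q)) ∂ω := by
        gcongr 2 ^ (p / (p - q)) * ?_
        refine setLIntegral_mono' measurableSet_Ioc fun s hs => mul_le_mul' ?_ ?_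
        · rw [ENNReal.rpow_neg, ENNReal.rpow_neg, ← hxy]
          exact ENNReal.inv_le_inv.2 (ENNReal.rpow_le_rpow (antitone_measure_Ioi ω hs.1.le) hκ)
        · exact ENNReal.rpow_le_rpow
            (antitone_beta hq.le (by linarith) hr.le hr1.le μ ν hs.2) (by positivity)
    _ ≤ _ := by
        gcongr 2 ^ (p / (p - q)) * ?_
        exact setLIntegral_le_lintegral _ _

end IsAdmissible

theorem exists_energy_le_of_isAdmissible (hr : 0 < r) (hrq : r ≤ q) (hqp : q < p)
    (hp1 : p < 1) : ∃ c : ℝ≥0, ∀ (a : ℝ) (μ ν ω : Measure ℝ), IsAdmissible a μ ν ω →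
      ∀ C, MeasureIneq p q r μ ν ω C → energy p q r a μ ν ω ≤ c * C ^ (p / (p - q)) := by
  have hq : 0 < q := by linarith
  have hp : 0 < p := by linarith
  have hpq : 0 < p - q := by linarith
  have h1q : 0 < 1 - q := by linarith
  have he : 0 < p * (1 - q) / (p - q) := by positivity
  obtain ⟨c, hc⟩ := exists_energy_le_of_isRegular hr hrq hqp hp1
  refine ⟨3 * c, fun a μ ν ω h C hC => ?_⟩
  obtain ⟨A, P, Q, hP, hQ, hA, hQA, hAa, hAor, hreg⟩ := h.exists_truncation
  have hn := fun n => hc _ _ _ _ (hreg n) C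
    (hC.restrict hr hp (P n) (hQ.measurable n) (hQA n))
  set D : ℝ≥0∞ := c * C ^ (p / (p - q)) with hD
  have h1 : tailEnergy p q r μ ν ω ≤ D := by
    rw [← iSup_tailEnergy_restrict hr (by linarith) hq hqp hp1 hP hQ hA]
    exact iSup_le fun n => (le_self_add.trans le_self_add).trans (hn n)
  have h2 : kernEnergy p q r μ ν ω ≤ D := by
    rw [← iSup_kernEnergy_restrict hr hrq hqp hp1 hP hQ hA]
    exact iSup_le fun n => le_add_self.trans (hn n)
  have h3 : endEnergy p q r a μ ν ω ≤ D := by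
    rcases hAor with htop | hAeq
    · rw [endEnergy, htop, ENNReal.top_rpow_of_neg (by simp only [neg_lt_zero]; positivity),
        zero_mul]
      exact zero_le
    · rw [endEnergy, ← iSup_beta_restrict hr (by linarith) hq (by linarith) hP hQ,
        ← iSup_rpow _ he, ENNReal.mul_iSup]
      refine iSup_le fun n => le_trans (le_trans (le_of_eq ?_)
        ((le_add_self (a := endEnergy p q r (A n) (μ.restrict (P n)) (ν.restrict (Q n))
          (ω.restrict (Ioi (A n))))).trans le_self_add)) (hn n)
      rw [endEnergy, restrict_Ioi_apply_Ioi ω le_rfl, hAeq n]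
  calc energy p q r a μ ν ω ≤ D + D + D := add_le_add (add_le_add h1 h3) h2
    _ = _ := by rw [hD]; push_cast; ring

theorem exists_measureIneq_of_isAdmissible (hr : 0 < r) (hrq : r ≤ q) (hqp : q < p)
    (hp1 : p < 1) : ∃ c : ℝ≥0, ∀ (a : ℝ) (μ ν ω : Measure ℝ), IsAdmissible a μ ν ω →
      MeasureIneq p q r μ ν ω (c * energy p q r a μ ν ω ^ ((p - q) / p)) := by
  have hq : 0 < q := by linarith
  have hp : 0 < p := by linarith
  have hpq : 0 < p - q := by linarith
  have h1q : 0 < 1 - q := by linarith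
  have he : 0 < p * (1 - q) / (p - q) := by positivity
  obtain ⟨c, hc⟩ := exists_measureIneq_of_isRegular hr hrq hqp hp1
  refine ⟨c * (2 + 2 ^ (p / (p - q))) ^ ((p - q) / p), fun a μ ν ω h => ?_⟩
  obtain ⟨A, P, Q, hP, hQ, hA, hQA, hAa, hAor, hreg⟩ := h.exists_truncation
  refine measureIneq_of_restrict hr hq hp hP hQ (A := A) fun n g hg =>
    (hc _ _ _ _ (hreg n) g hg).trans (mul_le_mul' ?_ le_rfl)
  push_cast [ENNReal.coe_rpow_of_nonneg _ (by positivity : 0 ≤ (p - q) / p),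
    ENNReal.coe_rpow_of_nonneg _ (by positivity : 0 ≤ p / (p - q))]
  rw [mul_assoc, ← ENNReal.mul_rpow_of_nonneg _ _ (by positivity)]
  refine mul_le_mul' le_rfl (ENNReal.rpow_le_rpow ?_ (by positivity))
  set T := tailEnergy p q r μ ν ω with hT
  set E := endEnergy p q r a μ ν ω with hE
  set K := kernEnergy p q r μ ν ω with hK
  have h1 : tailEnergy p q r (μ.restrict (P n)) (ν.restrict (Q n)) (ω.restrict (Ioi (A n))) ≤ T := by
    rw [hT, ← iSup_tailEnergy_restrict hr (by linarith) hq hqp hp1 hP hQ hA]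
    exact le_iSup (fun n => tailEnergy p q r (μ.restrict (P n)) (ν.restrict (Q n))
      (ω.restrict (Ioi (A n)))) n
  have h2 : kernEnergy p q r (μ.restrict (P n)) (ν.restrict (Q n)) (ω.restrict (Ioi (A n))) ≤ K := by
    rw [hK, ← iSup_kernEnergy_restrict hr hrq hqp hp1 hP hQ hA]
    exact le_iSup (fun n => kernEnergy p q r (μ.restrict (P n)) (ν.restrict (Q n))
      (ω.restrict (Ioi (A n)))) n
  have h3 : endEnergy p q r (A n) (μ.restrict (P n)) (ν.restrict (Q n)) (ω.restrict (Ioi (A n))) ≤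
      2 ^ (p / (p - q)) * T + E := by
    have hle : endEnergy p q r (A n) (μ.restrict (P n)) (ν.restrict (Q n))
        (ω.restrict (Ioi (A n))) ≤
        ω (Ioi (A n)) ^ (-(q / (p - q))) * beta q r μ ν (A n) ^ (p * (1 - q) / (p - q)) := by
      rw [endEnergy, restrict_Ioi_apply_Ioi ω le_rfl]
      refine mul_le_mul' le_rfl (ENNReal.rpow_le_rpow ?_ he.le)
      rw [← iSup_beta_restrict hr (by linarith) hq (by linarith) hP hQ]
      exact le_iSup (fun n => beta q r (μ.restrict (P n)) (ν.restrict (Q n)) (A _)) n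
    refine hle.trans ?_
    rcases hAor with htop | hAeq
    · have hfin := (hreg n).finite_right
      have hz0 : ω (Ioi (A n)) ≠ 0 := by
        have := (hreg n).ne_zero
        rwa [Ne, Measure.restrict_eq_zero] at this
      have hzt : ω (Ioi (A n)) ≠ ∞ := by
        have := measure_ne_top (ω.restrict (Ioi (A n))) univ
        rwa [Measure.restrict_apply_univ] at this
      exact (h.rpow_mul_le_tailEnergy hr (by linarith) hq hqp hp1 htop hz0 hzt).trans le_self_add
    · rw [hAeq n]
      exact le_add_self
  have hT' : T ≤ T + E + K := le_self_add.trans le_self_add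
  calc _ ≤ T + (2 ^ (p / (p - q)) * T + E) + K := add_le_add (add_le_add h1 h3) h2
    _ = (T + E + K) + 2 ^ (p / (p - q)) * T := by ring
    _ ≤ 2 * (T + E + K) + 2 ^ (p / (p - q)) * (T + E + K) := by
        refine add_le_add ?_ (mul_le_mul' le_rfl hT')
        rw [two_mul]; exact le_self_add
    _ = _ := by rw [energy]; ring

end CesaroEmbedding

/-! ### Translation between weights on an interval and measures on the line. -/

namespace CesaroEmbedding

open Set

theorem measurableSet_interval (x y : EReal) : MeasurableSet (interval x y) :=
  (measurableSet_lt measurable_const measurable_coe_real_ereal).inter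
    (measurableSet_lt measurable_coe_real_ereal measurable_const)

theorem Ioi_inter_interval {a x : ℝ} (hx : a ≤ x) (b : EReal) :
    Ioi x ∩ interval a b = interval x b := by
  ext s
  simp only [interval, mem_inter_iff, mem_Ioi, mem_ofPred_eq, EReal.coe_lt_coe_iff]
  exact ⟨fun h => ⟨h.1, h.2.2⟩, fun h => ⟨h.1, lt_of_le_of_lt hx h.1, h.2⟩⟩

theorem Ioo_inter_interval {a x t : ℝ} {b : EReal} (hx : a ≤ x) (ht : (t : EReal) ≤ b) :
    Ioo x t ∩ interval a b = interval x t := by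
  ext s
  simp only [interval, mem_inter_iff, mem_Ioo, mem_ofPred_eq, EReal.coe_lt_coe_iff]
  exact ⟨fun h => h.1, fun h => ⟨h, lt_of_le_of_lt hx h.1,
    lt_of_lt_of_le (EReal.coe_lt_coe_iff.2 h.2) ht⟩⟩

theorem Iio_inter_interval {a t : ℝ} {b : EReal} (ht : (t : EReal) ≤ b) :
    Iio t ∩ interval a b = interval a t := by
  ext s
  simp only [interval, mem_inter_iff, mem_Iio, mem_ofPred_eq, EReal.coe_lt_coe_iff]
  exact ⟨fun h => ⟨h.2.1, h.1⟩, fun h => ⟨h.2, h.1,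
    lt_of_lt_of_le (EReal.coe_lt_coe_iff.2 h.2) ht⟩⟩

/-- The measure on the real line with density `g` on the interval from `a` to `b`. -/
noncomputable def weightMeasure (a b : EReal) (g : ℝ → ℝ≥0∞) : Measure ℝ :=
  (volume.restrict (interval a b)).withDensity g

section

variable {a : ℝ} {b : EReal} {g : ℝ → ℝ≥0∞}

theorem weightMeasure_apply {s : Set ℝ} (hs : MeasurableSet s) :
    weightMeasure a b g s = ∫⁻ t in s ∩ interval a b, g t := by
  rw [weightMeasure, withDensity_apply _ hs, Measure.restrict_restrict hs]

theorem weightMeasure_Ioi {x : ℝ} (hx : a ≤ x) : weightMeasure a b g (Ioi x) = integral x b g := by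
  rw [weightMeasure_apply measurableSet_Ioi, Ioi_inter_interval hx, integral]

theorem weightMeasure_Ioo {x t : ℝ} (hx : a ≤ x) (ht : (t : EReal) ≤ b) :
    weightMeasure a b g (Ioo x t) = integral x t g := by
  rw [weightMeasure_apply measurableSet_Ioo, Ioo_inter_interval hx ht, integral]

theorem weightMeasure_Iic : weightMeasure a b g (Iic a) = 0 := by
  rw [weightMeasure_apply measurableSet_Iic, show Iic a ∩ interval a b = ∅ from ?_]
  · simp
  · ext s
    simp only [interval, mem_inter_iff, mem_Iic, mem_ofPred_eq, EReal.coe_lt_coe_iff,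
      mem_empty_iff_false, iff_false]
    exact fun h => not_lt.2 h.1 h.2.1

theorem setLIntegral_weightMeasure (hg : MeasurableOn a b g) {F : ℝ → ℝ≥0∞} (hF : Measurable F)
    {s : Set ℝ} (hs : MeasurableSet s) :
    ∫⁻ t in s, F t ∂(weightMeasure a b g) = ∫⁻ t in s ∩ interval a b, g t * F t := by
  rw [weightMeasure, restrict_withDensity hs, Measure.restrict_restrict hs,
    lintegral_withDensity_eq_lintegral_mul₀ _ hF.aemeasurable]
  · rfl
  · exact hg.mono_measure (Measure.restrict_mono inter_subset_right le_rfl)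

theorem lintegral_weightMeasure (hg : MeasurableOn a b g) {F : ℝ → ℝ≥0∞} (hF : Measurable F) :
    ∫⁻ t, F t ∂(weightMeasure a b g) = ∫⁻ t in interval a b, g t * F t := by
  rw [← setLIntegral_univ, setLIntegral_weightMeasure hg hF MeasurableSet.univ, univ_inter]

theorem ae_weightMeasure {P : ℝ → Prop} (h : ∀ t ∈ interval a b, P t) :
    ∀ᵐ t ∂(weightMeasure a b g), P t :=
  (withDensity_absolutelyContinuous _ _).ae_le
    ((ae_restrict_iff' (measurableSet_interval _ _)).2 (.of_forall h))

theorem sigmaFinite_weightMeasure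
    (hg : ∀ᵐ t ∂(volume.restrict (interval a b)), g t ≠ ∞) :
    SigmaFinite (weightMeasure a b g) :=
  SigmaFinite.withDensity_of_ne_top hg

end

section

variable {p q r a : ℝ} {b : EReal} {u v w : ℝ → ℝ≥0∞}

theorem IsWeight.rpow (hv : IsWeight a b v) (e : ℝ) : IsWeight a b fun s => v s ^ e where
  measurableOn := AEMeasurable.pow_const hv.measurableOn e
  pos_finite := by
    filter_upwards [hv.pos_finite] with t ht
    exact ⟨ENNReal.rpow_pos ht.1 ht.2.ne,
      (ENNReal.rpow_ne_top_of_ne_zero ht.1.ne' ht.2.ne).lt_top⟩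

theorem isAdmissible_weightMeasure (hab : (a : EReal) < b) (hu : IsWeight a b u)
    (hv : IsWeight a b v) (hW : ∀ x ∈ interval a b, 0 < W b w x ∧ W b w x < ∞) :
    IsAdmissible a (weightMeasure a b u) (weightMeasure a b v) (weightMeasure a b w) where
  sigmaFinite_left := sigmaFinite_weightMeasure (hu.pos_finite.mono fun _ h => h.2.ne)
  atomless_left := by unfold weightMeasure; infer_instance
  sigmaFinite_mid := sigmaFinite_weightMeasure (hv.pos_finite.mono fun _ h => h.2.ne)
  atomless_right := by unfold weightMeasure; infer_instance
  null_left := weightMeasure_Iic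
  null_mid := weightMeasure_Iic
  null_right := weightMeasure_Iic
  ne_zero := by
    obtain ⟨x, hx⟩ := EReal.lt_iff_exists_real_btwn.1 hab
    have := (hW x hx).1
    rw [W, ← weightMeasure_Ioi (EReal.coe_le_coe_iff.1 hx.1.le)] at this
    exact fun h => by simp [h] at this
  tail_ne_top x hx := by
    rw [weightMeasure_Ioi hx.le]
    rcases lt_or_ge (x : EReal) b with h | h
    · exact (hW x ⟨EReal.coe_lt_coe_iff.2 hx, h⟩).2.ne
    · have : interval x b = ∅ := by
        ext s
        simp only [interval, mem_ofPred_eq, mem_empty_iff_false, iff_false]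
        exact fun hs => not_lt.2 h (hs.1.trans hs.2)
      simp [integral, this]
  tail_pos := ae_weightMeasure fun t ht => by
    rw [weightMeasure_Ioi (EReal.coe_le_coe_iff.1 ht.1.le)]
    exact (hW t ht).1

theorem V_rpow_eq (e : ℝ) {x t : ℝ} (hx : a ≤ x) (ht : (t : EReal) ≤ b) :
    V r v x t ^ e = weightMeasure a b (fun s => v s ^ (1 / (1 - r))) (Ioo x t) ^
      ((1 - r) / r * e) := by
  rw [V, weightMeasure_Ioo hx ht, ENNReal.rpow_mul]

/-- `beta` integrates over all t, but for t ≤ x the interval (x, t) is empty and its positive power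
vanishes. -/
theorem beta_weightMeasure (hr : 0 < r) (hr1 : r < 1) (hq : 0 < q) (hq1 : q < 1)
    (hu : IsWeight a b u) {x : ℝ} (hx : a ≤ x) :
    (integral x b fun t => integral t b u ^ (q / (1 - q)) * u t * V r v x t ^ (q / (1 - q))) =
      beta q r (weightMeasure a b u) (weightMeasure a b fun s => v s ^ (1 / (1 - r))) x := by
  have h1 : 0 < 1 - r := by linarith
  have h2 : 0 < 1 - q := by linarith
  set μ := weightMeasure a b u with hμ
  set ν := weightMeasure a b fun s => v s ^ (1 / (1 - r)) with hν
  have hm : Measurable fun t => μ (Ioi t) ^ (q / (1 - q)) *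
      ν (Ioo x t) ^ (q * (1 - r) / (r * (1 - q))) := by
    refine (measurable_measure_Ioi_rpow μ _).mul ?_
    simp only [← restrict_Ioi_apply_Iio]
    exact measurable_measure_Iio_rpow _ _
  have hset : beta q r μ ν x = ∫⁻ t in Ioi x, μ (Ioi t) ^ (q / (1 - q)) *
      ν (Ioo x t) ^ (q * (1 - r) / (r * (1 - q))) ∂μ := by
    rw [beta_eq, ← lintegral_indicator measurableSet_Ioi]
    refine lintegral_congr fun t => ?_
    by_cases ht : t ∈ Ioi x
    · rw [indicator_of_mem ht]
    · rw [indicator_of_notMem ht, Ioo_eq_empty (fun h => ht h), measure_empty,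
        ENNReal.zero_rpow_of_pos (by positivity), mul_zero]
  rw [hset, hμ, setLIntegral_weightMeasure hu.measurableOn hm measurableSet_Ioi,
    Ioi_inter_interval hx, integral]
  refine setLIntegral_congr_fun (measurableSet_interval _ _) fun t ht => ?_
  have hxt : x < t := EReal.coe_lt_coe_iff.1 ht.1
  rw [weightMeasure_Ioi (hx.trans hxt.le), V_rpow_eq _ hx ht.2.le,
    show (1 - r) / r * (q / (1 - q)) = q * (1 - r) / (r * (1 - q)) by field_simp]
  ring

theorem C5_eq (hr : 0 < r) (hr1 : r < 1) (hq : 0 < q) (hqp : q < p) (hp1 : p < 1)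
    (hu : IsWeight a b u) (hw : IsWeight a b w) :
    C5 p q r a b u v w =
      tailEnergy p q r (weightMeasure a b u) (weightMeasure a b fun s => v s ^ (1 / (1 - r)))
          (weightMeasure a b w) ^ ((p - q) / (p * q)) +
        endEnergy p q r a (weightMeasure a b u) (weightMeasure a b fun s => v s ^ (1 / (1 - r)))
          (weightMeasure a b w) ^ ((p - q) / (p * q)) := by
  have h1 : 0 < 1 - q := by linarith
  have hpq : 0 < p - q := by linarith
  have hp : 0 < p := by linarith
  rw [C5]
  congr 1
  · rw [tailEnergy, lintegral_weightMeasure hw.measurableOn (by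
      exact (measurable_measure_Ioi_rpow _ _).mul
        ((antitone_beta hq.le (by linarith) hr.le hr1.le _ _).measurable.pow_const _)), integral]
    congr 1
    refine setLIntegral_congr_fun (measurableSet_interval _ _) fun x hx => ?_
    have hax : a ≤ x := EReal.coe_le_coe_iff.1 hx.1.le
    rw [beta_weightMeasure hr hr1 hq (by linarith) hu hax, weightMeasure_Ioi hax, W]
    ring
  · rw [beta_weightMeasure hr hr1 hq (by linarith) hu le_rfl, W, ← weightMeasure_Ioi le_rfl,
      endEnergy, ENNReal.mul_rpow_of_nonneg _ _ (by positivity), ← ENNReal.rpow_mul,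
      ← ENNReal.rpow_mul]
    congr 2 <;> field_simp

theorem C6_eq (hr : 0 < r) (hrq : r ≤ q) (hqp : q < p) (hp1 : p < 1)
    (hu : IsWeight a b u) (hw : IsWeight a b w) :
    C6 p q r a b u v w =
      kernEnergy p q r (weightMeasure a b u) (weightMeasure a b fun s => v s ^ (1 / (1 - r)))
          (weightMeasure a b w) ^ ((p - q) / (p * q)) := by
  have hpr : 0 < p - r := by linarith
  have hp : 0 < p := by linarith
  rw [C6, kernEnergy, lintegral_weightMeasure hu.measurableOn (by
    exact (measurable_measure_Ioi_rpow _ _).mul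
      ((monotone_kern hp.le (by linarith) (by linarith) _ _).measurable.pow_const _)), integral]
  congr 1
  refine setLIntegral_congr_fun (measurableSet_interval _ _) fun x hx => ?_
  have hax : a ≤ x := EReal.coe_le_coe_iff.1 hx.1.le
  have hm : Measurable fun s => weightMeasure a b (fun s => v s ^ (1 / (1 - r))) (Ioo s x) :=
    Antitone.measurable fun s s' h => measure_mono (Ioo_subset_Ioo_left h)
  have hk : kern p r (weightMeasure a b fun s => v s ^ (1 / (1 - r))) (weightMeasure a b w) x =
      integral a x fun t =>
        W b w t ^ (-(p / (p - r))) * w t * V r v t x ^ (p * r / (p - r)) := by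
    rw [kern, setLIntegral_weightMeasure hw.measurableOn
      (by exact (measurable_measure_Ioi_rpow _ _).mul (hm.pow_const _)) measurableSet_Iio,
      Iio_inter_interval hx.2.le, integral]
    refine setLIntegral_congr_fun (measurableSet_interval _ _) fun t ht => ?_
    have hat : a ≤ t := EReal.coe_le_coe_iff.1 ht.1.le
    rw [weightMeasure_Ioi hat, V_rpow_eq _ hat hx.2.le, W,
      show (1 - r) / r * (p * r / (p - r)) = p * (1 - r) / (p - r) by field_simp]
    ring
  rw [weightMeasure_Ioi hax, hk]
  ring

theorem integral_eq_setLIntegral_weightMeasure {ρ f F : ℝ → ℝ≥0∞} (hρ : MeasurableOn a b ρ)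
    (hF : Measurable F) (hf : f =ᵐ[volume.restrict (interval a b)] fun s => ρ s * F s)
    {t : ℝ} (ht : (t : EReal) ≤ b) :
    integral a t f = ∫⁻ s in Iio t, F s ∂(weightMeasure a b ρ) := by
  rw [setLIntegral_weightMeasure hρ hF measurableSet_Iio, Iio_inter_interval ht, integral]
  refine lintegral_congr_ae (ae_mono (Measure.restrict_mono ?_ le_rfl) hf)
  rw [← Iio_inter_interval ht]
  exact inter_subset_right

/-- The density v^{1/(1-r)} is the one that serves both sides: f = v^{1/(1-r)} h gives f^r v =
v^{1/(1-r)} h^r, since r/(1-r) + 1 = 1/(1-r). -/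
theorem lhs_eq (hr1 : r < 1) (hr : 0 < r) (hu : IsWeight a b u) (hv : IsWeight a b v)
    {f h : ℝ → ℝ≥0∞} (hh : Measurable h)
    (hf : f =ᵐ[volume.restrict (interval a b)] fun s => v s ^ (1 / (1 - r)) * h s) :
    lhs q r a b u v f = (∫⁻ t, (∫⁻ s in Iio t, h s ^ r
      ∂(weightMeasure a b fun s => v s ^ (1 / (1 - r)))) ^ (q / r) ∂(weightMeasure a b u)) ^
        (1 / q) := by
  have h1 : 0 < 1 - r := by linarith
  have hf' : (fun s => f s ^ r * v s) =ᵐ[volume.restrict (interval a b)]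
      fun s => v s ^ (1 / (1 - r)) * h s ^ r := by
    filter_upwards [hf, hv.pos_finite] with s hs hvs
    rw [hs, ENNReal.mul_rpow_of_nonneg _ _ hr.le, ← ENNReal.rpow_mul,
      show 1 / (1 - r) = 1 / (1 - r) * r + 1 by field_simp; ring,
      ENNReal.rpow_add _ _ hvs.1.ne' hvs.2.ne, ENNReal.rpow_one,
      show (1 / (1 - r) * r + 1) * r = 1 / (1 - r) * r by field_simp; ring]
    ring
  rw [lhs, lintegral_weightMeasure hu.measurableOn
    ((monotone_setLIntegral_Iio _ _).measurable.pow_const _), integral]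
  congr 1
  refine setLIntegral_congr_fun (measurableSet_interval _ _) fun t ht => ?_
  rw [integral_eq_setLIntegral_weightMeasure (hv.rpow _).measurableOn (hh.pow_const r) hf' ht.2.le,
    mul_comm]

theorem rhs_eq (hv : IsWeight a b v) (hw : IsWeight a b w) {f h : ℝ → ℝ≥0∞} (hh : Measurable h)
    (hf : f =ᵐ[volume.restrict (interval a b)] fun s => v s * h s) :
    rhs p a b w f = (∫⁻ t, (∫⁻ s in Iio t, h s ∂(weightMeasure a b v)) ^ p
      ∂(weightMeasure a b w)) ^ (1 / p) := by
  rw [rhs, lintegral_weightMeasure hw.measurableOn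
    ((monotone_setLIntegral_Iio _ _).measurable.pow_const _), integral]
  congr 1
  refine setLIntegral_congr_fun (measurableSet_interval _ _) fun t ht => ?_
  rw [integral_eq_setLIntegral_weightMeasure hv.measurableOn hh hf ht.2.le, mul_comm]

theorem inequalityHolds_iff (hr : 0 < r) (hr1 : r < 1) (hq : 0 < q)
    (hu : IsWeight a b u) (hv : IsWeight a b v) (hw : IsWeight a b w) (C : ℝ≥0∞) :
    InequalityHolds p q r a b u v w C ↔
      MeasureIneq p q r (weightMeasure a b u) (weightMeasure a b fun s => v s ^ (1 / (1 - r)))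
        (weightMeasure a b w) (C ^ q) := by
  have hρ := hv.rpow (1 / (1 - r))
  have key : ∀ X Y : ℝ≥0∞, X ^ (1 / q) ≤ C * Y ^ (1 / p) ↔ X ≤ C ^ q * Y ^ (q / p) := by
    intro X Y
    rw [← ENNReal.rpow_le_rpow_iff hq, ← ENNReal.rpow_mul, ENNReal.mul_rpow_of_nonneg _ _ hq.le,
      ← ENNReal.rpow_mul, one_div_mul_cancel hq.ne', ENNReal.rpow_one,
      show 1 / p * q = q / p by ring]
  constructor
  · intro H h hh
    have := H (fun s => v s ^ (1 / (1 - r)) * h s) (hρ.measurableOn.mul hh.aemeasurable)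
    rwa [lhs_eq hr1 hr hu hv hh .rfl, rhs_eq hρ hw hh .rfl, key] at this
  · intro H f hf
    -- The substitution is inverted almost everywhere, v being positive and finite there; a Borel
    -- representative is taken because `MeasureIneq` tests only measurable functions.
    have hm : AEMeasurable (fun s => f s * (v s ^ (1 / (1 - r)))⁻¹)
        (volume.restrict (interval a b)) := hf.mul hρ.measurableOn.inv
    have hfh : f =ᵐ[volume.restrict (interval a b)]
        fun s => v s ^ (1 / (1 - r)) * hm.mk _ s := by
      filter_upwards [hm.ae_eq_mk, hρ.pos_finite] with s hs hvs
      rw [← hs, mul_comm, mul_assoc, ENNReal.inv_mul_cancel hvs.1.ne' hvs.2.ne, mul_one]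
    rw [lhs_eq hr1 hr hu hv hm.measurable_mk hfh, rhs_eq hρ hw hm.measurable_mk hfh, key]
    exact H _ hm.measurable_mk

end

/-! ### Two-sided estimate of the best constant. -/

/-- The best constant is comparable to the sum of the two conditions, and it is admissible up to
a constant factor. -/
theorem exists_const_inequalityHolds {p q r : ℝ} (hr : 0 < r) (hrq : r ≤ q) (hqp : q < p)
    (hp1 : p < 1) : ∃ c : ℝ≥0, 0 < c ∧ ∀ (a : ℝ) (b : EReal) (u v w : ℝ → ℝ≥0∞), (a : EReal) < b →
      IsWeight a b u → IsWeight a b v → IsWeight a b w →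
      (∀ x ∈ interval a b, 0 < W b w x ∧ W b w x < ∞) →
      InequalityHolds p q r a b u v w (c * (C5 p q r a b u v w + C6 p q r a b u v w)) ∧
      ∀ C, InequalityHolds p q r a b u v w C →
        C5 p q r a b u v w + C6 p q r a b u v w ≤ c * C := by
  have hq : 0 < q := by linarith
  have hp : 0 < p := by linarith
  have hpq : 0 < p - q := by linarith
  have hr1 : r < 1 := by linarith
  set e := (p - q) / (p * q) with he
  have he0 : 0 < e := by positivity
  obtain ⟨k₁, h₁⟩ := exists_energy_le_of_isAdmissible hr hrq hqp hp1
  obtain ⟨k₂, h₂⟩ := exists_measureIneq_of_isAdmissible hr hrq hqp hp1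
  -- The first summand serves the lower bound, the second the upper bound (two splittings of the
  -- power e of a sum), and the 1 makes the constant positive.
  refine ⟨3 * k₁ ^ e + k₂ ^ (1 / q) * (2 ^ e * 2 ^ e) + 1, by positivity,
    fun a b u v w hab hu hv hw hW => ?_⟩
  have hadm := isAdmissible_weightMeasure hab hu (hv.rpow (1 / (1 - r))) hW
  rw [C5_eq hr hr1 hq hqp hp1 hu hw, C6_eq hr hrq hqp hp1 hu hw]
  set μ := weightMeasure a b u
  set ν := weightMeasure a b fun s => v s ^ (1 / (1 - r))
  set ω := weightMeasure a b w
  push_cast [ENNReal.coe_rpow_of_nonneg _ he0.le,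
    ENNReal.coe_rpow_of_nonneg _ (by positivity : 0 ≤ 1 / q)]
  rw [← he]
  constructor
  · rw [inequalityHolds_iff hr hr1 hq hu hv hw]
    intro h hh
    refine (h₂ a μ ν ω hadm h hh).trans (mul_le_mul' ?_ le_rfl)
    rw [← ENNReal.rpow_le_rpow_iff (z := 1 / q) (by positivity), ← ENNReal.rpow_mul,
      mul_one_div_cancel hq.ne', ENNReal.rpow_one, ENNReal.mul_rpow_of_nonneg _ _ (by positivity),
      ← ENNReal.rpow_mul, show (p - q) / p * (1 / q) = e by rw [he]; field_simp]
    have hE : energy p q r a μ ν ω ^ e ≤ 2 ^ e * 2 ^ e * (tailEnergy p q r μ ν ω ^ e +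
        endEnergy p q r a μ ν ω ^ e + kernEnergy p q r μ ν ω ^ e) := by
      have h2 : (1 : ℝ≥0∞) ≤ 2 ^ e := ENNReal.one_le_rpow one_le_two he0
      calc energy p q r a μ ν ω ^ e ≤ 2 ^ e * ((tailEnergy p q r μ ν ω +
            endEnergy p q r a μ ν ω) ^ e + kernEnergy p q r μ ν ω ^ e) :=
            add_rpow_le_two_rpow_mul _ _ he0.le
        _ ≤ 2 ^ e * (2 ^ e * (tailEnergy p q r μ ν ω ^ e + endEnergy p q r a μ ν ω ^ e) +
            2 ^ e * kernEnergy p q r μ ν ω ^ e) := by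
            gcongr
            · exact add_rpow_le_two_rpow_mul _ _ he0.le
            · exact le_mul_of_one_le_left' h2
        _ = _ := by ring
    calc _ ≤ (k₂ : ℝ≥0∞) ^ (1 / q) * (2 ^ e * 2 ^ e * (tailEnergy p q r μ ν ω ^ e +
        endEnergy p q r a μ ν ω ^ e + kernEnergy p q r μ ν ω ^ e)) := by gcongr
      _ = (k₂ : ℝ≥0∞) ^ (1 / q) * (2 ^ e * 2 ^ e) * (tailEnergy p q r μ ν ω ^ e +
        endEnergy p q r a μ ν ω ^ e + kernEnergy p q r μ ν ω ^ e) := by ring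
      _ ≤ _ := by
        gcongr
        exact le_add_self.trans le_self_add
  · intro C hC
    rw [inequalityHolds_iff hr hr1 hq hu hv hw] at hC
    have hE : energy p q r a μ ν ω ^ e ≤ (k₁ : ℝ≥0∞) ^ e * C := by
      refine (ENNReal.rpow_le_rpow (h₁ a μ ν ω hadm _ hC) he0.le).trans (le_of_eq ?_)
      rw [ENNReal.mul_rpow_of_nonneg _ _ he0.le, ← ENNReal.rpow_mul, ← ENNReal.rpow_mul,
        show q * (p / (p - q) * e) = 1 by rw [he]; field_simp, ENNReal.rpow_one]
    calc _ ≤ energy p q r a μ ν ω ^ e + energy p q r a μ ν ω ^ e + energy p q r a μ ν ω ^ e := by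
          refine add_le_add (add_le_add ?_ ?_) ?_ <;> refine ENNReal.rpow_le_rpow ?_ he0.le
          · exact le_self_add.trans le_self_add
          · exact le_add_self.trans le_self_add
          · exact le_add_self
      _ = 3 * energy p q r a μ ν ω ^ e := by ring
      _ ≤ 3 * ((k₁ : ℝ≥0∞) ^ e * C) := by gcongr
      _ = 3 * (k₁ : ℝ≥0∞) ^ e * C := by ring
      _ ≤ _ := by
        gcongr
        rw [add_assoc]
        exact le_self_add

end CesaroEmbedding

theorem theorem2p2 (p q r : ℝ) (hr : 0 < r) (hrq : r ≤ q) (hqp : q < p) (hp : p < 1) :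
    ∃ c₁ c₂ : ℝ≥0, 0 < c₁ ∧ 0 < c₂ ∧
      ∀ (a b : EReal) (u v w : ℝ → ℝ≥0∞), 0 ≤ a → a < b →
        CesaroEmbedding.IsWeight a b u → CesaroEmbedding.IsWeight a b v →
        CesaroEmbedding.IsWeight a b w →
        (∀ x ∈ CesaroEmbedding.interval a b,
          0 < CesaroEmbedding.W b w x ∧ CesaroEmbedding.W b w x < ∞) →
        ((∃ C : ℝ≥0, CesaroEmbedding.InequalityHolds p q r a b u v w C) ↔
          max (CesaroEmbedding.C5 p q r a b u v w) (CesaroEmbedding.C6 p q r a b u v w) < ∞) ∧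
        c₁ * (CesaroEmbedding.C5 p q r a b u v w + CesaroEmbedding.C6 p q r a b u v w) ≤
          CesaroEmbedding.bestConstant p q r a b u v w ∧
        CesaroEmbedding.bestConstant p q r a b u v w ≤
          c₂ * (CesaroEmbedding.C5 p q r a b u v w + CesaroEmbedding.C6 p q r a b u v w) := by
  obtain ⟨c, hc0, hc⟩ := CesaroEmbedding.exists_const_inequalityHolds hr hrq hqp hp
  refine ⟨c⁻¹, c, inv_pos.2 hc0, hc0, fun a b u v w ha hab hu hv hw hW => ?_⟩
  -- The left end point is a real number because 0 ≤ a < b; only b may be infinite.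
  have ha' : ((a.toReal : ℝ) : EReal) = a :=
    EReal.coe_toReal hab.ne_top (lt_of_lt_of_le EReal.bot_lt_zero ha).ne'
  generalize a.toReal = α at ha'
  subst ha'
  obtain ⟨hup, hlow⟩ := hc α b u v w hab hu hv hw hW
  refine ⟨⟨?_, fun h => ?_⟩, ?_, sInf_le hup⟩
  · rintro ⟨C, hC⟩
    have h := (hlow C hC).trans_lt (ENNReal.mul_lt_top ENNReal.coe_lt_top ENNReal.coe_lt_top)
    exact max_lt (lt_of_le_of_lt le_self_add h) (lt_of_le_of_lt le_add_self h)
  · have hne : (c : ℝ≥0∞) * (CesaroEmbedding.C5 p q r α b u v w +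
        CesaroEmbedding.C6 p q r α b u v w) ≠ ∞ :=
      ENNReal.mul_ne_top ENNReal.coe_ne_top
        (ENNReal.add_ne_top.2 ⟨((le_max_left _ _).trans_lt h).ne, ((le_max_right _ _).trans_lt h).ne⟩)
    exact ⟨_, by rw [ENNReal.coe_toNNReal hne]; exact hup⟩
  · refine le_sInf fun C hC => ?_
    rw [ENNReal.coe_inv hc0.ne', ENNReal.inv_mul_le_iff (by simpa using hc0.ne') (by simp)]
    exact hlow C hC
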